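/- Let $n\ge 1$ and let $\kappa=(\kappa_1,\dots,\kappa_n)$ be a vector of positive integers; put $|\kappa|=\sum_l\kappa_l$, $\gamma\cdot\kappa=\sum_l\gamma_l\kappa_l$ for multi-indices $\gamma\in\mathbb{N}_0^n$, and $|x|_\kappa=\big(\sum_{l=1}^n|x^l|^{2/\kappa_l}\big)^{1/2}$ for $x\in\mathbb{R}^n$. All functions are complex-valued, $\hat f(\xi)=\int_{\mathbb{R}^n} f(x)e^{-2\pi i x\cdot\xi}\,dx$, extended as usual to $L^2(\mathbb{R}^n)$ and to tempered distributions, and ${}^\vee$ is its inverse. Let $m$ be bounded and smooth on $\mathbb{R}^n\setminus\{0\}$, and assume that for every multi-index $\gamma$ $$A_\gamma:=\sup_{R>0}R^{-|\kappa|+\gamma\cdot\kappa}\int_{R<|\xi|_\kappa<2R}|D^\gamma m(\xi)|\,d\xi<\infty .$$ (A) The operator $Tf=(m\hat f)^\vee$ on $L^2(\mathbb{R}^n)$ is of weak type $(1,1)$ and of strong type $(p,p)$ for every $p\in(1,\infty)$: there is a linear map $T_1$ from $L^1(\mathbb{R}^n)$ to (classes of) measurable functions that agrees with $T$ on $L^1\cap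 L^2$, and a constant $C$ such that $t\,|\{x:|T_1f(x)|>t\}|\le C\|f\|_{L^1}$ for all $f\in L^1$, $t>0$; and for every $p\in(1,\infty)$ there is a bounded linear operator $T_p$ on $L^p(\mathbb{R}^n)$ that agrees with $T$ on $L^p\cap L^2$. (B) For $f:\mathbb{R}^n\to\mathbb{C}$ let $\omega_f(\rho)=\sup_{|x-y|_\kappa\le\rho}|f(x)-f(y)|$. There is a constant $C$, depending only on $m$ (and on $n$, $\kappa$), such that the following holds for every $f$ with $$\int_0^\delta\frac{\omega_f(\rho)}{\rho}\,d\rho<\infty\ \text{ for some }\delta>0,\qquad \int_r^\infty\frac{\omega_f(\rho)}{\rho^2}\,d\rho=o(r^{-1})\ \text{ as } r\to0+ .$$ The function $f$ defines a tempered distribution. There is a tempered distribution $u$ with $\hat u=m\hat f$ as distributions on $\mathbb{R}^n\setminus\{0\}$, and every such $u$ is represented by a continuous function of polynomial growth, again denoted by $u$, for which there is a polynomial $Q$ such that for all $x,y\in\mathbb{R}^n$ $$\big|[u(x)-Q(x)]-[u(y)-Q(y)]\big|\le C\left(\int_0^{|x-y|_\kappa}\frac{\omega_f(\rho)}{\rho}\,d\rho+|x-y|_\kappa\int_{|x-y|_\kappa}^\infty\frac{\omega_f(\rho)}{\rho^2}\,d\rho\right).\qquad(*)$$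 Moreover, with the same constant $C$: - If $m$ vanishes on a punctured neighbourhood of $0$ (so that $m\hat f$ is defined on all of $\mathbb{R}^n$, with $m(0)=0$), then there is a tempered distribution $u$ with $\hat u=m\hat f$ on $\mathbb{R}^n$, and it is represented by a continuous function of polynomial growth which satisfies $(*)$ with $Q=0$. - If $f\in L^p(\mathbb{R}^n)$ for some $p\in(1,\infty)$, then $u=T_pf$ satisfies $\hat u=m\hat f$ on $\mathbb{R}^n\setminus\{0\}$ and is represented by a continuous function of polynomial growth which satisfies $(*)$ with $Q=0$. -/

import Mathlib

open MeasureTheory Set Filter Topology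
open scoped ENNReal NNReal ContDiff FourierTransform SchwartzMap

noncomputable section

namespace AnisoMult

/-- Euclidean space `ℝⁿ`. -/
abbrev E (n : ℕ) : Type := EuclideanSpace ℝ (Fin n)

/-- The `κ`-(quasi-)norm `|x|_κ = (∑ₗ |xˡ|^(2/κₗ))^(1/2)`. -/
def knorm {n : ℕ} (κ : Fin n → ℕ) (x : E n) : ℝ :=
  Real.sqrt (∑ l, |x l| ^ ((2 : ℝ) / (κ l : ℝ)))

/-- The first order partial derivative `∂ₗ g`. -/
def partialDeriv {n : ℕ} (l : Fin n) (g : E n → ℂ) : E n → ℂ :=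
  fun x => fderiv ℝ g x (EuclideanSpace.single l 1)

/-- The partial derivative `D^γ g = ∂₁^{γ₁} ⋯ ∂ₙ^{γₙ} g` for a multi-index `γ`. -/
def multiDeriv {n : ℕ} (γ : Fin n → ℕ) (g : E n → ℂ) : E n → ℂ :=
  (List.finRange n).foldr (fun l h => (partialDeriv l)^[γ l] h) g

/-- The dyadic constant
`A_γ = sup_{R > 0} R^{-|κ| + γ·κ} ∫_{R < |ξ|_κ < 2R} |D^γ m(ξ)| dξ ∈ [0, ∞]`. -/
def dyadicConst {n : ℕ} (κ : Fin n → ℕ) (m : E n → ℂ) (γ : Fin n → ℕ) : ℝ≥0∞ :=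
  ⨆ (R : ℝ) (_ : 0 < R),
    ENNReal.ofReal (R ^ (-((∑ l, κ l : ℕ) : ℤ) + ((∑ l, γ l * κ l : ℕ) : ℤ))) *
      ∫⁻ ξ in {ξ : E n | R < knorm κ ξ ∧ knorm κ ξ < 2 * R}, ‖multiDeriv γ m ξ‖ₑ

/-- Bounded multipliers, smooth away from the origin, all of whose dyadic constants are finite.
The value `m 0` is irrelevant. -/
structure IsMultiplier {n : ℕ} (κ : Fin n → ℕ) (m : E n → ℂ) : Prop where
  bounded : ∃ M : ℝ, ∀ ξ, ξ ≠ 0 → ‖m ξ‖ ≤ M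
  smooth : ContDiffOn ℝ ∞ m {0}ᶜ
  dyadic : ∀ γ : Fin n → ℕ, dyadicConst κ m γ < ⊤

open Classical in
/-- The operator `f ↦ (m f̂)^∨` on `L²(ℝⁿ)`. (For bounded measurable `m` the product `m f̂` always
belongs to `L²`, so that the second branch is not used.) -/
def l2Op {n : ℕ} (m : E n → ℂ) (f : Lp ℂ 2 (volume : Measure (E n))) :
    Lp ℂ 2 (volume : Measure (E n)) :=
  𝓕⁻ (if h : MemLp (fun ξ => m ξ * (𝓕 f : Lp ℂ 2 (volume : Measure (E n))) ξ) 2 volume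
    then h.toLp else 0 : Lp ℂ 2 (volume : Measure (E n)))

/-- `T`, defined on `Lᵖ` with values in (classes of) measurable functions, agrees with the operator
`f ↦ (m f̂)^∨` on `Lᵖ ∩ L²`. -/
def ExtendsL2Op {n : ℕ} (m : E n → ℂ) (p : ℝ≥0∞)
    (T : Lp ℂ p (volume : Measure (E n)) → (E n →ₘ[volume] ℂ)) : Prop :=
  ∀ (f : Lp ℂ p (volume : Measure (E n))) (g : Lp ℂ 2 (volume : Measure (E n))),
    f =ᵐ[volume] g → T f =ᵐ[volume] l2Op m g

/-- The oscillation `ω_f(ρ) = sup_{|x - y|_κ ≤ ρ} |f(x) - f(y)| ∈ [0, ∞]`. -/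
def osc {n : ℕ} (κ : Fin n → ℕ) (f : E n → ℂ) (ρ : ℝ) : ℝ≥0∞ :=
  ⨆ (x : E n) (y : E n) (_ : knorm κ (x - y) ≤ ρ), ‖f x - f y‖ₑ

/-- `∫_0^δ ω_f(ρ)/ρ dρ < ∞` for some `δ > 0`, and `∫_r^∞ ω_f(ρ)/ρ² dρ = o(1/r)` as `r → 0+`. -/
def DiniCondition {n : ℕ} (κ : Fin n → ℕ) (f : E n → ℂ) : Prop :=
  (∃ δ : ℝ, 0 < δ ∧ ∫⁻ ρ in Ioo 0 δ, osc κ f ρ / ENNReal.ofReal ρ < ⊤) ∧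
  Tendsto (fun r : ℝ => ENNReal.ofReal r * ∫⁻ ρ in Ioi r, osc κ f ρ / ENNReal.ofReal (ρ ^ 2))
    (𝓝[>] 0) (𝓝 0)

/-- `∫_0^r ω_f(ρ)/ρ dρ + r ∫_r^∞ ω_f(ρ)/ρ² dρ`. -/
def modulusBound {n : ℕ} (κ : Fin n → ℕ) (f : E n → ℂ) (r : ℝ) : ℝ≥0∞ :=
  (∫⁻ ρ in Ioo 0 r, osc κ f ρ / ENNReal.ofReal ρ) +
    ENNReal.ofReal r * ∫⁻ ρ in Ioi r, osc κ f ρ / ENNReal.ofReal (ρ ^ 2)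

/-- `|v(x) - v(y)| ≤ C (∫_0^{|x-y|_κ} ω_f(ρ)/ρ dρ + |x-y|_κ ∫_{|x-y|_κ}^∞ ω_f(ρ)/ρ² dρ)`. -/
def HasModulus {n : ℕ} (κ : Fin n → ℕ) (f : E n → ℂ) (C : ℝ≥0) (v : E n → ℂ) : Prop :=
  ∀ x y : E n, ‖v x - v y‖ₑ ≤ C * modulusBound κ f (knorm κ (x - y))

/-- The tempered distribution `u` is (integration against) the function `g`. -/
def RepresentedBy {n : ℕ} (u : 𝓢'(E n, ℂ)) (g : E n → ℂ) : Prop :=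
  ∀ φ : 𝓢(E n, ℂ), Integrable (fun x => φ x * g x) volume ∧ u φ = ∫ x, φ x * g x

/-- The tempered distribution `u` is represented by the continuous function `g`
of polynomial growth. -/
structure ContinuousRep {n : ℕ} (u : 𝓢'(E n, ℂ)) (g : E n → ℂ) : Prop where
  continuous : Continuous g
  growth : ∃ (K : ℝ) (N : ℕ), ∀ x, ‖g x‖ ≤ K * (1 + ‖x‖) ^ N
  rep : RepresentedBy u g

/-- `û = m f̂` as distributions on the open set `U`: for every test function `φ ∈ C_c^∞(U)`,
`⟨û, φ⟩ = ⟨f̂, m φ⟩`. It is used for `m` smooth on `U ∖ {0}` with either `0 ∉ U` or `m = 0` on a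
punctured neighbourhood of `0`; then `m φ`, extended continuously to `0`, is the test
function `ψ`. -/
def FourierEqOn {n : ℕ} (U : Set (E n)) (m : E n → ℂ) (f u : 𝓢'(E n, ℂ)) : Prop :=
  ∀ φ ψ : 𝓢(E n, ℂ), HasCompactSupport φ → tsupport φ ⊆ U →
    (∀ ξ, ξ ≠ 0 → ψ ξ = m ξ * φ ξ) → (𝓕 u) φ = (𝓕 f) ψ

/-- The polynomial function on `ℝⁿ` given by `Q`. -/
def polyFun {n : ℕ} (Q : MvPolynomial (Fin n) ℂ) (x : E n) : ℂ :=
  MvPolynomial.eval (fun l => (x l : ℂ)) Q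

end AnisoMult

end

open AnisoMult

/-! The proof is a Littlewood–Paley decomposition adapted to the dilations δ_t x = (t^κₗ xˡ). With
θ(ξ) = χ(ξ) − χ(δ₂ξ), the multiplier splits off the origin as m = ∑ⱼ θ(δ_{2^-j}ξ) m(ξ). Each piece,
rescaled to unit size, is θ(ξ) m(δ_{2^j}ξ). The constants A_γ are invariant under this rescaling, so
the derivatives of the rescaled pieces are bounded in L¹ uniformly in j. Their inverse Fourier
transforms `kern` therefore decay faster than any power of |x|_κ, together with their first
derivatives, uniformly in j (`exists_kern_bound`, `exists_kern_sub_bound`). They also have integral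
zero, since θ(0) = 0.

Part (A). Summing the kernel bounds over j gives Hörmander's condition for every finite partial sum,
with a constant independent of the sum (`exists_hormander_psiSum`). The Calderón–Zygmund
decomposition over anisotropic dyadic cubes gives weak type (1,1), Marcinkiewicz interpolation with
L² gives 1 < p < 2, and duality gives p > 2. All bounds are uniform in the truncation, so they pass
to the limit. The operator extends to Lᵖ by density, and to L¹ as a limit in measure.

Part (B). Because the kernels have mean zero, the j-th piece Tⱼf sees only increments of f. Its size
is at most Cω(2^-j), and |Tⱼf(x) − Tⱼf(y)| ≤ Cω(2^-j) min(1, 2^j|x−y|_κ) (`exists_piece_sub_le`).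
The sum over j is a discretisation of the right side of (*) (`tsum_osc_le`). Hence `liftSum`, the
series ∑ⱼ (Tⱼf(x) − Tⱼf(0)), converges and satisfies (*). The subtracted constants are invisible on
the Fourier side away from 0, so `liftSum` solves û = m f̂ there. Any other solution differs from it
by a distribution with Fourier transform supported at 0, that is, by a polynomial
(`exists_representedBy_polyFun`).

In the two special cases this polynomial is constant. If m vanishes near 0 the values of the
truncated operators at the origin converge, and adding their limit to `liftSum` yields the unique
solution on all of ℝⁿ. If f ∈ Lᵖ, a Liouville argument applies: `liftSum` is o(|x|_κ) along dilation
orbits while T_p f lies in Lᵖ, so the polynomial cannot grow along such orbits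
(`polyFun_eq_of_memLp`). -/

noncomputable section

namespace AnisoMult

variable {n : ℕ} {κ : Fin n → ℕ}

/-! ### The anisotropic gauge and dilations -/

/-- The vector of the roots `|xˡ|^(1/κₗ)`, whose Euclidean norm is `|x|_κ`. -/
def rootVec (κ : Fin n → ℕ) (x : E n) : E n :=
  WithLp.toLp 2 fun l => |x l| ^ ((1 : ℝ) / (κ l : ℝ))

lemma knorm_eq_norm_rootVec (κ : Fin n → ℕ) (x : E n) : knorm κ x = ‖rootVec κ x‖ := by
  rw [knorm, EuclideanSpace.norm_eq]
  congr 1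
  refine Finset.sum_congr rfl fun l _ => ?_
  simp only [rootVec, Real.norm_eq_abs, sq_abs]
  rw [← Real.rpow_natCast, ← Real.rpow_mul (abs_nonneg _)]
  congr 1
  push_cast
  ring

lemma knorm_nonneg (x : E n) : 0 ≤ knorm κ x := Real.sqrt_nonneg _

lemma continuous_knorm (κ : Fin n → ℕ) : Continuous (knorm κ) := by
  unfold knorm
  refine Real.continuous_sqrt.comp (continuous_finsetSum _ fun l _ => ?_)
  refine Continuous.rpow_const (by fun_prop) fun x => Or.inr (by positivity)

lemma knorm_neg (x : E n) : knorm κ (-x) = knorm κ x := by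
  simp [knorm]

lemma norm_le_norm_of_abs_coord_le {a b : E n} (h : ∀ l, |a l| ≤ |b l|) : ‖a‖ ≤ ‖b‖ := by
  rw [EuclideanSpace.norm_eq, EuclideanSpace.norm_eq]
  refine Real.sqrt_le_sqrt (Finset.sum_le_sum fun l _ => ?_)
  simpa using sq_le_sq.2 (h l)

lemma rootVec_nonneg (x : E n) (l : Fin n) : 0 ≤ rootVec κ x l := by
  simp only [rootVec]; positivity

lemma knorm_mono {x y : E n} (h : ∀ l, |x l| ≤ |y l|) : knorm κ x ≤ knorm κ y := by
  rw [knorm_eq_norm_rootVec, knorm_eq_norm_rootVec]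
  refine norm_le_norm_of_abs_coord_le fun l => ?_
  rw [abs_of_nonneg (rootVec_nonneg _ _), abs_of_nonneg (rootVec_nonneg _ _)]
  exact Real.rpow_le_rpow (abs_nonneg _) (h l) (by positivity)

/-- Since κₗ ≥ 1, t ↦ t^(1/κₗ) is subadditive, and Minkowski's inequality for the root vectors
finishes. The triangle inequality holds with constant 1, so no quasi-norm constants appear later. -/
lemma knorm_add_le (hκ : ∀ l, 0 < κ l) (x y : E n) :
    knorm κ (x + y) ≤ knorm κ x + knorm κ y := by
  simp only [knorm_eq_norm_rootVec]
  refine le_trans (norm_le_norm_of_abs_coord_le (b := rootVec κ x + rootVec κ y) fun l => ?_)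
    (norm_add_le _ _)
  rw [abs_of_nonneg (rootVec_nonneg _ _), abs_of_nonneg (by
    simpa using add_nonneg (rootVec_nonneg x l) (rootVec_nonneg y l))]
  have h1 : (1 : ℝ) ≤ κ l := by exact_mod_cast hκ l
  calc |x l + y l| ^ ((1 : ℝ) / κ l) ≤ (|x l| + |y l|) ^ ((1 : ℝ) / κ l) :=
        Real.rpow_le_rpow (abs_nonneg _) (abs_add_le _ _) (by positivity)
    _ ≤ _ := Real.rpow_add_le_add_rpow (abs_nonneg _) (abs_nonneg _) (by positivity)
        (by rw [div_le_one (by linarith)]; exact h1)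

lemma knorm_smul_le {s : ℝ} (hs : |s| ≤ 1) (x : E n) : knorm κ (s • x) ≤ knorm κ x :=
  knorm_mono fun l => by
    simpa [abs_mul] using mul_le_of_le_one_left (abs_nonneg (x l)) hs

lemma root_coord_le_knorm (x : E n) (l : Fin n) : |x l| ^ ((1 : ℝ) / κ l) ≤ knorm κ x := by
  rw [knorm_eq_norm_rootVec]
  have := PiLp.norm_apply_le (rootVec κ x) l
  rwa [Real.norm_of_nonneg (rootVec_nonneg _ _)] at this

lemma abs_coord_le (hκ : ∀ l, 0 < κ l) (x : E n) (l : Fin n) : |x l| ≤ knorm κ x ^ κ l := by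
  have h1 : (κ l : ℝ) ≠ 0 := by exact_mod_cast (hκ l).ne'
  have := Real.rpow_le_rpow (by positivity) (root_coord_le_knorm (κ := κ) x l) (Nat.cast_nonneg (κ l))
  rwa [← Real.rpow_mul (abs_nonneg _), one_div, inv_mul_cancel₀ h1, Real.rpow_one,
    Real.rpow_natCast] at this

lemma knorm_zero (hκ : ∀ l, 0 < κ l) : knorm κ (0 : E n) = 0 := by
  have : ∀ l, (2 : ℝ) / κ l ≠ 0 := fun l => by have := hκ l; positivity
  simp [knorm, Real.zero_rpow (this _)]

lemma knorm_pos (hκ : ∀ l, 0 < κ l) {x : E n} (hx : x ≠ 0) : 0 < knorm κ x := by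
  refine lt_of_le_of_ne (knorm_nonneg x) fun h => hx ?_
  ext l
  have := abs_coord_le hκ x l
  rw [← h, zero_pow (hκ l).ne'] at this
  simpa using this

lemma norm_le_sum_abs (x : E n) : ‖x‖ ≤ ∑ l, |x l| := by
  rw [EuclideanSpace.norm_eq]
  simp only [Real.norm_eq_abs]
  rw [Real.sqrt_le_left (Finset.sum_nonneg fun _ _ => abs_nonneg _)]
  exact Finset.sum_sq_le_sq_sum_of_nonneg fun _ _ => abs_nonneg _

lemma knorm_le_sum (x : E n) : knorm κ x ≤ ∑ l, |x l| ^ ((1 : ℝ) / κ l) := by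
  rw [knorm_eq_norm_rootVec]
  refine (norm_le_sum_abs _).trans (Finset.sum_le_sum fun l _ => ?_)
  rw [abs_of_nonneg (rootVec_nonneg _ _)]
  rfl

lemma root_le_one_add (hκ : ∀ l, 0 < κ l) (l : Fin n) {a : ℝ} (ha : 0 ≤ a) :
    a ^ ((1 : ℝ) / κ l) ≤ 1 + a := by
  have h1 : (1 : ℝ) ≤ κ l := by exact_mod_cast hκ l
  calc a ^ ((1 : ℝ) / κ l) ≤ (1 + a) ^ ((1 : ℝ) / κ l) :=
        Real.rpow_le_rpow ha (by linarith) (by positivity)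
    _ ≤ (1 + a) ^ (1 : ℝ) := Real.rpow_le_rpow_of_exponent_le (by linarith)
        (by rw [div_le_one (by linarith)]; exact h1)
    _ = 1 + a := Real.rpow_one _

lemma knorm_le_norm (hκ : ∀ l, 0 < κ l) (x : E n) : knorm κ x ≤ n * (1 + ‖x‖) := by
  refine (knorm_le_sum x).trans ?_
  calc ∑ l, |x l| ^ ((1 : ℝ) / κ l) ≤ ∑ _l : Fin n, (1 + ‖x‖) := by
        refine Finset.sum_le_sum fun l _ => (root_le_one_add hκ l (abs_nonneg _)).trans ?_
        have := PiLp.norm_apply_le x l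
        rw [Real.norm_eq_abs] at this
        linarith
    _ = _ := by simp; ring

lemma le_sum_kappa (κ : Fin n → ℕ) (l : Fin n) : κ l ≤ ∑ l, κ l :=
  Finset.single_le_sum (f := κ) (fun _ _ => Nat.zero_le _) (Finset.mem_univ l)

/-- With `knorm_le_norm` this makes polynomial growth in ‖x‖ and in |x|_κ interchangeable. The
exponent |κ| serves as a common upper bound for the κₗ. -/
lemma one_add_norm_le (hκ : ∀ l, 0 < κ l) (x : E n) :
    1 + ‖x‖ ≤ (n + 1) * (1 + knorm κ x) ^ (∑ l, κ l) := by
  have h0 := knorm_nonneg (κ := κ) x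
  have h1 : (1 : ℝ) ≤ (1 + knorm κ x) ^ (∑ l, κ l) := one_le_pow₀ (by linarith)
  have h2 : ‖x‖ ≤ ∑ _l : Fin n, (1 + knorm κ x) ^ (∑ l, κ l) := by
    refine (norm_le_sum_abs x).trans (Finset.sum_le_sum fun l _ => (abs_coord_le hκ x l).trans ?_)
    exact (pow_le_pow_left₀ h0 (by linarith) _).trans
      (pow_le_pow_right₀ (by linarith) (le_sum_kappa κ l))
  simp only [Finset.sum_const, Finset.card_univ, Fintype.card_fin, nsmul_eq_mul] at h2
  linarith

/-- The anisotropic dilation `x ↦ (2^(j κₗ) xˡ)ₗ`. -/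
def dil (κ : Fin n → ℕ) (j : ℤ) : E n ≃L[ℝ] E n :=
  LinearEquiv.toContinuousLinearEquiv
  { toFun := fun x => WithLp.toLp 2 fun l => (2 : ℝ) ^ (j * κ l) * x l
    map_add' := fun x y => by ext l; simp [mul_add]
    map_smul' := fun c x => by ext l; simp; ring
    invFun := fun x => WithLp.toLp 2 fun l => (2 : ℝ) ^ (-(j * κ l)) * x l
    left_inv := fun x => by
      ext l; simp only [zpow_neg]
      rw [inv_mul_cancel_left₀ (by positivity)]
    right_inv := fun x => by
      ext l; simp only [zpow_neg]
      rw [mul_inv_cancel_left₀ (by positivity)] }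

@[simp] lemma dil_apply (j : ℤ) (x : E n) (l : Fin n) : dil κ j x l = (2 : ℝ) ^ (j * κ l) * x l :=
  rfl

lemma dil_dil (i j : ℤ) (x : E n) : dil κ i (dil κ j x) = dil κ (i + j) x := by
  ext l
  simp only [dil_apply, add_mul]
  rw [zpow_add₀ two_ne_zero, mul_assoc]

@[simp] lemma dil_zero_apply (x : E n) : dil κ 0 x = x := by ext l; simp

lemma dil_neg_dil (j : ℤ) (x : E n) : dil κ (-j) (dil κ j x) = x := by simp [dil_dil]

lemma dil_dil_neg (j : ℤ) (x : E n) : dil κ j (dil κ (-j) x) = x := by simp [dil_dil]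

lemma knorm_dil (hκ : ∀ l, 0 < κ l) (j : ℤ) (x : E n) :
    knorm κ (dil κ j x) = (2 : ℝ) ^ j * knorm κ x := by
  have h2 : rootVec κ (dil κ j x) = (2 : ℝ) ^ j • rootVec κ x := by
    ext l
    have h1 : (κ l : ℝ) ≠ 0 := by exact_mod_cast (hκ l).ne'
    simp only [rootVec, dil_apply, PiLp.smul_apply, smul_eq_mul, abs_mul]
    rw [Real.mul_rpow (abs_nonneg _) (abs_nonneg _), abs_of_pos (by positivity), zpow_mul,
      zpow_natCast, ← Real.rpow_natCast, ← Real.rpow_mul (by positivity), mul_one_div_cancel h1,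
      Real.rpow_one]
  rw [knorm_eq_norm_rootVec, knorm_eq_norm_rootVec, h2, norm_smul, Real.norm_of_nonneg (by positivity)]

lemma det_dil (j : ℤ) : LinearMap.det ((dil κ j : E n →L[ℝ] E n) : E n →ₗ[ℝ] E n) =
    (2 : ℝ) ^ (j * (∑ l, κ l : ℕ)) := by
  classical
  rw [← LinearMap.det_toMatrix (EuclideanSpace.basisFun (Fin n) ℝ).toBasis]
  have : LinearMap.toMatrix (EuclideanSpace.basisFun (Fin n) ℝ).toBasis
      (EuclideanSpace.basisFun (Fin n) ℝ).toBasis ((dil κ j : E n →L[ℝ] E n) : E n →ₗ[ℝ] E n) =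
      Matrix.diagonal fun l => (2 : ℝ) ^ (j * κ l) := by
    ext a b
    rw [LinearMap.toMatrix_apply]
    simp [Matrix.diagonal_apply]
  rw [this, Matrix.det_diagonal, Nat.cast_sum, Finset.mul_sum]
  induction (Finset.univ : Finset (Fin n)) using Finset.induction_on with
  | empty => simp
  | insert a s ha ih => rw [Finset.prod_insert ha, Finset.sum_insert ha, zpow_add₀ two_ne_zero, ih]

lemma map_dil_volume (j : ℤ) : Measure.map (dil κ j) (volume : Measure (E n)) =
    ENNReal.ofReal ((2 : ℝ) ^ (-j * (∑ l, κ l : ℕ))) • volume := by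
  have h := Measure.map_linearMap_addHaar_eq_smul_addHaar (volume : Measure (E n))
    (f := ((dil κ j : E n →L[ℝ] E n) : E n →ₗ[ℝ] E n)) (by rw [det_dil]; positivity)
  rw [det_dil, abs_of_nonneg (by positivity), ← zpow_neg, ← neg_mul] at h
  exact h

lemma lintegral_comp_dil (j : ℤ) (F : E n → ℝ≥0∞) : ∫⁻ x, F (dil κ j x) =
    ENNReal.ofReal ((2 : ℝ) ^ (-j * (∑ l, κ l : ℕ))) * ∫⁻ x, F x := by
  refine (lintegral_map_equiv F (dil κ j).toHomeomorph.toMeasurableEquiv).symm.trans ?_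
  change ∫⁻ x, F x ∂(Measure.map (dil κ j) volume) = _
  rw [map_dil_volume, lintegral_smul_measure, smul_eq_mul]

lemma integral_comp_dil (j : ℤ) (F : E n → ℂ) : ∫ x, F (dil κ j x) =
    (2 : ℂ) ^ (-j * (∑ l, κ l : ℕ)) * ∫ x, F x := by
  refine (integral_map_equiv (dil κ j).toHomeomorph.toMeasurableEquiv F).symm.trans ?_
  change ∫ x, F x ∂(Measure.map (dil κ j) volume) = _
  rw [map_dil_volume, integral_smul_measure, ENNReal.toReal_ofReal (by positivity)]
  simp

lemma volume_knorm_le_dil (hκ : ∀ l, 0 < κ l) (j : ℤ) (R : ℝ) (c : E n) :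
    volume {x : E n | knorm κ (x - c) ≤ 2 ^ j * R} =
      ENNReal.ofReal ((2 : ℝ) ^ (j * (∑ l, κ l : ℕ))) * volume {x : E n | knorm κ x ≤ R} := by
  have h1 : {x : E n | knorm κ (x - c) ≤ 2 ^ j * R} =
      (fun x => x + -c) ⁻¹' (dil κ (-j) ⁻¹' {x : E n | knorm κ x ≤ R}) := by
    ext x
    simp only [mem_ofPred_eq, mem_preimage, knorm_dil hκ, zpow_neg, ← sub_eq_add_neg]
    rw [inv_mul_le_iff₀ (by positivity)]
  rw [h1, measure_preimage_add_right, ← Measure.map_apply (dil κ (-j)).continuous.measurable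
    (measurableSet_le (continuous_knorm κ).measurable measurable_const), map_dil_volume]
  simp

lemma volume_knorm_le_lt_top (hκ : ∀ l, 0 < κ l) (R : ℝ) :
    volume {x : E n | knorm κ x ≤ R} < ⊤ := by
  refine (measure_mono (t := Metric.closedBall 0 ((n + 1) * (1 + |R|) ^ (∑ l, κ l))) ?_).trans_lt
    measure_closedBall_lt_top
  intro x hx
  have h0 := knorm_nonneg (κ := κ) x
  have h := one_add_norm_le hκ x
  have h2 : (1 + knorm κ x) ^ (∑ l, κ l) ≤ (1 + |R|) ^ (∑ l, κ l) :=
    pow_le_pow_left₀ (by linarith) (by linarith [le_abs_self R, hx.out]) _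
  rw [mem_closedBall_zero_iff]
  have h3 : (0 : ℝ) ≤ n := by positivity
  nlinarith

/-- An exponent for which `(1 + |x|_κ)^(-N)` is integrable. -/
def intExp (κ : Fin n → ℕ) : ℕ := (∑ l, κ l) * (n + 1)

lemma integrable_one_add_knorm_inv (hκ : ∀ l, 0 < κ l) :
    Integrable (fun x : E n => ((1 + knorm κ x) ^ intExp κ)⁻¹) := by
  have h := (integrable_one_add_norm (E := E n) (μ := volume) (r := n + 1)
    (by simp)).const_mul (((n : ℝ) + 1) ^ (n + 1))
  refine h.mono' ?_ (Eventually.of_forall fun x => ?_)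
  · refine Continuous.aestronglyMeasurable ?_
    refine Continuous.inv₀ (by have := continuous_knorm κ; fun_prop) fun x => ?_
    have := knorm_nonneg (κ := κ) x
    positivity
  · have h0 := knorm_nonneg (κ := κ) x
    rw [Real.norm_of_nonneg (by positivity), intExp, pow_mul, Real.rpow_neg (by positivity),
      ← div_eq_mul_inv, inv_le_iff_one_le_mul₀ (by positivity)]
    have h1 := one_add_norm_le hκ x
    have h2 : (1 + ‖x‖) ^ ((n : ℝ) + 1) = (1 + ‖x‖) ^ (n + 1) := by
      rw [← Real.rpow_natCast]; push_cast; rfl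
    rw [h2, ← mul_div_right_comm, ← mul_pow, one_le_div (by positivity)]
    exact pow_le_pow_left₀ (by positivity) h1 _

lemma lintegral_one_add_knorm_inv_lt_top (hκ : ∀ l, 0 < κ l) {N : ℕ} (hN : intExp κ ≤ N) :
    ∫⁻ x : E n, ENNReal.ofReal (((1 + knorm κ x) ^ N)⁻¹) < ⊤ := by
  refine lt_of_le_of_lt (lintegral_mono fun x => ?_)
    (integrable_one_add_knorm_inv (n := n) hκ).lintegral_lt_top
  refine ENNReal.ofReal_le_ofReal ?_
  have h0 := knorm_nonneg (κ := κ) x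
  exact inv_anti₀ (by positivity) (pow_le_pow_right₀ (by linarith) hN)

/-- `|x / s^M|_κ ≤ |x|_κ / s` for `s ≥ 1` and `M ≥ κₗ`. -/
lemma knorm_inv_pow_smul_le (hκ : ∀ l, 0 < κ l) {s : ℝ} (hs : 1 ≤ s) (x : E n) :
    knorm κ ((s ^ (∑ l, κ l))⁻¹ • x) ≤ s⁻¹ * knorm κ x := by
  have h2 : ‖rootVec κ ((s ^ (∑ l, κ l))⁻¹ • x)‖ ≤ ‖s⁻¹ • rootVec κ x‖ := by
    refine norm_le_norm_of_abs_coord_le fun l => ?_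
    have h1 : (κ l : ℝ) ≠ 0 := by exact_mod_cast (hκ l).ne'
    rw [abs_of_nonneg (rootVec_nonneg _ _), PiLp.smul_apply, smul_eq_mul, abs_of_nonneg
      (mul_nonneg (by positivity) (rootVec_nonneg _ _))]
    simp only [rootVec, PiLp.smul_apply, smul_eq_mul, abs_mul]
    rw [Real.mul_rpow (abs_nonneg _) (abs_nonneg _)]
    refine mul_le_mul_of_nonneg_right ?_ (by positivity)
    calc |(s ^ (∑ l, κ l))⁻¹| ^ ((1 : ℝ) / κ l) ≤ ((s⁻¹) ^ κ l) ^ ((1 : ℝ) / κ l) := by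
          refine Real.rpow_le_rpow (abs_nonneg _) ?_ (by positivity)
          rw [abs_of_nonneg (by positivity), inv_pow]
          exact inv_anti₀ (by positivity) (pow_le_pow_right₀ hs (le_sum_kappa κ l))
      _ = s⁻¹ := by
          rw [← Real.rpow_natCast, ← Real.rpow_mul (by positivity), mul_one_div_cancel h1,
            Real.rpow_one]
  rw [knorm_eq_norm_rootVec, knorm_eq_norm_rootVec]
  refine h2.trans_eq ?_
  rw [norm_smul, Real.norm_of_nonneg (by positivity)]

end AnisoMult

end

/-! ### From the integral hypothesis on `m` to derivative bounds uniform over dyadic scales. -/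

noncomputable section

namespace AnisoMult

variable {n : ℕ} {κ : Fin n → ℕ}

/-! ### Partial derivatives -/

/-- The kernel estimates weight with powers of one coordinate at a time, so the multi-indices that
enter are N·eₗ. -/
lemma multiDeriv_single (l : Fin n) (N : ℕ) (g : E n → ℂ) :
    multiDeriv (Pi.single l N) g = (partialDeriv l)^[N] g := by
  unfold multiDeriv
  have key : ∀ L : List (Fin n), L.Nodup →
      L.foldr (fun i h => (partialDeriv i)^[(Pi.single l N : Fin n → ℕ) i] h) g =
        if l ∈ L then (partialDeriv l)^[N] g else g := by
    intro L
    induction L with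
    | nil => intro _; simp
    | cons a t ih =>
      intro hnd
      rw [List.nodup_cons] at hnd
      rw [List.foldr_cons, ih hnd.2]
      by_cases hal : a = l
      · subst hal; simp [hnd.1]
      · simp [Ne.symm hal]
  rw [key _ (List.nodup_finRange n), if_pos (List.mem_finRange l)]

/-- Smoothness away from the origin. -/
abbrev Smooth0 (g : E n → ℂ) : Prop := ContDiffOn ℝ ∞ g {0}ᶜ

lemma Smooth0.contDiffAt {g : E n → ℂ} (hg : Smooth0 g) {x : E n} (hx : x ≠ 0) :
    ContDiffAt ℝ ∞ g x :=
  ContDiffOn.contDiffAt hg (isOpen_compl_singleton.mem_nhds hx)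

lemma Smooth0.partialDeriv {g : E n → ℂ} (hg : Smooth0 g) (l : Fin n) :
    Smooth0 (partialDeriv l g) := by
  have := hg.fderiv_of_isOpen (m := ∞) isOpen_compl_singleton (by simp)
  exact this.clm_apply contDiffOn_const

lemma contDiff_partialDeriv {g : E n → ℂ} (hg : ContDiff ℝ ∞ g) (l : Fin n) :
    ContDiff ℝ ∞ (partialDeriv l g) :=
  (hg.fderiv_right (m := ∞) (by simp)).clm_apply contDiff_const

lemma contDiff_iterate_partialDeriv {g : E n → ℂ} (hg : ContDiff ℝ ∞ g) (l : Fin n) (N : ℕ) :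
    ContDiff ℝ ∞ ((partialDeriv l)^[N] g) := by
  induction N generalizing g with
  | zero => exact hg
  | succ N ih => exact ih (contDiff_partialDeriv hg l)

lemma Smooth0.comp_dil {g : E n → ℂ} (hg : Smooth0 g) (j : ℤ) : Smooth0 (g ∘ dil κ j) :=
  ContDiffOn.comp hg (dil κ j).contDiff.contDiffOn fun x hx => by simpa using hx

lemma partialDeriv_add {u v : E n → ℂ} (hu : ContDiff ℝ ∞ u) (hv : ContDiff ℝ ∞ v) (l : Fin n) :
    partialDeriv l (fun x => u x + v x) = fun x => partialDeriv l u x + partialDeriv l v x := by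
  funext x
  unfold partialDeriv
  rw [fderiv_fun_add (hu.differentiable (by simp) x) (hv.differentiable (by simp) x)]
  rfl

lemma iterate_partialDeriv_add {u v : E n → ℂ} (hu : ContDiff ℝ ∞ u) (hv : ContDiff ℝ ∞ v)
    (l : Fin n) (N : ℕ) : (partialDeriv l)^[N] (fun x => u x + v x) =
      fun x => (partialDeriv l)^[N] u x + (partialDeriv l)^[N] v x := by
  induction N generalizing u v with
  | zero => rfl
  | succ N ih =>
    rw [Function.iterate_succ_apply, partialDeriv_add hu hv,
      ih (contDiff_partialDeriv hu l) (contDiff_partialDeriv hv l)]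
    rfl

lemma partialDeriv_smul_comp_dil (c : ℝ) (g : E n → ℂ) (l : Fin n) (j : ℤ) :
    partialDeriv l (c • (g ∘ dil κ j)) =
      (c * (2 : ℝ) ^ (j * κ l)) • (partialDeriv l g ∘ dil κ j) := by
  funext x
  have h1 : dil κ j (EuclideanSpace.single l (1 : ℝ)) =
      (2 : ℝ) ^ (j * κ l) • EuclideanSpace.single l (1 : ℝ) := by
    ext i
    rcases eq_or_ne i l with rfl | h <;> simp [*]
  unfold partialDeriv
  rw [fderiv_const_smul_field, Pi.smul_apply, (dil κ j).comp_right_fderiv]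
  simp only [Pi.smul_apply, smul_apply, ContinuousLinearMap.comp_apply,
    ContinuousLinearEquiv.coe_coe, h1, map_smul, Function.comp_apply, mul_smul]

lemma iterate_partialDeriv_comp_dil (g : E n → ℂ) (l : Fin n) (j : ℤ) (i : ℕ) :
    (partialDeriv l)^[i] (g ∘ dil κ j) =
      ((2 : ℝ) ^ (j * κ l * i)) • ((partialDeriv l)^[i] g ∘ dil κ j) := by
  induction i with
  | zero => simp
  | succ i ih =>
    rw [Function.iterate_succ_apply', ih, partialDeriv_smul_comp_dil, Function.iterate_succ_apply',
      ← zpow_add₀ two_ne_zero]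
    push_cast
    ring_nf

/-! ### `L¹` bounds on anisotropic annuli -/

/-- The annulus `{a < |ξ|_κ < b}`. -/
def annulus (κ : Fin n → ℕ) (a b : ℝ) : Set (E n) := {ξ | a < knorm κ ξ ∧ knorm κ ξ < b}

lemma measurableSet_annulus (κ : Fin n → ℕ) (a b : ℝ) : MeasurableSet (annulus κ a b) :=
  (measurableSet_lt measurable_const (continuous_knorm κ).measurable).inter
    (measurableSet_lt (continuous_knorm κ).measurable measurable_const)

lemma lintegral_annulus_comp_dil (hκ : ∀ l, 0 < κ l) (a b : ℝ) (j : ℤ) (F : E n → ℝ≥0∞) :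
    ∫⁻ x in annulus κ a b, F (dil κ j x) = ENNReal.ofReal ((2 : ℝ) ^ (-j * (∑ l, κ l : ℕ))) *
      ∫⁻ x in annulus κ (2 ^ j * a) (2 ^ j * b), F x := by
  rw [← lintegral_indicator (measurableSet_annulus ..),
    ← lintegral_indicator (measurableSet_annulus ..), ← lintegral_comp_dil]
  refine lintegral_congr fun x => ?_
  have : dil κ j x ∈ annulus κ (2 ^ j * a) (2 ^ j * b) ↔ x ∈ annulus κ a b := by
    have : (0 : ℝ) < 2 ^ j := by positivity
    simp [annulus, knorm_dil hκ, this]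
  by_cases hx : x ∈ annulus κ a b
  · rw [indicator_of_mem hx, indicator_of_mem (this.2 hx)]
  · rw [indicator_of_notMem hx, indicator_of_notMem (mt this.1 hx)]

/-- Substituting ξ = δ_{2^j}x produces 2^(jiκₗ) from the derivatives and 2^(-j|κ|) from the volume.
This is the weight in A_γ at R = 2^j a up to a power of a, so j disappears. -/
lemma exists_bound_dyadic (hκ : ∀ l, 0 < κ l) {m : E n → ℂ} (hm : IsMultiplier κ m) (l : Fin n)
    (i : ℕ) {a : ℝ} (ha : 0 < a) : ∃ C : ℝ≥0, ∀ j : ℤ,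
      ∫⁻ x in annulus κ a (2 * a), ‖(partialDeriv l)^[i] (m ∘ dil κ j) x‖ₑ ≤ C := by
  set e : ℤ := -((∑ l, κ l : ℕ) : ℤ) + ((i * κ l : ℕ) : ℤ) with he
  have hA := hm.dyadic (Pi.single l i)
  refine ⟨(ENNReal.ofReal (a ^ (-e)) * dyadicConst κ m (Pi.single l i)).toNNReal, fun j => ?_⟩
  rw [ENNReal.coe_toNNReal (ENNReal.mul_lt_top ENNReal.ofReal_lt_top hA).ne,
    iterate_partialDeriv_comp_dil]
  have h1 : ENNReal.ofReal ((2 ^ j * a) ^ e) * ∫⁻ ξ in annulus κ (2 ^ j * a) (2 ^ j * (2 * a)),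
      ‖(partialDeriv l)^[i] m ξ‖ₑ ≤ dyadicConst κ m (Pi.single l i) := by
    have hs : ∑ k, (Pi.single l i : Fin n → ℕ) k * κ k = i * κ l := by
      rw [Finset.sum_eq_single l (fun b _ hb => by simp [hb]) (by simp)]; simp
    refine le_trans (le_of_eq ?_) (le_iSup₂ (f := fun (R : ℝ) (_ : 0 < R) => ENNReal.ofReal
      (R ^ (-((∑ l, κ l : ℕ) : ℤ) + ((∑ k, (Pi.single l i : Fin n → ℕ) k * κ k : ℕ) : ℤ))) *
      ∫⁻ ξ in {ξ : E n | R < knorm κ ξ ∧ knorm κ ξ < 2 * R}, ‖multiDeriv (Pi.single l i) m ξ‖ₑ)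
      (2 ^ j * a) (by positivity))
    rw [hs, multiDeriv_single, annulus, mul_left_comm]
  have h2 : ∀ x, ‖((2 : ℝ) ^ (j * κ l * i) • ((partialDeriv l)^[i] m ∘ dil κ j)) x‖ₑ =
      ENNReal.ofReal ((2 : ℝ) ^ (j * κ l * i)) * ‖(partialDeriv l)^[i] m (dil κ j x)‖ₑ := by
    intro x
    rw [Pi.smul_apply, enorm_smul, Real.enorm_of_nonneg (by positivity)]
    rfl
  simp only [h2]
  rw [lintegral_const_mul' _ _ ENNReal.ofReal_ne_top, lintegral_annulus_comp_dil hκ a (2 * a) j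
    (fun x => ‖(partialDeriv l)^[i] m x‖ₑ), ← mul_assoc]
  refine le_trans (le_of_eq ?_) (mul_le_mul_right h1 _)
  conv_rhs => rw [← mul_assoc]
  rw [← ENNReal.ofReal_mul (by positivity), ← ENNReal.ofReal_mul (by positivity)]
  congr 2
  rw [mul_zpow, mul_left_comm, zpow_neg, inv_mul_cancel₀ (by positivity), mul_one,
    ← zpow_add₀ two_ne_zero, ← zpow_mul, he]
  congr 1
  push_cast
  ring

/-- A wide annulus is covered by annuli of ratio 2 whose inner radii grow by the factor 3/2. The
overlap matters: with factor 2 the open annuli would miss the separating spheres. -/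
lemma exists_bound_annulus (hκ : ∀ l, 0 < κ l) {m : E n → ℂ} (hm : IsMultiplier κ m) (l : Fin n)
    (i : ℕ) {a : ℝ} (ha : 0 < a) (b : ℝ) : ∃ C : ℝ≥0, ∀ j : ℤ,
      ∫⁻ x in annulus κ a b, ‖(partialDeriv l)^[i] (m ∘ dil κ j) x‖ₑ ≤ C := by
  have key : ∀ k : ℕ, ∃ C : ℝ≥0, ∀ j : ℤ,
      ∫⁻ x in annulus κ a (2 * ((3 / 2) ^ k * a)),
        ‖(partialDeriv l)^[i] (m ∘ dil κ j) x‖ₑ ≤ C := by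
    intro k
    induction k with
    | zero => simpa using exists_bound_dyadic hκ hm l i ha
    | succ k ih =>
      obtain ⟨C, hC⟩ := ih
      obtain ⟨C', hC'⟩ := exists_bound_dyadic hκ hm l i
        (a := (3 / 2) ^ (k + 1) * a) (by positivity)
      refine ⟨C + C', fun j => ?_⟩
      refine (lintegral_mono_set (t := annulus κ a (2 * ((3 / 2) ^ k * a)) ∪
        annulus κ ((3 / 2) ^ (k + 1) * a) (2 * ((3 / 2) ^ (k + 1) * a))) ?_).trans
        ((lintegral_union_le _ _ _).trans ?_)
      · rintro x ⟨h1, h2⟩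
        have h3 : (0 : ℝ) < (3 / 2) ^ k * a := by positivity
        have h4 : (3 / 2 : ℝ) ^ (k + 1) * a = 3 / 2 * ((3 / 2) ^ k * a) := by ring
        rcases lt_or_ge (knorm κ x) (2 * ((3 / 2) ^ k * a)) with h | h
        · exact Or.inl ⟨h1, h⟩
        · exact Or.inr ⟨by rw [h4]; linarith, h2⟩
      · push_cast
        exact add_le_add (hC j) (hC' j)
  obtain ⟨k, hk⟩ := pow_unbounded_of_one_lt (b / a) (by norm_num : (1 : ℝ) < 3 / 2)
  obtain ⟨C, hC⟩ := key k
  refine ⟨C, fun j => (lintegral_mono_set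
    (t := annulus κ a (2 * ((3 / 2) ^ k * a))) fun x hx => ⟨hx.1, hx.2.trans ?_⟩).trans (hC j)⟩
  rw [div_lt_iff₀ ha] at hk
  have : 0 < (3 / 2 : ℝ) ^ k * a := by positivity
  linarith

/-! ### Cutoffs and the kernels -/

/-- Smooth functions with compact support in `ℝⁿ ∖ {0}`. -/
structure Cutoff (θ : E n → ℂ) : Prop where
  smooth : ContDiff ℝ ∞ θ
  compact : HasCompactSupport θ
  zero_notMem : (0 : E n) ∉ tsupport θ

lemma Cutoff.mul_right {θ g : E n → ℂ} (hθ : Cutoff θ) (hg : Smooth0 g) :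
    Cutoff (fun x => θ x * g x) where
  smooth := by
    rw [contDiff_iff_contDiffAt]
    intro x
    by_cases hx : x = 0
    · subst hx
      have : (fun x => θ x * g x) =ᶠ[𝓝 0] fun _ => 0 := by
        filter_upwards [notMem_tsupport_iff_eventuallyEq.1 hθ.zero_notMem] with y hy
        simp [hy]
      exact contDiffAt_const.congr_of_eventuallyEq this
    · exact hθ.smooth.contDiffAt.mul (hg.contDiffAt hx)
  compact := hθ.compact.mul_right
  zero_notMem h := hθ.zero_notMem (tsupport_mul_subset_left h)

lemma Cutoff.partialDeriv {θ : E n → ℂ} (hθ : Cutoff θ) (l : Fin n) :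
    Cutoff (partialDeriv l θ) where
  smooth := contDiff_partialDeriv hθ.smooth l
  compact := hθ.compact.fderiv_apply (𝕜 := ℝ) _
  zero_notMem h := hθ.zero_notMem (tsupport_fderiv_apply_subset ℝ _ h)

lemma partialDeriv_cutoff_mul {θ g : E n → ℂ} (hθ : Cutoff θ) (hg : Smooth0 g) (l : Fin n) :
    partialDeriv l (fun x => θ x * g x) =
      fun x => partialDeriv l θ x * g x + θ x * partialDeriv l g x := by
  funext x
  by_cases hx : x ∈ tsupport θ
  · have hx0 : x ≠ 0 := fun h => hθ.zero_notMem (h ▸ hx)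
    unfold partialDeriv
    rw [fderiv_fun_mul (hθ.smooth.differentiable (by simp) x)
      ((hg.contDiffAt hx0).differentiableAt (by simp))]
    simp [mul_comm]
    ring
  · have h0 : θ =ᶠ[𝓝 x] 0 := notMem_tsupport_iff_eventuallyEq.1 hx
    have h1 : (fun x => θ x * g x) =ᶠ[𝓝 x] fun _ => 0 := by
      filter_upwards [h0] with y hy
      simp [hy]
    unfold AnisoMult.partialDeriv
    rw [h1.fderiv_eq, h0.fderiv_eq, h0.eq_of_nhds]
    simp

lemma Cutoff.exists_annulus (hκ : ∀ l, 0 < κ l) {θ : E n → ℂ} (hθ : Cutoff θ) :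
    ∃ a b : ℝ, 0 < a ∧ tsupport θ ⊆ annulus κ a b := by
  rcases (tsupport θ).eq_empty_or_nonempty with h | h
  · exact ⟨1, 1, one_pos, by simp [h]⟩
  obtain ⟨x, hx, hxm⟩ := hθ.compact.isCompact.exists_isMinOn h (continuous_knorm κ).continuousOn
  obtain ⟨y, hy, hym⟩ := hθ.compact.isCompact.exists_isMaxOn h (continuous_knorm κ).continuousOn
  have hx0 : x ≠ 0 := fun h => hθ.zero_notMem (h ▸ hx)
  have := knorm_pos hκ hx0
  refine ⟨knorm κ x / 2, knorm κ y + 1, by linarith, fun z hz => ⟨?_, ?_⟩⟩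
  · have := isMinOn_iff.1 hxm z hz
    linarith
  · have := isMaxOn_iff.1 hym z hz
    linarith

/-- Leibniz' rule by induction, for all cutoffs and families at once. One derivative falls on θ,
giving another cutoff, or on `G j`, giving another family of the same kind. -/
lemma exists_bound_iterate_partialDeriv_mul (l : Fin n) {A : Set (E n)} (hA : MeasurableSet A)
    (N : ℕ) {θ : E n → ℂ} (hθ : Cutoff θ) (hθA : tsupport θ ⊆ A) (G : ℤ → E n → ℂ)
    (hG : ∀ j, Smooth0 (G j))
    (hGA : ∀ i, ∃ C : ℝ≥0, ∀ j, ∫⁻ x in A, ‖(partialDeriv l)^[i] (G j) x‖ₑ ≤ C) :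
    ∃ C : ℝ≥0, ∀ j, ∫⁻ x, ‖(partialDeriv l)^[N] (fun x => θ x * G j x) x‖ₑ ≤ C := by
  induction N generalizing θ G with
  | zero =>
    obtain ⟨B, hB⟩ := hθ.compact.exists_bound_of_continuous hθ.smooth.continuous
    obtain ⟨C, hC⟩ := hGA 0
    refine ⟨B.toNNReal * C, fun j => ?_⟩
    have h1 : ∀ x, ‖θ x * G j x‖ₑ ≤ A.indicator (fun x => (B.toNNReal : ℝ≥0∞) * ‖G j x‖ₑ) x := by
      intro x
      by_cases hx : x ∈ A
      · rw [indicator_of_mem hx, enorm_mul]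
        gcongr
        rw [← ofReal_norm]
        exact ENNReal.ofReal_le_ofReal (hB x)
      · rw [indicator_of_notMem hx, image_eq_zero_of_notMem_tsupport (fun h => hx (hθA h))]
        simp
    refine (lintegral_mono h1).trans ?_
    rw [lintegral_indicator hA, lintegral_const_mul' _ _ ENNReal.coe_ne_top]
    push_cast
    exact mul_le_mul_right (hC j) _
  | succ N ih =>
    obtain ⟨C1, h1⟩ := ih (hθ.partialDeriv l)
      ((tsupport_fderiv_apply_subset ℝ _).trans hθA) G hG hGA
    obtain ⟨C2, h2⟩ := ih hθ hθA (fun j => partialDeriv l (G j)) (fun j => (hG j).partialDeriv l)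
      (fun i => hGA (i + 1))
    refine ⟨C1 + C2, fun j => ?_⟩
    have s1 := (hθ.partialDeriv l).mul_right (hG j)
    have s2 := hθ.mul_right ((hG j).partialDeriv l)
    rw [Function.iterate_succ_apply, partialDeriv_cutoff_mul hθ (hG j),
      iterate_partialDeriv_add s1.smooth s2.smooth]
    refine (lintegral_mono fun x => enorm_add_le _ _).trans ?_
    rw [lintegral_add_left
      (contDiff_iterate_partialDeriv s1.smooth l N).continuous.enorm.measurable]
    push_cast
    exact add_le_add (h1 j) (h2 j)

/-- The Schwartz function `θ g`. -/
def cutMul {θ g : E n → ℂ} (hθ : Cutoff θ) (hg : Smooth0 g) : 𝓢(E n, ℂ) :=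
  (hθ.mul_right hg).compact.toSchwartzMap (hθ.mul_right hg).smooth

@[simp] lemma cutMul_apply {θ g : E n → ℂ} (hθ : Cutoff θ) (hg : Smooth0 g) (x : E n) :
    cutMul hθ hg x = θ x * g x := rfl

lemma enorm_fourierInv_le (Φ : 𝓢(E n, ℂ)) (x : E n) : ‖(𝓕⁻ Φ) x‖ₑ ≤ ∫⁻ y, ‖Φ y‖ₑ := by
  rw [SchwartzMap.fourierInv_coe, Real.fourierInv_eq]
  refine (enorm_integral_le_lintegral_enorm _).trans (le_of_eq (lintegral_congr fun y => ?_))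
  rw [← ofReal_norm, ← ofReal_norm, Circle.norm_smul]

-- Under 𝓕⁻ each derivative becomes multiplication by −2πi xˡ. The factors 2π ≥ 1 are discarded.
open LineDeriv in
lemma enorm_coord_pow_mul_fourierInv_le (Φ : 𝓢(E n, ℂ)) (l : Fin n) (N : ℕ) (x : E n) :
    ‖x l‖ₑ ^ N * ‖(𝓕⁻ Φ) x‖ₑ ≤ ∫⁻ y, ‖(partialDeriv l)^[N] Φ y‖ₑ := by
  induction N generalizing Φ with
  | zero => simpa using enorm_fourierInv_le Φ x
  | succ N ih =>
    have h := ih (∂_{EuclideanSpace.single l (1 : ℝ)} Φ)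
    have h2 : ((∂_{EuclideanSpace.single l (1 : ℝ)} Φ : 𝓢(E n, ℂ)) : E n → ℂ) =
        partialDeriv l Φ := by
      funext y
      rw [SchwartzMap.lineDerivOp_apply_eq_fderiv]; rfl
    rw [h2, ← Function.iterate_succ_apply, SchwartzMap.fourierInv_lineDerivOp_eq] at h
    refine le_trans ?_ h
    have h3 : (fun y : E n => inner ℝ y (EuclideanSpace.single l (1 : ℝ))).HasTemperateGrowth := by
      fun_prop
    rw [smul_apply, SchwartzMap.smulLeftCLM_apply_apply h3]
    simp only [EuclideanSpace.inner_single_right, one_mul, conj_trivial, enorm_smul, pow_succ]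
    rw [mul_assoc]
    refine mul_le_mul_right ?_ _
    refine le_mul_of_one_le_left' ?_
    rw [← ofReal_norm]
    simp only [norm_neg, norm_mul, Complex.norm_I, Complex.norm_real, mul_one,
      Complex.norm_two, Real.norm_eq_abs, abs_of_pos Real.pi_pos]
    rw [ENNReal.one_le_ofReal]
    linarith [Real.pi_gt_three]

end AnisoMult

end

/-! ### Uniform kernel estimates and the dyadic decomposition of `m`. -/

noncomputable section

namespace AnisoMult

variable {n : ℕ} {κ : Fin n → ℕ}

/-! ### Decay of the dyadic kernels -/

/-- The inverse Fourier transform of `θ(ξ) m(δ_{2^j} ξ)`. -/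
def kern {θ m : E n → ℂ} (hθ : Cutoff θ) (hm : IsMultiplier κ m) (j : ℤ) : 𝓢(E n, ℂ) :=
  𝓕⁻ (cutMul hθ (Smooth0.comp_dil (κ := κ) hm.smooth j))

lemma exists_bound_lintegral_cutMul (hκ : ∀ l, 0 < κ l) {θ m : E n → ℂ} (hθ : Cutoff θ)
    (hm : IsMultiplier κ m) (l : Fin n) (N : ℕ) : ∃ C : ℝ≥0, ∀ j : ℤ,
      ∫⁻ x, ‖(partialDeriv l)^[N] (cutMul hθ (Smooth0.comp_dil (κ := κ) hm.smooth j)) x‖ₑ ≤ C := by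
  obtain ⟨a, b, ha, hab⟩ := hθ.exists_annulus hκ
  exact exists_bound_iterate_partialDeriv_mul l (measurableSet_annulus κ a b) N hθ hab
    (fun j => m ∘ dil κ j) (fun j => Smooth0.comp_dil hm.smooth j)
    (fun i => exists_bound_annulus hκ hm l i ha b)

lemma exists_bound_coord_pow_kern (hκ : ∀ l, 0 < κ l) {θ m : E n → ℂ} (hθ : Cutoff θ)
    (hm : IsMultiplier κ m) (l : Fin n) (N : ℕ) : ∃ C : ℝ, 0 ≤ C ∧ ∀ (j : ℤ) (x : E n),
      |x l| ^ N * ‖kern hθ hm j x‖ ≤ C := by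
  obtain ⟨C, hC⟩ := exists_bound_lintegral_cutMul hκ hθ hm l N
  refine ⟨C, C.2, fun j x => ?_⟩
  have h := (enorm_coord_pow_mul_fourierInv_le _ l N x).trans (hC j)
  change ‖x l‖ₑ ^ N * ‖kern hθ hm j x‖ₑ ≤ C at h
  rw [← ofReal_norm, ← ofReal_norm, ← ENNReal.ofReal_pow (norm_nonneg _),
    ← ENNReal.ofReal_mul (by positivity), ENNReal.ofReal_le_coe] at h
  simpa using h

/-- At each point it suffices to weight with the largest coordinate: the N-th power of that
coordinate controls the region of large x, and the unweighted bound controls the rest. -/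
theorem exists_kern_bound (hn : 0 < n) (hκ : ∀ l, 0 < κ l) {θ m : E n → ℂ} (hθ : Cutoff θ)
    (hm : IsMultiplier κ m) (N : ℕ) : ∃ C : ℝ, 0 ≤ C ∧ ∀ (j : ℤ) (x : E n),
      ‖kern hθ hm j x‖ ≤ C * ((1 + knorm κ x) ^ N)⁻¹ := by
  have : Nonempty (Fin n) := ⟨⟨0, hn⟩⟩
  choose C hC0 hC using fun l => exists_bound_coord_pow_kern hκ hθ hm l N
  obtain ⟨D, hD0, hD⟩ := exists_bound_coord_pow_kern hκ hθ hm ⟨0, hn⟩ 0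
  refine ⟨(2 * n + 1) ^ N * (D + ∑ l, C l), by
    have := Finset.sum_nonneg fun l (_ : l ∈ Finset.univ) => hC0 l
    positivity, fun j x => ?_⟩
  have hk := knorm_nonneg (κ := κ) x
  rw [← div_eq_mul_inv, le_div_iff₀ (by positivity)]
  obtain ⟨l, hl⟩ := Finite.exists_max fun l => |x l|
  -- Each root satisfies |xⁱ|^(1/κᵢ) ≤ 1 + |xⁱ| ≤ 2 max(1, |xˡ|), and the n roots together with the
  -- summand 1 give 2n + 1.
  have h1 : 1 + knorm κ x ≤ (2 * n + 1) * max 1 |x l| := by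
    have : knorm κ x ≤ ∑ _l : Fin n, 2 * max 1 |x l| := by
      refine (knorm_le_sum x).trans (Finset.sum_le_sum fun i _ => ?_)
      refine (root_le_one_add hκ i (abs_nonneg _)).trans ?_
      linarith [hl i, le_max_left 1 |x l|, le_max_right 1 |x l|]
    simp only [Finset.sum_const, Finset.card_univ, Fintype.card_fin, nsmul_eq_mul] at this
    linarith [le_max_left 1 |x l|]
  have h2 : max 1 |x l| ^ N ≤ 1 + |x l| ^ N := by
    rcases max_cases 1 |x l| with ⟨h, _⟩ | ⟨h, _⟩ <;> rw [h]
    · simp [pow_nonneg]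
    · linarith
  have h3 := hC l j x
  have h4 := hD j x
  have h5 : C l ≤ ∑ l, C l := Finset.single_le_sum (fun l _ => hC0 l) (Finset.mem_univ l)
  rw [pow_zero, one_mul] at h4
  calc ‖kern hθ hm j x‖ * (1 + knorm κ x) ^ N
      ≤ ‖kern hθ hm j x‖ * ((2 * n + 1) ^ N * (1 + |x l| ^ N)) := by
        gcongr
        refine (pow_le_pow_left₀ (by positivity) h1 N).trans ?_
        rw [mul_pow]
        gcongr
    _ = (2 * n + 1) ^ N * (‖kern hθ hm j x‖ + |x l| ^ N * ‖kern hθ hm j x‖) := by ring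
    _ ≤ _ := by gcongr; linarith

lemma Cutoff.coord_mul {θ : E n → ℂ} (hθ : Cutoff θ) (l : Fin n) :
    Cutoff (fun x => θ x * ((2 * Real.pi * Complex.I) * (x l : ℂ))) := by
  refine hθ.mul_right (ContDiff.contDiffOn ?_)
  have : ContDiff ℝ ∞ fun x : E n => (x l : ℝ) := by fun_prop
  exact contDiff_const.mul (Complex.ofRealCLM.contDiff.comp this)

open LineDeriv in
lemma partialDeriv_kern {θ m : E n → ℂ} (hθ : Cutoff θ) (hm : IsMultiplier κ m) (j : ℤ)
    (l : Fin n) : partialDeriv l (kern hθ hm j) = kern (hθ.coord_mul l) hm j := by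
  have h3 : (fun y : E n => inner ℝ y (EuclideanSpace.single l (1 : ℝ))).HasTemperateGrowth := by
    fun_prop
  funext x
  have h := SchwartzMap.lineDerivOp_fourierInv_eq
    (cutMul hθ (Smooth0.comp_dil (κ := κ) hm.smooth j)) (EuclideanSpace.single l (1 : ℝ))
  have h2 := congrArg (fun g : 𝓢(E n, ℂ) => g x) h
  simp only [SchwartzMap.lineDerivOp_apply_eq_fderiv] at h2
  refine h2.trans ?_
  unfold kern
  congr 2
  ext y
  rw [smul_apply, SchwartzMap.smulLeftCLM_apply_apply h3]
  simp only [EuclideanSpace.inner_single_right, one_mul, conj_trivial, cutMul_apply,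
    Function.comp_apply, smul_eq_mul, Complex.real_smul]
  ring

lemma norm_fderiv_le_sum (g : E n → ℂ) (x h : E n) :
    ‖fderiv ℝ g x h‖ ≤ ∑ l, |h l| * ‖partialDeriv l g x‖ := by
  have : h = ∑ l, h l • EuclideanSpace.single l (1 : ℝ) := by
    ext i
    simp [Finset.sum_apply, Pi.single_apply]
  conv_lhs => rw [this]
  rw [map_sum]
  refine (norm_sum_le _ _).trans (Finset.sum_le_sum fun l _ => ?_)
  rw [map_smul, norm_smul, Real.norm_eq_abs]
  rfl

/-- A derivative of the kernel multiplies the symbol by 2πiξₗ, so it is the kernel of another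
cutoff, with the same decay. The mean value inequality on the segment then gains |hˡ| ≤ |h|_κ^κₗ ≤
|h|_κ, the last step because |h|_κ ≤ 1. -/
theorem exists_kern_sub_bound (hn : 0 < n) (hκ : ∀ l, 0 < κ l) {θ m : E n → ℂ} (hθ : Cutoff θ)
    (hm : IsMultiplier κ m) (N : ℕ) : ∃ C : ℝ, 0 ≤ C ∧ ∀ (j : ℤ) (w h : E n), knorm κ h ≤ 1 →
      ‖kern hθ hm j w - kern hθ hm j (w - h)‖ ≤ C * knorm κ h * ((1 + knorm κ w) ^ N)⁻¹ := by
  choose C hC0 hC using fun l => exists_kern_bound hn hκ (hθ.coord_mul l) hm N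
  refine ⟨(∑ l, C l) * 2 ^ N, mul_nonneg (Finset.sum_nonneg fun l _ => hC0 l) (by positivity),
    fun j w h hh => ?_⟩
  have hw := knorm_nonneg (κ := κ) w
  have hh0 := knorm_nonneg (κ := κ) h
  have hd : ∀ s ∈ Icc (0 : ℝ) 1, HasDerivWithinAt (fun s : ℝ => kern hθ hm j (w - h + s • h))
      (fderiv ℝ (kern hθ hm j) (w - h + s • h) h) (Icc 0 1) s := by
    intro s _
    have h1 := ((kern hθ hm j).differentiableAt (x := w - h + s • h)).hasFDerivAt
    have h2 : HasDerivAt (fun s : ℝ => w - h + s • h) h s := by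
      simpa using ((hasDerivAt_id s).smul_const h).const_add (w - h)
    exact (h1.comp_hasDerivAt s h2).hasDerivWithinAt
  have hb : ∀ s ∈ Ico (0 : ℝ) 1, ‖fderiv ℝ (kern hθ hm j) (w - h + s • h) h‖ ≤
      (∑ l, C l) * 2 ^ N * knorm κ h * ((1 + knorm κ w) ^ N)⁻¹ := by
    intro s hs
    refine (norm_fderiv_le_sum _ _ _).trans ?_
    -- A point of the segment differs from w by (1 − s)h, of gauge at most 1, so the weights at the
    -- two points are comparable.
    have h5 : 1 + knorm κ w ≤ 2 * (1 + knorm κ (w - h + s • h)) := by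
      have e1 : w = (w - h + s • h) + (1 - s) • h := by module
      have e2 := knorm_add_le hκ (w - h + s • h) ((1 - s) • h)
      rw [← e1] at e2
      have e3 : knorm κ ((1 - s) • h) ≤ knorm κ h :=
        knorm_smul_le (by rw [abs_le]; constructor <;> linarith [hs.1, hs.2]) _
      linarith [knorm_nonneg (κ := κ) (w - h + s • h)]
    have h6 := knorm_nonneg (κ := κ) (w - h + s • h)
    have h7 : ((1 + knorm κ (w - h + s • h)) ^ N)⁻¹ ≤ 2 ^ N * ((1 + knorm κ w) ^ N)⁻¹ := by
      rw [← div_eq_mul_inv, inv_le_iff_one_le_mul₀ (by positivity), ← mul_div_right_comm,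
        ← mul_pow, one_le_div (by positivity)]
      exact pow_le_pow_left₀ (by positivity) h5 N
    rw [Finset.sum_mul, Finset.sum_mul, Finset.sum_mul]
    refine Finset.sum_le_sum fun l _ => ?_
    have h8 : |h l| ≤ knorm κ h :=
      (abs_coord_le hκ h l).trans (pow_le_of_le_one hh0 hh (hκ l).ne')
    rw [partialDeriv_kern]
    calc |h l| * ‖kern (hθ.coord_mul l) hm j (w - h + s • h)‖
        ≤ knorm κ h * (C l * (2 ^ N * ((1 + knorm κ w) ^ N)⁻¹)) := by
          have := hC l j (w - h + s • h)
          have := hC0 l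
          gcongr
          exact (hC l j _).trans (by gcongr)
      _ = _ := by ring
  have := norm_image_sub_le_of_norm_deriv_le_segment_01' hd hb
  simpa using this

/-- The integral is the value of the symbol at 0, where the cutoff vanishes. This cancellation is
what brings in the oscillation of f in part (B). -/
lemma integral_kern_eq_zero {θ m : E n → ℂ} (hθ : Cutoff θ) (hm : IsMultiplier κ m) (j : ℤ) :
    ∫ x, kern hθ hm j x = 0 := by
  have h : (𝓕 (kern hθ hm j)) 0 = 0 := by
    unfold kern
    rw [FourierTransform.fourier_fourierInv_eq, cutMul_apply,
      image_eq_zero_of_notMem_tsupport hθ.zero_notMem, zero_mul]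
  rw [SchwartzMap.fourier_coe, Real.fourier_eq] at h
  simpa using h

/-! ### The dyadic partition of unity -/

/-- The bump function underlying the cutoff `chi`. -/
def chiBump (n : ℕ) : ContDiffBump (0 : E n) := ⟨1, 2, one_pos, one_lt_two⟩

/-- A smooth function that is `1` on the unit ball and vanishes off the ball of radius `2`. -/
def chi (x : E n) : ℂ := ((chiBump n x : ℝ) : ℂ)

lemma contDiff_chi : ContDiff ℝ ∞ (chi (n := n)) :=
  Complex.ofRealCLM.contDiff.comp (chiBump n).contDiff

lemma hasCompactSupport_chi : HasCompactSupport (chi (n := n)) :=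
  (chiBump n).hasCompactSupport.comp_left (g := Complex.ofReal) (by simp)

lemma chi_eq_one {x : E n} (hx : ‖x‖ ≤ 1) : chi x = 1 := by
  simp only [chi]
  rw [(chiBump n).one_of_mem_closedBall (by simpa [chiBump] using hx)]
  simp

lemma chi_eq_zero {x : E n} (hx : 2 ≤ ‖x‖) : chi x = 0 := by
  simp only [chi]
  rw [(chiBump n).zero_of_le_dist (by simpa [chiBump] using hx)]
  simp

lemma norm_chi_le (x : E n) : ‖chi x‖ ≤ 1 := by
  simp only [chi, Complex.norm_real, Real.norm_eq_abs]
  rw [abs_of_nonneg (chiBump n).nonneg]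
  exact (chiBump n).le_one

/-- The building block of the anisotropic dyadic partition of unity. -/
def theta (κ : Fin n → ℕ) (x : E n) : ℂ := chi x - chi (dil κ 1 x)

lemma cutoff_theta (κ : Fin n → ℕ) : Cutoff (theta κ) where
  smooth := contDiff_chi.sub (contDiff_chi.comp (dil κ 1).contDiff)
  compact := by
    have h : HasCompactSupport (chi ∘ dil κ 1) :=
      hasCompactSupport_chi.comp_homeomorph (dil κ 1).toHomeomorph
    exact hasCompactSupport_chi.sub h
  zero_notMem := by
    rw [notMem_tsupport_iff_eventuallyEq]
    have h1 : ∀ᶠ x : E n in 𝓝 0, ‖x‖ < 1 :=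
      continuous_norm.tendsto' (0 : E n) 0 norm_zero |>.eventually (gt_mem_nhds one_pos)
    have h2 : ∀ᶠ x : E n in 𝓝 0, ‖dil κ 1 x‖ < 1 :=
      ((dil κ 1).continuous.norm.tendsto' (0 : E n) 0 (by simp)).eventually (gt_mem_nhds one_pos)
    filter_upwards [h1, h2] with x hx hx'
    simp [theta, chi_eq_one hx.le, chi_eq_one hx'.le]

/-- The sum telescopes. The right side is eventually 1 at each point off the origin, so the
θ(δ_{2^-j}·) form a partition of unity there. -/
lemma sum_theta (J : ℕ) (x : E n) : ∑ j ∈ Finset.Ioc (-(J : ℤ)) J, theta κ (dil κ (-j) x) =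
    chi (dil κ (-J) x) - chi (dil κ J x) := by
  have key : ∀ k : ℕ, ∀ a : ℤ, ∑ j ∈ Finset.Ioc a (a + k), theta κ (dil κ (-j) x) =
      chi (dil κ (-(a + k)) x) - chi (dil κ (-a) x) := by
    intro k a
    induction k with
    | zero => simp
    | succ k ih =>
      have h1 : Finset.Ioc a (a + (k + 1 : ℕ)) = insert (a + k + 1) (Finset.Ioc a (a + k)) := by
        ext i; simp only [Finset.mem_Ioc, Finset.mem_insert]; push_cast; omega
      rw [h1, Finset.sum_insert (by simp), ih]
      simp only [theta, dil_dil]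
      rw [show 1 + -(a + k + 1) = -(a + k : ℤ) by ring]
      push_cast
      rw [← add_assoc]
      ring
  have := key (2 * J) (-J)
  rw [show (-(J : ℤ) + (2 * J : ℕ)) = J by push_cast; ring] at this
  simpa using this

/-- The piece `θ(δ_{2^{-j}} ξ) m(ξ)` of the multiplier. -/
def psi {m : E n → ℂ} (hm : IsMultiplier κ m) (j : ℤ) : 𝓢(E n, ℂ) :=
  SchwartzMap.compCLMOfContinuousLinearEquiv ℂ (dil κ (-j))
    (cutMul (cutoff_theta κ) (Smooth0.comp_dil (κ := κ) hm.smooth j))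

@[simp] lemma psi_apply {m : E n → ℂ} (hm : IsMultiplier κ m) (j : ℤ) (x : E n) :
    psi hm j x = theta κ (dil κ (-j) x) * m x := by
  simp [psi, dil_dil_neg]

lemma inner_dil (j : ℤ) (x y : E n) : inner ℝ (dil κ j x) y = inner ℝ x (dil κ j y) := by
  simp only [PiLp.inner_apply, dil_apply]
  refine Finset.sum_congr rfl fun l _ => ?_
  simp
  ring

/-- Each piece has as kernel an L¹-normalised dilate of a unit-scale kernel, so estimates at scale
2^j reduce to those for `kern`. -/
lemma fourierInv_psi {m : E n → ℂ} (hm : IsMultiplier κ m) (j : ℤ) (x : E n) :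
    (𝓕⁻ (psi hm j)) x =
      (2 : ℂ) ^ (j * (∑ l, κ l : ℕ)) * kern (cutoff_theta κ) hm j (dil κ j x) := by
  unfold kern
  rw [SchwartzMap.fourierInv_coe, SchwartzMap.fourierInv_coe, Real.fourierInv_eq, Real.fourierInv_eq]
  have h := integral_comp_dil (κ := κ) (-j) fun v => Real.fourierChar (inner ℝ v (dil κ j x)) •
    (cutMul (cutoff_theta κ) (Smooth0.comp_dil (κ := κ) hm.smooth j)) v
  rw [neg_neg] at h
  rw [← h]
  refine integral_congr_ae (Eventually.of_forall fun v => ?_)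
  simp only [← inner_dil, dil_dil_neg]
  rfl

/-- The partial sum `∑_{j ∈ S} θ(δ_{2^{-j}} ξ) m(ξ)`. -/
def psiSum {m : E n → ℂ} (hm : IsMultiplier κ m) (S : Finset ℤ) : 𝓢(E n, ℂ) :=
  ∑ j ∈ S, psi hm j

lemma fourierInv_psiSum {m : E n → ℂ} (hm : IsMultiplier κ m) (S : Finset ℤ) (x : E n) :
    (𝓕⁻ (psiSum hm S)) x = ∑ j ∈ S, (𝓕⁻ (psi hm j)) x := by
  have : 𝓕⁻ (psiSum hm S) = ∑ j ∈ S, 𝓕⁻ (psi hm j) := by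
    unfold psiSum
    exact map_sum (FourierTransform.fourierInvCLM ℂ 𝓢(E n, ℂ)) _ _
  rw [this]
  simp

end AnisoMult

end

noncomputable section

namespace AnisoMult

variable {n : ℕ} {κ : Fin n → ℕ}

/-! ### The Hörmander condition -/

/-- With 2^k ≤ r < 2^(k+1), the summand is at most 2·2^(-|j+k|). Translating the index by k gives
one convergent series for all r and S. -/
lemma exists_sum_min_bound : ∃ C : ℝ, 0 ≤ C ∧ ∀ (r : ℝ) (S : Finset ℤ), 0 < r →
    ∑ j ∈ S, min (2 ^ j * r) (2 ^ j * r)⁻¹ ≤ C := by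
  have hs : Summable fun i : ℤ => (2 : ℝ) * (1 / 2) ^ i.natAbs := by
    refine Summable.mul_left _ ?_
    refine Summable.of_nat_of_neg ?_ ?_ <;>
      simpa using summable_geometric_of_lt_one (by norm_num : (0 : ℝ) ≤ 1 / 2) (by norm_num)
  refine ⟨∑' i : ℤ, (2 : ℝ) * (1 / 2) ^ i.natAbs, tsum_nonneg fun i => by positivity,
    fun r S hr => ?_⟩
  obtain ⟨k, hk1, hk2⟩ := exists_mem_Ico_zpow hr one_lt_two
  have h1 : ∀ j ∈ S, min (2 ^ j * r) (2 ^ j * r)⁻¹ ≤ (2 : ℝ) * (1 / 2) ^ (j + k).natAbs := by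
    intro j _
    rcases le_or_gt 0 (j + k) with h | h
    · refine (min_le_right _ _).trans ?_
      obtain ⟨i, hi⟩ := Int.eq_ofNat_of_zero_le h
      have h2 : (2 : ℝ) ^ i ≤ 2 ^ j * r := by
        rw [← zpow_natCast, ← hi, zpow_add₀ two_ne_zero]
        gcongr
      rw [hi]
      simp only [Int.natAbs_natCast, one_div, inv_pow]
      have h3 := inv_anti₀ (by positivity) h2
      have h4 : (0 : ℝ) ≤ (2 ^ i)⁻¹ := by positivity
      linarith
    · refine (min_le_left _ _).trans ?_
      obtain ⟨i, hi⟩ := Int.eq_ofNat_of_zero_le (a := -(j + k)) (by omega)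
      have h2 : (2 : ℝ) ^ j * r ≤ 2 ^ (j + k + 1) := by
        rw [add_assoc, zpow_add₀ two_ne_zero]
        gcongr
      refine h2.trans (le_of_eq ?_)
      have h3 : j + k = -(i : ℤ) := by rw [← hi]; ring
      rw [zpow_add₀ two_ne_zero, h3]
      simp [mul_comm]
  refine (Finset.sum_le_sum h1).trans ?_
  have := hs.sum_le_tsum (S.map (Equiv.addRight k).toEmbedding) fun i _ => by positivity
  rw [Finset.sum_map] at this
  simpa using this

lemma measurableSet_le_knorm (κ : Fin n → ℕ) (r : ℝ) : MeasurableSet {x : E n | r ≤ knorm κ x} :=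
  measurableSet_le measurable_const (continuous_knorm κ).measurable

/-- For s ≤ 1 the difference bound supplies the factor s. For s > 1 both w and w − h have gauge at
least s, and one spare power of decay supplies 1/s. The minimum of the two is what makes the sum
over dyadic scales converge. -/
lemma exists_kern_hormander (hn : 0 < n) (hκ : ∀ l, 0 < κ l) {θ m : E n → ℂ} (hθ : Cutoff θ)
    (hm : IsMultiplier κ m) : ∃ C : ℝ≥0, ∀ (j : ℤ) (s : ℝ) (h : E n), 0 < s → knorm κ h ≤ s →
      ∫⁻ w in {w : E n | 2 * s ≤ knorm κ w}, ‖kern hθ hm j (w - h) - kern hθ hm j w‖ₑ ≤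
        C * ENNReal.ofReal (min s s⁻¹) := by
  obtain ⟨C1, hC1, h1⟩ := exists_kern_bound hn hκ hθ hm (intExp κ + 1)
  obtain ⟨C2, hC2, h2⟩ := exists_kern_sub_bound hn hκ hθ hm (intExp κ)
  set I := ∫⁻ x : E n, ENNReal.ofReal (((1 + knorm κ x) ^ (intExp κ))⁻¹) with hI
  have hIt : I ≠ ⊤ := (lintegral_one_add_knorm_inv_lt_top hκ le_rfl).ne
  refine ⟨(ENNReal.ofReal (2 * C1 + C2) * I).toNNReal, fun j s h hs hh => ?_⟩
  rw [ENNReal.coe_toNNReal (ENNReal.mul_ne_top ENNReal.ofReal_ne_top hIt)]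
  rcases le_or_gt s 1 with hs1 | hs1
  · rw [min_eq_left (hs1.trans (one_le_inv_iff₀.2 ⟨hs, hs1⟩))]
    calc ∫⁻ w in {w : E n | 2 * s ≤ knorm κ w}, ‖kern hθ hm j (w - h) - kern hθ hm j w‖ₑ
        ≤ ∫⁻ w, ENNReal.ofReal ((2 * C1 + C2) * s) *
            ENNReal.ofReal (((1 + knorm κ w) ^ (intExp κ))⁻¹) := by
          refine (setLIntegral_le_lintegral _ _).trans (lintegral_mono fun w => ?_)
          have h0 := knorm_nonneg (κ := κ) w
          rw [← ENNReal.ofReal_mul (by positivity), ← ofReal_norm, norm_sub_rev]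
          refine ENNReal.ofReal_le_ofReal ((h2 j w h (hh.trans hs1)).trans ?_)
          have : C2 * knorm κ h ≤ (2 * C1 + C2) * s :=
            mul_le_mul (by linarith) hh (knorm_nonneg _) (by linarith)
          gcongr
      _ = _ := by
          rw [lintegral_const_mul' _ _ ENNReal.ofReal_ne_top, ENNReal.ofReal_mul (by positivity)]
          ring
  · rw [min_eq_right ((inv_le_one_of_one_le₀ hs1.le).trans hs1.le)]
    have hb : ∀ w : E n, s ≤ knorm κ w → ‖kern hθ hm j w‖ₑ ≤ ENNReal.ofReal (C1 * s⁻¹) *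
        ENNReal.ofReal (((1 + knorm κ w) ^ (intExp κ))⁻¹) := by
      intro w hw
      have h0 := knorm_nonneg (κ := κ) w
      rw [← ENNReal.ofReal_mul (by positivity), ← ofReal_norm]
      refine ENNReal.ofReal_le_ofReal ((h1 j w).trans ?_)
      rw [pow_succ', mul_inv, mul_assoc]
      gcongr
      linarith
    calc ∫⁻ w in {w : E n | 2 * s ≤ knorm κ w}, ‖kern hθ hm j (w - h) - kern hθ hm j w‖ₑ
        ≤ ∫⁻ w in {w : E n | 2 * s ≤ knorm κ w}, (ENNReal.ofReal (C1 * s⁻¹) *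
            ENNReal.ofReal (((1 + knorm κ (w - h)) ^ (intExp κ))⁻¹) + ENNReal.ofReal (C1 * s⁻¹) *
            ENNReal.ofReal (((1 + knorm κ w) ^ (intExp κ))⁻¹)) := by
          refine setLIntegral_mono' (measurableSet_le_knorm κ _) fun w hw => ?_
          have hw : 2 * s ≤ knorm κ w := hw
          refine (enorm_sub_le).trans (add_le_add (hb _ ?_) (hb _ (by linarith)))
          have := knorm_add_le hκ (w - h) h
          rw [sub_add_cancel] at this
          linarith
      _ ≤ ∫⁻ w, (ENNReal.ofReal (C1 * s⁻¹) *
            ENNReal.ofReal (((1 + knorm κ (w - h)) ^ (intExp κ))⁻¹) + ENNReal.ofReal (C1 * s⁻¹) *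
            ENNReal.ofReal (((1 + knorm κ w) ^ (intExp κ))⁻¹)) := setLIntegral_le_lintegral _ _
      _ = ENNReal.ofReal (C1 * s⁻¹) * I + ENNReal.ofReal (C1 * s⁻¹) * I := by
          have hmeas : Measurable fun w : E n =>
              ENNReal.ofReal (((1 + knorm κ w) ^ (intExp κ))⁻¹) := by
            have := (continuous_knorm κ).measurable
            fun_prop
          rw [lintegral_add_right _ (hmeas.const_mul _),
            lintegral_const_mul' _ _ ENNReal.ofReal_ne_top,
            lintegral_const_mul' _ _ ENNReal.ofReal_ne_top, lintegral_sub_right_eq_self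
            (fun w : E n => ENNReal.ofReal (((1 + knorm κ w) ^ (intExp κ))⁻¹))]
      _ = ENNReal.ofReal ((2 * C1) * s⁻¹) * I := by
          rw [← two_mul, mul_assoc 2 C1, ENNReal.ofReal_mul (p := 2) (by norm_num)]
          simp [mul_assoc]
      _ ≤ ENNReal.ofReal ((2 * C1 + C2) * s⁻¹) * I := by
          gcongr
          linarith
      _ = _ := by
          rw [ENNReal.ofReal_mul (by positivity)]
          ring

/-- The Hörmander condition for a convolution kernel, with respect to the gauge `|x|_κ`. -/
def Hormander (κ : Fin n → ℕ) (C : ℝ≥0) (K : E n → ℂ) : Prop :=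
  ∀ (r : ℝ) (y : E n), 0 < r → knorm κ y ≤ r →
    ∫⁻ x in {x : E n | 2 * r ≤ knorm κ x}, ‖K (x - y) - K x‖ₑ ≤ C

/-- Dilating by δ_{2^j} turns the condition at radius r for the j-th piece into the unit-scale
estimate at s = 2^j r. The resulting sum of min(s, 1/s) is bounded independently of r and S, which
is what later permits removing the truncation. -/
theorem exists_hormander_psiSum (hn : 0 < n) (hκ : ∀ l, 0 < κ l) {m : E n → ℂ}
    (hm : IsMultiplier κ m) : ∃ C : ℝ≥0, ∀ S : Finset ℤ, Hormander κ C (𝓕⁻ (psiSum hm S) : 𝓢(E n, ℂ)) := by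
  obtain ⟨C1, h1⟩ := exists_kern_hormander hn hκ (cutoff_theta κ) hm
  obtain ⟨C2, hC2, h2⟩ := exists_sum_min_bound
  refine ⟨C1 * C2.toNNReal, fun S r y hr hy => ?_⟩
  have hj : ∀ j : ℤ, ∫⁻ x in {x : E n | 2 * r ≤ knorm κ x},
      ‖(𝓕⁻ (psi hm j)) (x - y) - (𝓕⁻ (psi hm j)) x‖ₑ ≤
        C1 * ENNReal.ofReal (min (2 ^ j * r) (2 ^ j * r)⁻¹) := by
    intro j
    have h3 := h1 j (2 ^ j * r) (dil κ j y) (by positivity) (by rw [knorm_dil hκ]; gcongr)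
    refine le_trans (le_of_eq ?_) h3
    rw [← lintegral_indicator (measurableSet_le_knorm ..),
      ← lintegral_indicator (measurableSet_le_knorm ..)]
    have h4 := lintegral_comp_dil (κ := κ) j
      ({w : E n | 2 * (2 ^ j * r) ≤ knorm κ w}.indicator fun w =>
        ‖kern (cutoff_theta κ) hm j (w - dil κ j y) - kern (cutoff_theta κ) hm j w‖ₑ)
    have h5 : ∀ F : ℝ≥0∞, ENNReal.ofReal ((2 : ℝ) ^ (j * (∑ l, κ l : ℕ))) *
        (ENNReal.ofReal ((2 : ℝ) ^ (-j * (∑ l, κ l : ℕ))) * F) = F := by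
      intro F
      rw [← mul_assoc, ← ENNReal.ofReal_mul (by positivity), ← zpow_add₀ two_ne_zero]
      simp
    refine Eq.trans ?_ (h5 _)
    rw [← h4, ← lintegral_const_mul' _ _ ENNReal.ofReal_ne_top]
    refine lintegral_congr fun x => ?_
    have h6 : dil κ j x ∈ {w : E n | 2 * (2 ^ j * r) ≤ knorm κ w} ↔
        x ∈ {x : E n | 2 * r ≤ knorm κ x} := by
      simp only [mem_ofPred_eq, knorm_dil hκ]
      rw [mul_left_comm]
      exact mul_le_mul_iff_right₀ (by positivity)
    by_cases hx : x ∈ {x : E n | 2 * r ≤ knorm κ x}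
    · rw [indicator_of_mem hx, indicator_of_mem (h6.2 hx), fourierInv_psi, fourierInv_psi,
        ← mul_sub, enorm_mul, map_sub]
      congr 1
      rw [← ofReal_norm, norm_zpow, Complex.norm_two]
    · rw [indicator_of_notMem hx, indicator_of_notMem (mt h6.1 hx), mul_zero]
  calc ∫⁻ x in {x : E n | 2 * r ≤ knorm κ x},
      ‖(𝓕⁻ (psiSum hm S)) (x - y) - (𝓕⁻ (psiSum hm S)) x‖ₑ
      ≤ ∫⁻ x in {x : E n | 2 * r ≤ knorm κ x},
          ∑ j ∈ S, ‖(𝓕⁻ (psi hm j)) (x - y) - (𝓕⁻ (psi hm j)) x‖ₑ := by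
        refine lintegral_mono fun x => ?_
        simp only [fourierInv_psiSum]
        rw [← Finset.sum_sub_distrib]
        exact enorm_sum_le _ _
    _ = ∑ j ∈ S, ∫⁻ x in {x : E n | 2 * r ≤ knorm κ x},
          ‖(𝓕⁻ (psi hm j)) (x - y) - (𝓕⁻ (psi hm j)) x‖ₑ := by
        refine lintegral_finsetSum _ fun j _ => ?_
        have := (𝓕⁻ (psi hm j)).continuous
        exact Continuous.measurable (by fun_prop)
    _ ≤ ∑ j ∈ S, C1 * ENNReal.ofReal (min (2 ^ j * r) (2 ^ j * r)⁻¹) :=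
        Finset.sum_le_sum fun j _ => hj j
    _ = C1 * ENNReal.ofReal (∑ j ∈ S, min (2 ^ j * r) (2 ^ j * r)⁻¹) := by
        rw [← Finset.mul_sum, ENNReal.ofReal_sum_of_nonneg]
        intro j _
        positivity
    _ ≤ _ := by
        push_cast
        gcongr
        exact ENNReal.ofReal_le_ofReal (h2 r S hr)

end AnisoMult

end

noncomputable section

namespace AnisoMult

variable {n : ℕ} {κ : Fin n → ℕ}

/-! ### Anisotropic dyadic cubes -/

/-- The index of the dyadic cube of generation `k` that contains `x`. -/
def cubeIdx (κ : Fin n → ℕ) (k : ℤ) (x : E n) : Fin n → ℤ := fun l => ⌊dil κ (-k) x l⌋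

/-- The dyadic cube of generation `k` (with side lengths `2^(k κₗ)`) and index `i`. -/
def cube (κ : Fin n → ℕ) (q : ℤ × (Fin n → ℤ)) : Set (E n) := {x | cubeIdx κ q.1 x = q.2}

lemma mem_cube_self (k : ℤ) (x : E n) : x ∈ cube κ (k, cubeIdx κ k x) := rfl

/-- Passing to the parent divides the l-th index by 2^κₗ with rounding down, because κₗ is a
positive integer power of the scale. Nestedness of the grids follows. -/
lemma cubeIdx_succ (k : ℤ) (x : E n) (l : Fin n) :
    cubeIdx κ (k + 1) x l = cubeIdx κ k x l / (2 ^ κ l : ℕ) := by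
  simp only [cubeIdx]
  rw [← Int.floor_div_natCast]
  congr 1
  simp only [dil_apply]
  rw [show -(k + 1) * (κ l : ℤ) = -k * κ l - κ l by ring, zpow_sub₀ two_ne_zero]
  push_cast
  rw [zpow_natCast]
  ring

lemma cubeIdx_eq_of_le {k k' : ℤ} (hk : k ≤ k') {x y : E n} (h : cubeIdx κ k x = cubeIdx κ k y) :
    cubeIdx κ k' x = cubeIdx κ k' y := by
  obtain ⟨d, rfl⟩ := Int.le.dest hk
  clear hk
  induction d with
  | zero => simpa using h
  | succ d ih =>
    funext l
    push_cast
    rw [← add_assoc, cubeIdx_succ, cubeIdx_succ, ih]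

lemma measurable_cubeIdx (k : ℤ) : Measurable (cubeIdx (n := n) κ k) := by
  refine measurable_pi_lambda _ fun l => Int.measurable_floor.comp ?_
  simp only [dil_apply]
  fun_prop

lemma measurableSet_cube (q : ℤ × (Fin n → ℤ)) : MeasurableSet (cube κ q) :=
  measurable_cubeIdx q.1 (measurableSet_singleton q.2)

lemma volume_cube (q : ℤ × (Fin n → ℤ)) : volume (cube κ q) =
    ENNReal.ofReal ((2 : ℝ) ^ (q.1 * (∑ l, κ l : ℕ))) := by
  have h1 : cube κ q = dil κ (-q.1) ⁻¹' {x : E n | ∀ l, ⌊x l⌋ = q.2 l} := by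
    ext x
    simp only [cube, mem_ofPred_eq, mem_preimage, funext_iff]
    rfl
  have h2 : {x : E n | ∀ l, ⌊x l⌋ = q.2 l} = WithLp.ofLp ⁻¹'
      (univ.pi fun l => Ico (q.2 l : ℝ) (q.2 l + 1)) := by
    ext x
    simp [Int.floor_eq_iff]
  have hm : MeasurableSet (univ.pi fun l => Ico (q.2 l : ℝ) (q.2 l + 1)) :=
    MeasurableSet.univ_pi fun l => measurableSet_Ico
  have h3 : volume {x : E n | ∀ l, ⌊x l⌋ = q.2 l} = 1 := by
    rw [h2, (PiLp.volume_preserving_ofLp (Fin n)).measure_preimage hm.nullMeasurableSet,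
      Real.volume_pi_Ico]
    simp
  have hm2 : MeasurableSet {x : E n | ∀ l, ⌊x l⌋ = q.2 l} := by
    rw [h2]; exact (PiLp.volume_preserving_ofLp (Fin n)).measurable hm
  rw [h1, ← Measure.map_apply (dil κ (-q.1)).continuous.measurable hm2, map_dil_volume]
  simp [h3]

lemma volume_cube_pos (q : ℤ × (Fin n → ℤ)) : 0 < volume (cube κ q) := by
  rw [volume_cube]
  exact ENNReal.ofReal_pos.2 (by positivity)

lemma volume_cube_ne_top (q : ℤ × (Fin n → ℤ)) : volume (cube κ q) ≠ ⊤ := by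
  rw [volume_cube]; exact ENNReal.ofReal_ne_top

lemma abs_dil_sub_lt_one {q : ℤ × (Fin n → ℤ)} {x y : E n} (hx : x ∈ cube κ q) (hy : y ∈ cube κ q)
    (l : Fin n) : |dil κ (-q.1) (x - y) l| < 1 := by
  have : ⌊dil κ (-q.1) x l⌋ = ⌊dil κ (-q.1) y l⌋ := by
    have h1 := congrFun hx.out l
    have h2 := congrFun hy.out l
    exact h1.trans h2.symm
  rw [map_sub]
  exact Int.abs_sub_lt_one_of_floor_eq_floor this

lemma knorm_sub_le_of_mem_cube (hκ : ∀ l, 0 < κ l) {q : ℤ × (Fin n → ℤ)} {x y : E n}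
    (hx : x ∈ cube κ q) (hy : y ∈ cube κ q) : knorm κ (x - y) ≤ 2 ^ q.1 * n := by
  have h : knorm κ (dil κ (-q.1) (x - y)) ≤ n := by
    refine (knorm_le_sum _).trans ?_
    calc ∑ l, |dil κ (-q.1) (x - y) l| ^ ((1 : ℝ) / κ l) ≤ ∑ _l : Fin n, (1 : ℝ) :=
          Finset.sum_le_sum fun l _ => Real.rpow_le_one (abs_nonneg _)
            (abs_dil_sub_lt_one hx hy l).le (by positivity)
      _ = n := by simp
  rw [knorm_dil hκ, zpow_neg, inv_mul_le_iff₀ (by positivity)] at h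
  exact h

lemma norm_sub_le_of_mem_cube (hκ : ∀ l, 0 < κ l) {q : ℤ × (Fin n → ℤ)} {x y : E n}
    (hx : x ∈ cube κ q) (hy : y ∈ cube κ q) (hq : q.1 ≤ 0) : ‖x - y‖ ≤ n * 2 ^ q.1 := by
  refine (norm_le_sum_abs _).trans ?_
  calc ∑ l, |(x - y) l| ≤ ∑ _l : Fin n, (2 : ℝ) ^ q.1 := by
        refine Finset.sum_le_sum fun l _ => ?_
        have h := abs_dil_sub_lt_one hx hy l
        rw [dil_apply, abs_mul, abs_of_pos (by positivity), neg_mul, zpow_neg,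
          inv_mul_lt_iff₀ (by positivity), mul_one] at h
        refine h.le.trans (zpow_le_zpow_right₀ one_le_two ?_)
        have : (1 : ℤ) ≤ κ l := by exact_mod_cast hκ l
        nlinarith
    _ = _ := by simp

lemma volume_mul_cube_succ (k : ℤ) (i i' : Fin n → ℤ) : volume (cube κ (k + 1, i')) =
    2 ^ (∑ l, κ l) * volume (cube κ (k, i)) := by
  rw [volume_cube, volume_cube]
  simp only [add_mul, one_mul]
  rw [zpow_add₀ two_ne_zero, ENNReal.ofReal_mul (by positivity), zpow_natCast,
    ENNReal.ofReal_pow (by norm_num), mul_comm]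
  simp

/-- The Calderón–Zygmund stopping cubes. -/
def stopCubes (κ : Fin n → ℕ) (f : E n → ℂ) (t : ℝ≥0∞) : Set (ℤ × (Fin n → ℤ)) :=
  {q | t * volume (cube κ q) < ∫⁻ y in cube κ q, ‖f y‖ₑ ∧ ∀ x ∈ cube κ q, ∀ k', q.1 < k' →
    ∫⁻ y in cube κ (k', cubeIdx κ k' x), ‖f y‖ₑ ≤ t * volume (cube κ (k', cubeIdx κ k' x))}

lemma disjoint_stopCubes (f : E n → ℂ) (t : ℝ≥0∞) :
    Pairwise (Function.onFun Disjoint fun q : stopCubes κ f t => cube κ q.1) := by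
  have key : ∀ q q' : stopCubes κ f t, ∀ x ∈ cube κ q.1, x ∈ cube κ q'.1 →
      q.1.1 ≤ q'.1.1 := by
    rintro ⟨⟨k, i⟩, h1, h2⟩ ⟨⟨k', i'⟩, h1', h2'⟩ x hx hx'
    by_contra! hlt
    have := h2' x hx' k hlt
    have e : cubeIdx κ k x = i := hx
    rw [e] at this
    exact absurd h1 (not_lt.2 this)
  intro q q' hqq'
  rw [Function.onFun, Set.disjoint_left]
  intro x hx hx'
  have hk : q.1.1 = q'.1.1 := le_antisymm (key q q' x hx hx') (key q' q x hx' hx)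
  refine hqq' (Subtype.ext (Prod.ext hk ?_))
  rw [← show cubeIdx κ q.1.1 x = q.1.2 from hx, hk]
  exact hx'

/-- By maximality the parent has average at most t, and its volume is larger by the factor 2^|κ|. -/
lemma lintegral_stopCube_le {f : E n → ℂ} {t : ℝ≥0∞} {q : ℤ × (Fin n → ℤ)}
    (hq : q ∈ stopCubes κ f t) :
    ∫⁻ y in cube κ q, ‖f y‖ₑ ≤ 2 ^ (∑ l, κ l) * t * volume (cube κ q) := by
  obtain ⟨k, i⟩ := q
  have hne : (cube κ (k, i)).Nonempty := nonempty_of_measure_ne_zero (volume_cube_pos _).ne'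
  obtain ⟨x, hx⟩ := hne
  have h := hq.2 x hx (k + 1) (by simp)
  rw [volume_mul_cube_succ k i] at h
  refine (lintegral_mono_set fun y hy => ?_).trans (h.trans (le_of_eq (by ring)))
  have : cubeIdx κ k y = cubeIdx κ k x := by
    rw [show cubeIdx κ k y = i from hy, show cubeIdx κ k x = i from hx]
  exact cubeIdx_eq_of_le (by simp) this

/-- Since f is integrable and volumes grow with the generation, averages over cubes of large
generation are at most t. If some cube around x had a larger average, there would be a greatest such
generation, and that cube would be a stopping cube. -/
lemma lintegral_le_of_notMem_stopCubes (hn : 0 < n) (hκ : ∀ l, 0 < κ l) {f : E n → ℂ} {t : ℝ≥0∞}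
    (ht : t ≠ 0) (ht' : t ≠ ⊤) (hf : ∫⁻ y, ‖f y‖ₑ ≠ ⊤) {x : E n}
    (hx : x ∉ ⋃ q : stopCubes κ f t, cube κ q.1) (k : ℤ) :
    ∫⁻ y in cube κ (k, cubeIdx κ k x), ‖f y‖ₑ ≤ t * volume (cube κ (k, cubeIdx κ k x)) := by
  by_contra! hk
  have hM : 1 ≤ ∑ l, κ l := (hκ ⟨0, hn⟩).trans_le (le_sum_kappa κ ⟨0, hn⟩)
  have hbdd : ∃ b : ℤ, ∀ z : ℤ, t * volume (cube κ (z, cubeIdx κ z x)) <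
      ∫⁻ y in cube κ (z, cubeIdx κ z x), ‖f y‖ₑ → z ≤ b := by
    obtain ⟨N, hN⟩ := pow_unbounded_of_one_lt ((∫⁻ y, ‖f y‖ₑ) / t).toReal one_lt_two
    refine ⟨N, fun z hz => ?_⟩
    by_contra! hlt
    refine absurd (hz.trans_le (setLIntegral_le_lintegral _ _)) (not_lt.2 ?_)
    rw [mul_comm, ← ENNReal.div_le_iff ht ht', volume_cube,
      ← ENNReal.ofReal_toReal (ENNReal.div_ne_top hf ht)]
    refine ENNReal.ofReal_le_ofReal (hN.le.trans ?_)
    rw [← zpow_natCast]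
    refine zpow_le_zpow_right₀ one_le_two (hlt.le.trans ?_)
    have h1 : (1 : ℤ) ≤ (∑ l, κ l : ℕ) := by exact_mod_cast hM
    have h2 : (0 : ℤ) ≤ z := le_trans (by positivity) hlt.le
    simpa using mul_le_mul_of_nonneg_left h1 h2
  obtain ⟨k0, hk0, hmax⟩ := Int.exists_greatest_of_bdd hbdd ⟨k, hk⟩
  refine hx (mem_iUnion.2 ⟨⟨(k0, cubeIdx κ k0 x), hk0, fun y hy k' hk' => ?_⟩, mem_cube_self k0 x⟩)
  rw [cubeIdx_eq_of_le (le_of_lt hk') (show cubeIdx κ k0 y = cubeIdx κ k0 x from hy)]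
  by_contra! h
  exact absurd (hmax k' h) (not_le.2 hk')

/-- For continuous f the small cubes around x play the role of the Lebesgue differentiation theorem.
-/
lemma enorm_le_of_notMem_stopCubes (hn : 0 < n) (hκ : ∀ l, 0 < κ l) {f : E n → ℂ} {t : ℝ≥0∞}
    (ht : t ≠ 0) (ht' : t ≠ ⊤) (hc : Continuous f) (hf : ∫⁻ y, ‖f y‖ₑ ≠ ⊤) {x : E n}
    (hx : x ∉ ⋃ q : stopCubes κ f t, cube κ q.1) : ‖f x‖ₑ ≤ t := by
  by_contra! hlt
  obtain ⟨s, hts, hs⟩ := exists_between hlt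
  have h1 : ∀ᶠ y in 𝓝 x, s < ‖f y‖ₑ := (hc.enorm.tendsto x).eventually (lt_mem_nhds hs)
  obtain ⟨ε, hε, hball⟩ := Metric.eventually_nhds_iff.1 h1
  obtain ⟨N, hN⟩ := exists_pow_lt_of_lt_one (show 0 < ε / n by positivity)
    (show (1 / 2 : ℝ) < 1 by norm_num)
  set k : ℤ := -N
  have hsub : ∀ y ∈ cube κ (k, cubeIdx κ k x), s ≤ ‖f y‖ₑ := by
    intro y hy
    refine (hball ?_).le
    rw [dist_eq_norm]
    refine (norm_sub_le_of_mem_cube hκ hy (mem_cube_self k x) (by simp [k])).trans_lt ?_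
    rw [lt_div_iff₀ (by positivity)] at hN
    simpa [k, mul_comm] using hN
  have h2 := lintegral_le_of_notMem_stopCubes hn hκ ht ht' hf hx k
  have h3 : s * volume (cube κ (k, cubeIdx κ k x)) ≤
      ∫⁻ y in cube κ (k, cubeIdx κ k x), ‖f y‖ₑ := by
    rw [← setLIntegral_const]
    exact setLIntegral_mono' (measurableSet_cube _) hsub
  refine absurd (h3.trans h2) (not_le.2 ?_)
  exact ENNReal.mul_lt_mul_left (volume_cube_pos _).ne' (volume_cube_ne_top _) hts

end AnisoMult

end

/-! ### Calderón–Zygmund theory for Schwartz convolution kernels. -/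

noncomputable section

namespace AnisoMult

variable {n : ℕ} {κ : Fin n → ℕ}

/-! ### Convolution with a Schwartz kernel -/

/-- The convolution `K * f`. -/
def cv (K : 𝓢(E n, ℂ)) (f : E n → ℂ) (x : E n) : ℂ := ∫ y, K (x - y) * f y

lemma exists_schwartz_bound (K : 𝓢(E n, ℂ)) : ∃ B : ℝ, 0 ≤ B ∧ ∀ x, ‖K x‖ ≤ B :=
  ⟨_, apply_nonneg _ _, fun x => SchwartzMap.norm_le_seminorm ℝ K x⟩

lemma integrable_cv_integrand (K : 𝓢(E n, ℂ)) {f : E n → ℂ} (hf : Integrable f) (x : E n) :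
    Integrable fun y => K (x - y) * f y := by
  obtain ⟨B, -, hB⟩ := exists_schwartz_bound K
  exact hf.bdd_mul (Continuous.aestronglyMeasurable (by have := K.continuous; fun_prop))
    (Eventually.of_forall fun y => hB (x - y))

lemma continuous_cv (K : 𝓢(E n, ℂ)) {f : E n → ℂ} (hf : Integrable f) : Continuous (cv K f) := by
  obtain ⟨B, -, hB⟩ := exists_schwartz_bound K
  refine continuous_of_dominated (bound := fun y => B * ‖f y‖)
    (fun x => (integrable_cv_integrand K hf x).aestronglyMeasurable)
    (fun x => Eventually.of_forall fun y => ?_) (hf.norm.const_mul B)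
    (Eventually.of_forall fun y => ?_)
  · rw [norm_mul]
    exact mul_le_mul_of_nonneg_right (hB _) (norm_nonneg _)
  · have := K.continuous
    fun_prop

lemma cv_add (K : 𝓢(E n, ℂ)) {f g : E n → ℂ} (hf : Integrable f) (hg : Integrable g) (x : E n) :
    cv K (fun y => f y + g y) x = cv K f x + cv K g x := by
  unfold cv
  rw [← integral_add (integrable_cv_integrand K hf x) (integrable_cv_integrand K hg x)]
  simp only [mul_add]

lemma eLpNorm_two_sq (f : E n → ℂ) : eLpNorm f 2 volume ^ 2 = ∫⁻ x, ‖f x‖ₑ ^ 2 := by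
  have := eLpNorm_nnreal_pow_eq_lintegral (f := f) (μ := volume) (p := 2) (by norm_num)
  simpa using this

/-! ### The Calderón–Zygmund decomposition -/

open Classical in
/-- The good part of the Calderón–Zygmund decomposition of `f` at height `t`. -/
def czGood (κ : Fin n → ℕ) (f : E n → ℂ) (t : ℝ≥0∞) (x : E n) : ℂ :=
  if h : ∃ q : stopCubes κ f t, x ∈ cube κ q.1 then ⨍ y in cube κ h.choose.1, f y else f x

lemma czGood_of_mem {f : E n → ℂ} {t : ℝ≥0∞} (q : stopCubes κ f t) {x : E n} (hx : x ∈ cube κ q.1) :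
    czGood κ f t x = ⨍ y in cube κ q.1, f y := by
  have h : ∃ q : stopCubes κ f t, x ∈ cube κ q.1 := ⟨q, hx⟩
  have h2 : h.choose = q := by
    by_contra hne
    exact Set.disjoint_left.1 (disjoint_stopCubes f t hne) h.choose_spec hx
  rw [czGood, dif_pos h, h2]

lemma czGood_of_notMem {f : E n → ℂ} {t : ℝ≥0∞} {x : E n}
    (hx : x ∉ ⋃ q : stopCubes κ f t, cube κ q.1) : czGood κ f t x = f x := by
  rw [czGood, dif_neg (by simpa using hx)]

lemma measurableSet_iUnion_stopCubes (f : E n → ℂ) (t : ℝ≥0∞) :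
    MeasurableSet (⋃ q : stopCubes κ f t, cube κ q.1) :=
  MeasurableSet.iUnion fun q => measurableSet_cube q.1

lemma lintegral_iUnion_stopCubes (f : E n → ℂ) (t : ℝ≥0∞) (F : E n → ℝ≥0∞) :
    ∫⁻ x in ⋃ q : stopCubes κ f t, cube κ q.1, F x =
      ∑' q : stopCubes κ f t, ∫⁻ x in cube κ q.1, F x :=
  lintegral_iUnion (s := fun q : stopCubes κ f t => cube κ q.1)
    (fun q => measurableSet_cube q.1) (disjoint_stopCubes f t) F

lemma aestronglyMeasurable_czGood {f : E n → ℂ} (hf : AEStronglyMeasurable f volume) (t : ℝ≥0∞) :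
    AEStronglyMeasurable (czGood κ f t) volume := by
  rw [← Measure.restrict_univ (μ := volume),
    ← union_compl_self (⋃ q : stopCubes κ f t, cube κ q.1), aestronglyMeasurable_union_iff,
    aestronglyMeasurable_iUnion_iff]
  refine ⟨fun q => ?_, ?_⟩
  · refine (aestronglyMeasurable_const (b := ⨍ y in cube κ q.1, f y)).congr ?_
    filter_upwards [ae_restrict_mem (measurableSet_cube q.1)] with x hx
    exact (czGood_of_mem q hx).symm
  · refine hf.restrict.congr ?_
    filter_upwards [ae_restrict_mem (measurableSet_iUnion_stopCubes f t).compl] with x hx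
    exact (czGood_of_notMem hx).symm

lemma enorm_average_mul_volume_le (f : E n → ℂ) (q : ℤ × (Fin n → ℤ)) :
    ‖⨍ y in cube κ q, f y‖ₑ * volume (cube κ q) ≤ ∫⁻ y in cube κ q, ‖f y‖ₑ := by
  have hv : volume.real (cube κ q) ≠ 0 :=
    (ENNReal.toReal_pos (volume_cube_pos q).ne' (volume_cube_ne_top q)).ne'
  have h : (volume (cube κ q)) = ‖volume.real (cube κ q)‖ₑ := by
    rw [Real.enorm_of_nonneg measureReal_nonneg, ofReal_measureReal (volume_cube_ne_top q)]
  rw [setAverage_eq, enorm_smul, h, mul_comm, ← mul_assoc, ← enorm_mul, mul_inv_cancel₀ hv]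
  simpa using enorm_integral_le_lintegral_enorm _

lemma enorm_czGood_le (hn : 0 < n) (hκ : ∀ l, 0 < κ l) {f : E n → ℂ} {t : ℝ≥0∞}
    (ht : t ≠ 0) (ht' : t ≠ ⊤) (hc : Continuous f) (hf : ∫⁻ y, ‖f y‖ₑ ≠ ⊤) (x : E n) :
    ‖czGood κ f t x‖ₑ ≤ 2 ^ (∑ l, κ l) * t := by
  by_cases hx : x ∈ ⋃ q : stopCubes κ f t, cube κ q.1
  · obtain ⟨q, hq⟩ := mem_iUnion.1 hx
    rw [czGood_of_mem q hq]
    have h := (enorm_average_mul_volume_le f q.1).trans (lintegral_stopCube_le q.2)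
    exact (ENNReal.mul_le_mul_iff_left (volume_cube_pos q.1).ne' (volume_cube_ne_top q.1)).1 h
  · rw [czGood_of_notMem hx]
    refine (enorm_le_of_notMem_stopCubes hn hκ ht ht' hc hf hx).trans ?_
    exact le_mul_of_one_le_left' (one_le_pow₀ one_le_two)

lemma lintegral_czGood_le (f : E n → ℂ) (t : ℝ≥0∞) :
    ∫⁻ x, ‖czGood κ f t x‖ₑ ≤ ∫⁻ x, ‖f x‖ₑ := by
  have hm := measurableSet_iUnion_stopCubes (κ := κ) f t
  rw [← lintegral_add_compl _ hm, ← lintegral_add_compl (fun x => ‖f x‖ₑ) hm]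
  refine add_le_add ?_ (le_of_eq ?_)
  · rw [lintegral_iUnion_stopCubes,
      lintegral_iUnion_stopCubes]
    refine ENNReal.tsum_le_tsum fun q => ?_
    rw [setLIntegral_congr_fun (g := fun _ => ‖⨍ y in cube κ q.1, f y‖ₑ) (measurableSet_cube q.1)
      (fun x hx => by simp only [czGood_of_mem q hx]), setLIntegral_const]
    exact enorm_average_mul_volume_le f q.1
  · exact setLIntegral_congr_fun hm.compl fun x hx => by simp only [czGood_of_notMem hx]

lemma integrable_czGood {f : E n → ℂ} (hf : Integrable f) (t : ℝ≥0∞) :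
    Integrable (czGood κ f t) :=
  ⟨aestronglyMeasurable_czGood hf.1 t, (lintegral_czGood_le f t).trans_lt hf.2⟩

lemma setIntegral_sub_czGood {f : E n → ℂ} (hf : Integrable f) (t : ℝ≥0∞) (q : stopCubes κ f t) :
    ∫ y in cube κ q.1, (f y - czGood κ f t y) = 0 := by
  rw [integral_sub hf.integrableOn (integrable_czGood hf t).integrableOn,
    setIntegral_congr_fun (g := fun _ => ⨍ y in cube κ q.1, f y) (measurableSet_cube q.1)
    (fun x hx => czGood_of_mem q hx), setIntegral_const, setAverage_eq, smul_smul,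
    mul_inv_cancel₀ (measureReal_ne_zero_iff (volume_cube_ne_top q.1) |>.2 (volume_cube_pos q.1).ne'),
    one_smul, sub_self]

lemma tsum_volume_stopCubes_le (f : E n → ℂ) (t : ℝ≥0∞) :
    t * ∑' q : stopCubes κ f t, volume (cube κ q.1) ≤ ∫⁻ x, ‖f x‖ₑ := by
  rw [← ENNReal.tsum_mul_left]
  refine (ENNReal.tsum_le_tsum fun q => q.2.1.le).trans ?_
  rw [← lintegral_iUnion_stopCubes]
  exact setLIntegral_le_lintegral _ _

/-! ### Weak type (1,1) for compactly supported continuous functions -/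

lemma lintegral_compl_hormander {K : 𝓢(E n, ℂ)} {C : ℝ≥0} (hC : Hormander κ C K) {ρ : ℝ}
    (hρ : 0 < ρ) {y c : E n} (hy : knorm κ (y - c) ≤ ρ) :
    ∫⁻ x in {x : E n | 2 * ρ < knorm κ (x - c)}, ‖K (x - y) - K (x - c)‖ₑ ≤ C := by
  refine le_trans ?_ (hC ρ (y - c) hρ hy)
  have hm : MeasurableSet {x : E n | 2 * ρ < knorm κ (x - c)} :=
    measurableSet_lt measurable_const
      ((continuous_knorm κ).comp (continuous_id.sub continuous_const)).measurable
  rw [← lintegral_indicator hm, ← lintegral_indicator (measurableSet_le_knorm ..),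
    ← lintegral_sub_right_eq_self ({x : E n | 2 * ρ ≤ knorm κ x}.indicator
      fun x => ‖K (x - (y - c)) - K x‖ₑ) c]
  refine lintegral_mono fun x => ?_
  by_cases hx : x ∈ {x : E n | 2 * ρ < knorm κ (x - c)}
  · rw [indicator_of_mem hx, indicator_of_mem (show x - c ∈ {x : E n | 2 * ρ ≤ knorm κ x} from le_of_lt hx.out)]
    simp
  · rw [indicator_of_notMem hx]
    exact zero_le

/-- The bad part has mean zero on each stopping cube, so the constant K(x − c_q) can be subtracted
cube by cube. -/
lemma enorm_cv_bad_le (K : 𝓢(E n, ℂ)) {f : E n → ℂ} (hf : Integrable f) (t : ℝ≥0∞)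
    (c : stopCubes κ f t → E n) (x : E n) :
    ‖cv K (fun y => f y - czGood κ f t y) x‖ₑ ≤ ∑' q : stopCubes κ f t,
      ∫⁻ y in cube κ q.1, ‖K (x - y) - K (x - c q)‖ₑ * ‖f y - czGood κ f t y‖ₑ := by
  have hb : Integrable fun y => f y - czGood κ f t y := hf.sub (integrable_czGood hf t)
  have hi := integrable_cv_integrand K hb x
  unfold cv
  rw [← setIntegral_eq_integral_of_forall_compl_eq_zero
    (s := ⋃ q : stopCubes κ f t, cube κ q.1) (fun y hy => by simp [czGood_of_notMem hy]),
    ← (hasSum_integral_iUnion (s := fun q : stopCubes κ f t => cube κ q.1) (fun q => measurableSet_cube q.1) (disjoint_stopCubes f t)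
    hi.integrableOn).tsum_eq]
  refine enorm_tsum_le_tsum_enorm.trans (ENNReal.tsum_le_tsum fun q => ?_)
  have h1 : ∫ y in cube κ q.1, K (x - y) * (f y - czGood κ f t y) =
      ∫ y in cube κ q.1, (K (x - y) - K (x - c q)) * (f y - czGood κ f t y) := by
    simp only [sub_mul (K _)]
    rw [integral_sub hi.integrableOn (hb.integrableOn.const_mul _), integral_const_mul,
      setIntegral_sub_czGood hf t q, mul_zero, sub_zero]
  rw [h1]
  refine (enorm_integral_le_lintegral_enorm _).trans (le_of_eq ?_)
  simp only [enorm_mul]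

/-- The bound depends on K only through its L² norm A and its Hörmander constant C, so it is uniform
over truncations. The three summands of the constant come from the good part, the exceptional set
and the bad part. -/
theorem weak_type_of_hasCompactSupport (hn : 0 < n) (hκ : ∀ l, 0 < κ l) {K : 𝓢(E n, ℂ)}
    {A C : ℝ≥0} (hA : ∀ g : E n → ℂ, MemLp g 2 volume →
      eLpNorm (cv K g) 2 volume ≤ A * eLpNorm g 2 volume) (hC : Hormander κ C K)
    {f : E n → ℂ} (hc : Continuous f) (hs : HasCompactSupport f) {t : ℝ≥0∞} (ht : t ≠ 0)
    (ht' : t ≠ ⊤) : t * volume {x | 2 * t < ‖cv K f x‖ₑ} ≤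
      (A ^ 2 * 2 ^ (∑ l, κ l) + volume {x : E n | knorm κ x ≤ 2 * n} + 2 * C) *
        ∫⁻ x, ‖f x‖ₑ := by
  have hf : Integrable f := hc.integrable_of_hasCompactSupport hs
  have hfi : ∫⁻ x, ‖f x‖ₑ ≠ ⊤ := hf.2.ne
  set g := czGood κ f t with hg
  have hgi : Integrable g := integrable_czGood hf t
  set b : E n → ℂ := fun y => f y - g y with hb
  have hbi : Integrable b := hf.sub hgi
  have hbn : ∫⁻ y, ‖b y‖ₑ ≤ 2 * ∫⁻ x, ‖f x‖ₑ := by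
    refine (lintegral_mono fun y => enorm_sub_le).trans ?_
    rw [lintegral_add_left' hf.1.enorm, two_mul]
    exact add_le_add_right (lintegral_czGood_le f t) _
  have hne : ∀ q : stopCubes κ f t, (cube κ q.1).Nonempty := fun q =>
    nonempty_of_measure_ne_zero (volume_cube_pos _).ne'
  choose c hcm using hne
  -- A cube of generation k has gauge diameter at most ρ = 2^k n. Balls of radius 2ρ are removed so
  -- that off them Hörmander's condition at radius ρ applies.
  set U : Set (E n) := ⋃ q : stopCubes κ f t, {x | knorm κ (x - c q) ≤ 2 ^ q.1.1 * (2 * n)} with hU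
  have hUm : MeasurableSet U := MeasurableSet.iUnion fun q => measurableSet_le
    ((continuous_knorm κ).comp (continuous_id.sub continuous_const)).measurable measurable_const
  -- the good part
  have hgood : t * volume {x | t ≤ ‖cv K g x‖ₑ} ≤ A ^ 2 * 2 ^ (∑ l, κ l) * ∫⁻ x, ‖f x‖ₑ := by
    have hsq : ∫⁻ x, ‖g x‖ₑ ^ 2 ≤ 2 ^ (∑ l, κ l) * t * ∫⁻ x, ‖f x‖ₑ := by
      calc ∫⁻ x, ‖g x‖ₑ ^ 2 ≤ ∫⁻ x, 2 ^ (∑ l, κ l) * t * ‖g x‖ₑ := by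
            refine lintegral_mono fun x => ?_
            rw [sq]
            exact mul_le_mul_left (enorm_czGood_le hn hκ ht ht' hc hfi x) _
        _ ≤ _ := by
            rw [lintegral_const_mul' _ _ (by finiteness)]
            exact mul_le_mul_right (lintegral_czGood_le f t) _
    have hg2 : MemLp g 2 volume := by
      refine ⟨hgi.1, ?_⟩
      have h : eLpNorm g 2 volume ^ 2 < ⊤ := by
        rw [eLpNorm_two_sq]
        exact hsq.trans_lt (by finiteness)
      exact (ENNReal.pow_lt_top_iff.1 h).resolve_right (by norm_num)
    have h1 : t ^ 2 * volume {x | t ≤ ‖cv K g x‖ₑ} ≤ ∫⁻ x, ‖cv K g x‖ₑ ^ 2 := by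
      refine le_trans (mul_le_mul_right (measure_mono fun x hx => ?_) _) (mul_meas_ge_le_lintegral
        ((continuous_cv K hgi).enorm.measurable.pow_const 2) (t ^ 2))
      exact pow_le_pow_left₀ zero_le hx.out 2
    rw [← eLpNorm_two_sq] at h1
    have h2 : t * (t * volume {x | t ≤ ‖cv K g x‖ₑ}) ≤
        t * (A ^ 2 * 2 ^ (∑ l, κ l) * ∫⁻ x, ‖f x‖ₑ) := by
      calc t * (t * volume {x | t ≤ ‖cv K g x‖ₑ}) = t ^ 2 * volume {x | t ≤ ‖cv K g x‖ₑ} := by ring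
        _ ≤ (A * eLpNorm g 2 volume) ^ 2 := h1.trans (pow_le_pow_left₀ zero_le (hA g hg2) 2)
        _ = A ^ 2 * ∫⁻ x, ‖g x‖ₑ ^ 2 := by rw [mul_pow, eLpNorm_two_sq]
        _ ≤ A ^ 2 * (2 ^ (∑ l, κ l) * t * ∫⁻ x, ‖f x‖ₑ) := mul_le_mul_right hsq _
        _ = _ := by ring
    exact (ENNReal.mul_le_mul_iff_right ht ht').1 h2
  -- the exceptional set
  have hexc : t * volume U ≤ volume {x : E n | knorm κ x ≤ 2 * n} * ∫⁻ x, ‖f x‖ₑ := by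
    calc t * volume U ≤ t * ∑' q : stopCubes κ f t,
          volume {x | knorm κ (x - c q) ≤ 2 ^ q.1.1 * (2 * n)} :=
          mul_le_mul_right (measure_iUnion_le _) _
      _ = volume {x : E n | knorm κ x ≤ 2 * n} *
          (t * ∑' q : stopCubes κ f t, volume (cube κ q.1)) := by
          simp only [volume_knorm_le_dil hκ, ← volume_cube, ENNReal.tsum_mul_right]
          ring
      _ ≤ _ := mul_le_mul_right (tsum_volume_stopCubes_le f t) _
  -- the bad part
  have hbad : t * volume (Uᶜ ∩ {x | t ≤ ‖cv K b x‖ₑ}) ≤ 2 * C * ∫⁻ x, ‖f x‖ₑ := by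
    have hFm : ∀ (q : stopCubes κ f t) (S : Set (E n)), AEMeasurable (fun p : E n × E n =>
        ‖K (p.1 - p.2) - K (p.1 - c q)‖ₑ * ‖b p.2‖ₑ)
        ((volume.restrict S).prod (volume.restrict (cube κ q.1))) := by
      intro q S
      have h1 : Continuous fun p : E n × E n => ‖K (p.1 - p.2) - K (p.1 - c q)‖ₑ := by
        have := K.continuous
        fun_prop
      exact h1.measurable.aemeasurable.mul (hbi.1.restrict.comp_snd.enorm)
    calc t * volume (Uᶜ ∩ {x | t ≤ ‖cv K b x‖ₑ})
        = t * (volume.restrict Uᶜ) {x | t ≤ ‖cv K b x‖ₑ} := by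
          rw [Measure.restrict_apply' hUm.compl, inter_comm]
      _ ≤ ∫⁻ x in Uᶜ, ‖cv K b x‖ₑ :=
          mul_meas_ge_le_lintegral (continuous_cv K hbi).enorm.measurable t
      _ ≤ ∫⁻ x in Uᶜ, ∑' q : stopCubes κ f t,
            ∫⁻ y in cube κ q.1, ‖K (x - y) - K (x - c q)‖ₑ * ‖b y‖ₑ :=
          lintegral_mono fun x => enorm_cv_bad_le K hf t c x
      _ = ∑' q : stopCubes κ f t, ∫⁻ x in Uᶜ,
            ∫⁻ y in cube κ q.1, ‖K (x - y) - K (x - c q)‖ₑ * ‖b y‖ₑ :=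
          lintegral_tsum fun q => (hFm q _).lintegral_prod_right'
      _ ≤ ∑' q : stopCubes κ f t, ∫⁻ y in cube κ q.1, C * ‖b y‖ₑ := by
          refine ENNReal.tsum_le_tsum fun q => ?_
          rw [lintegral_lintegral_swap (hFm q _)]
          refine setLIntegral_mono' (measurableSet_cube _) fun y hy => ?_
          rw [lintegral_mul_const' _ _ enorm_ne_top]
          refine mul_le_mul_left ?_ _
          refine (lintegral_mono_set (t := {x | 2 * (2 ^ q.1.1 * n) < knorm κ (x - c q)})
            fun x hx => ?_).trans (lintegral_compl_hormander hC (by positivity)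
              (knorm_sub_le_of_mem_cube hκ hy (hcm q)))
          have hx2 : x ∉ {x | knorm κ (x - c q) ≤ 2 ^ q.1.1 * (2 * n)} := fun h =>
            hx (mem_iUnion.2 ⟨q, h⟩)
          rw [mem_ofPred_eq, not_le] at hx2
          rw [mem_ofPred_eq]
          linarith
      _ = ∫⁻ y in ⋃ q : stopCubes κ f t, cube κ q.1, C * ‖b y‖ₑ :=
          (lintegral_iUnion_stopCubes f t _).symm
      _ ≤ ∫⁻ y, C * ‖b y‖ₑ := setLIntegral_le_lintegral _ _
      _ ≤ C * (2 * ∫⁻ x, ‖f x‖ₑ) := by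
          rw [lintegral_const_mul' _ _ ENNReal.coe_ne_top]
          exact mul_le_mul_right hbn _
      _ = _ := by ring
  have hsub : {x | 2 * t < ‖cv K f x‖ₑ} ⊆
      {x | t ≤ ‖cv K g x‖ₑ} ∪ U ∪ (Uᶜ ∩ {x | t ≤ ‖cv K b x‖ₑ}) := by
    intro x hx
    by_contra hcon
    simp only [mem_union, mem_inter_iff, mem_compl_iff, mem_ofPred_eq, not_or, not_le, not_and] at hcon
    have h1 := cv_add K hgi hbi x
    simp only [hb, add_sub_cancel] at h1
    have h2 := hx.out
    rw [h1, two_mul] at h2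
    exact absurd (h2.trans_le (enorm_add_le _ _))
      (not_lt.2 (add_le_add hcon.1.1.le (hcon.2 hcon.1.2).le))
  calc t * volume {x | 2 * t < ‖cv K f x‖ₑ}
      ≤ t * (volume {x | t ≤ ‖cv K g x‖ₑ} + volume U + volume (Uᶜ ∩ {x | t ≤ ‖cv K b x‖ₑ})) :=
        mul_le_mul_right ((measure_mono hsub).trans ((measure_union_le _ _).trans
          (add_le_add_left (measure_union_le _ _) _))) _
    _ ≤ _ := by
        rw [mul_add, mul_add, add_mul, add_mul]
        exact add_le_add (add_le_add hgood hexc) hbad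

end AnisoMult

end

/-! ### Convolution operators as Fourier multipliers, and density arguments. -/

noncomputable section

namespace AnisoMult

variable {n : ℕ} {κ : Fin n → ℕ}

/-! ### The operator on `L²` -/

/-- Essentially bounded multipliers. -/
structure BddMult (m : E n → ℂ) (M : ℝ) : Prop where
  meas : AEStronglyMeasurable m volume
  bound : ∀ᵐ ξ ∂(volume : Measure (E n)), ‖m ξ‖ ≤ M

lemma BddMult.memLp_mul {m : E n → ℂ} {M : ℝ} (hm : BddMult m M) {f : E n → ℂ}
    (hf : MemLp f 2 volume) : MemLp (fun ξ => m ξ * f ξ) 2 volume :=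
  hf.of_le_mul (hm.meas.mul hf.1) (c := M) <| by
    filter_upwards [hm.bound] with ξ hξ
    rw [norm_mul]
    exact mul_le_mul_of_nonneg_right hξ (norm_nonneg _)

lemma BddMult.l2Op_eq {m : E n → ℂ} {M : ℝ} (hm : BddMult m M)
    (f : Lp ℂ 2 (volume : Measure (E n))) :
    l2Op m f = 𝓕⁻ (hm.memLp_mul (Lp.memLp (𝓕 f))).toLp := by
  rw [l2Op, dif_pos (hm.memLp_mul (Lp.memLp (𝓕 f)))]

lemma BddMult.l2Op_add {m : E n → ℂ} {M : ℝ} (hm : BddMult m M)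
    (f g : Lp ℂ 2 (volume : Measure (E n))) : l2Op m (f + g) = l2Op m f + l2Op m g := by
  rw [hm.l2Op_eq, hm.l2Op_eq, hm.l2Op_eq, ← FourierTransform.fourierInv_add, ← MemLp.toLp_add]
  congr 1
  rw [MemLp.toLp_eq_toLp_iff, FourierTransform.fourier_add]
  filter_upwards [Lp.coeFn_add (𝓕 f) (𝓕 g)] with ξ hξ
  rw [hξ, Pi.add_apply, mul_add]
  rfl

lemma BddMult.l2Op_smul {m : E n → ℂ} {M : ℝ} (hm : BddMult m M) (c : ℂ)
    (f : Lp ℂ 2 (volume : Measure (E n))) : l2Op m (c • f) = c • l2Op m f := by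
  rw [hm.l2Op_eq, hm.l2Op_eq, ← FourierTransform.fourierInv_smul, ← MemLp.toLp_const_smul]
  congr 1
  rw [MemLp.toLp_eq_toLp_iff, FourierTransform.fourier_smul]
  filter_upwards [Lp.coeFn_smul c (𝓕 f)] with ξ hξ
  rw [hξ, Pi.smul_apply, Pi.smul_apply, smul_eq_mul, smul_eq_mul, mul_left_comm]

lemma norm_fourierInv_L2 (f : Lp ℂ 2 (volume : Measure (E n))) : ‖𝓕⁻ f‖ = ‖f‖ := by
  rw [← Lp.norm_fourier_eq (𝓕⁻ f), FourierTransform.fourier_fourierInv_eq]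

lemma BddMult.norm_l2Op_le {m : E n → ℂ} {M : ℝ} (hm : BddMult m M)
    (f : Lp ℂ 2 (volume : Measure (E n))) : ‖l2Op m f‖ ≤ M * ‖f‖ := by
  rw [hm.l2Op_eq, norm_fourierInv_L2, ← Lp.norm_fourier_eq f]
  refine Lp.norm_le_mul_norm_of_ae_le_mul ?_
  filter_upwards [(hm.memLp_mul (Lp.memLp (𝓕 f))).coeFn_toLp, hm.bound] with ξ h1 h2
  rw [h1, norm_mul]
  exact mul_le_mul_of_nonneg_right h2 (norm_nonneg _)

lemma BddMult.continuous_l2Op {m : E n → ℂ} {M : ℝ} (hm : BddMult m M) : Continuous (l2Op m) := by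
  refine (LinearMap.mkContinuous (σ := RingHom.id ℂ) ⟨⟨l2Op m, hm.l2Op_add⟩, hm.l2Op_smul⟩ M
    hm.norm_l2Op_le).continuous

lemma BddMult.of_schwartz (ψ : 𝓢(E n, ℂ)) {M : ℝ} (h : ∀ ξ, ‖ψ ξ‖ ≤ M) : BddMult ψ M :=
  ⟨ψ.continuous.aestronglyMeasurable, Eventually.of_forall h⟩

lemma ae_ne_zero (hn : 0 < n) : ∀ᵐ ξ ∂(volume : Measure (E n)), ξ ≠ 0 := by
  have : Nonempty (Fin n) := ⟨⟨0, hn⟩⟩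
  exact Measure.ae_ne volume 0

lemma exists_bddMult (hn : 0 < n) {m : E n → ℂ} (hm : IsMultiplier κ m) :
    ∃ M : ℝ, 0 ≤ M ∧ BddMult m M ∧ ∀ ξ, ξ ≠ 0 → ‖m ξ‖ ≤ M := by
  obtain ⟨M, hM⟩ := hm.bounded
  have hM' : ∀ ξ, ξ ≠ 0 → ‖m ξ‖ ≤ |M| := fun ξ hξ => (hM ξ hξ).trans (le_abs_self M)
  refine ⟨|M|, abs_nonneg M, ⟨?_, ?_⟩, hM'⟩
  · have h1 : AEStronglyMeasurable m (volume.restrict {0}ᶜ) :=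
      hm.smooth.continuousOn.aestronglyMeasurable (measurableSet_singleton 0).compl
    have h2 : ∀ᵐ ξ ∂(volume : Measure (E n)), ξ ∈ ({0}ᶜ : Set (E n)) := ae_ne_zero hn
    rwa [Measure.restrict_eq_self_of_ae_mem h2] at h1
  · filter_upwards [ae_ne_zero hn] with ξ hξ using hM' ξ hξ

/-! ### Convolutions on `Lᵖ` -/

lemma integrable_cv_of_memLp (K : 𝓢(E n, ℂ)) {p : ℝ≥0∞} (hp : 1 ≤ p) {f : E n → ℂ}
    (hf : MemLp f p volume) (x : E n) : Integrable fun y => K (x - y) * f y := by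
  have := ENNReal.HolderConjugate.inv_one_sub_inv' hp
  have hK : MemLp (fun y => K (x - y)) (1 - p⁻¹)⁻¹ volume :=
    (K.memLp _ volume).comp_measurePreserving (Measure.measurePreserving_sub_left volume x)
  have : ENNReal.HolderTriple (1 - p⁻¹)⁻¹ p 1 := ENNReal.HolderTriple.symm
  exact memLp_one_iff_integrable.1 (hf.mul hK)

/-- Hölder with the conjugate exponent (1 − 1/p)⁻¹, which is ∞ when p = 1. Convergence in Lᵖ thus
becomes uniform convergence of the convolutions. -/
lemma exists_enorm_cv_le (K : 𝓢(E n, ℂ)) {p : ℝ≥0∞} (hp : 1 ≤ p) : ∃ D : ℝ≥0,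
    ∀ f : E n → ℂ, AEStronglyMeasurable f volume → ∀ x, ‖cv K f x‖ₑ ≤ D * eLpNorm f p volume := by
  have := ENNReal.HolderConjugate.inv_one_sub_inv' hp
  have : ENNReal.HolderTriple (1 - p⁻¹)⁻¹ p 1 := ENNReal.HolderTriple.symm
  refine ⟨(eLpNorm K (1 - p⁻¹)⁻¹ volume).toNNReal, fun f hf x => ?_⟩
  rw [ENNReal.coe_toNNReal (K.memLp _ volume).2.ne]
  have hmp := Measure.measurePreserving_sub_left (volume : Measure (E n)) x
  calc ‖cv K f x‖ₑ ≤ ∫⁻ y, ‖K (x - y) * f y‖ₑ := enorm_integral_le_lintegral_enorm _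
    _ = eLpNorm ((fun y => K (x - y)) • f) 1 volume := by
        rw [eLpNorm_one_eq_lintegral_enorm]; rfl
    _ ≤ eLpNorm (fun y => K (x - y)) (1 - p⁻¹)⁻¹ volume * eLpNorm f p volume :=
        eLpNorm_smul_le_mul_eLpNorm hf
          (Continuous.aestronglyMeasurable (by have := K.continuous; fun_prop))
    _ = _ := by
        congr 1
        exact eLpNorm_comp_measurePreserving (g := K) K.continuous.aestronglyMeasurable hmp

lemma cv_sub_of_memLp (K : 𝓢(E n, ℂ)) {p q : ℝ≥0∞} (hp : 1 ≤ p) (hq : 1 ≤ q) {f g : E n → ℂ}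
    (hf : MemLp f p volume) (hg : MemLp g q volume) (x : E n) :
    cv K (f - g) x = cv K f x - cv K g x := by
  unfold cv
  rw [← integral_sub (integrable_cv_of_memLp K hp hf x) (integrable_cv_of_memLp K hq hg x)]
  simp only [Pi.sub_apply, mul_sub]

lemma cv_congr_ae (K : 𝓢(E n, ℂ)) {f g : E n → ℂ} (h : f =ᵐ[volume] g) : cv K f = cv K g := by
  funext x
  refine integral_congr_ae ?_
  filter_upwards [h] with y hy
  rw [hy]

lemma tendsto_cv (K : 𝓢(E n, ℂ)) {p : ℝ≥0∞} (hp : 1 ≤ p) {f : E n → ℂ} (hf : MemLp f p volume)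
    {g : ℕ → E n → ℂ} (hg : ∀ k, MemLp (g k) p volume)
    (h : Tendsto (fun k => eLpNorm (g k - f) p volume) atTop (𝓝 0)) (x : E n) :
    Tendsto (fun k => cv K (g k) x) atTop (𝓝 (cv K f x)) := by
  obtain ⟨D, hD⟩ := exists_enorm_cv_le K hp
  rw [tendsto_iff_edist_tendsto_0]
  have h2 : Tendsto (fun k => D * eLpNorm (g k - f) p volume) atTop (𝓝 0) := by
    simpa using ENNReal.Tendsto.const_mul h (Or.inr ENNReal.coe_ne_top)
  refine tendsto_of_tendsto_of_tendsto_of_le_of_le tendsto_const_nhds h2 (fun _ => zero_le)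
    fun k => ?_
  rw [edist_eq_enorm_sub, ← cv_sub_of_memLp K hp hp (hg k) hf]
  exact hD _ ((hg k).1.sub hf.1) x

lemma exists_seq_hasCompactSupport {p : ℝ≥0∞} (hp : p ≠ ⊤) {f : E n → ℂ} (hf : MemLp f p volume) :
    ∃ g : ℕ → E n → ℂ, (∀ k, Continuous (g k) ∧ HasCompactSupport (g k) ∧ MemLp (g k) p volume) ∧
      Tendsto (fun k => eLpNorm (g k - f) p volume) atTop (𝓝 0) := by
  have h : ∀ k : ℕ, ∃ g : E n → ℂ, HasCompactSupport g ∧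
      eLpNorm (f - g) p volume ≤ ((k : ℝ≥0∞) + 1)⁻¹ ∧ Continuous g ∧ MemLp g p volume :=
    fun k => hf.exists_hasCompactSupport_eLpNorm_sub_le hp (ENNReal.inv_ne_zero.2 (by finiteness))
  choose g h1 h2 h3 h4 using h
  refine ⟨g, fun k => ⟨h3 k, h1 k, h4 k⟩, ?_⟩
  have h5 : Tendsto (fun k : ℕ => ((k : ℝ≥0∞) + 1)⁻¹) atTop (𝓝 0) := by
    have := (tendsto_add_atTop_iff_nat (f := fun k : ℕ => ((k : ℝ≥0∞))⁻¹) 1).2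
      ENNReal.tendsto_inv_nat_nhds_zero
    simpa using this
  refine tendsto_of_tendsto_of_tendsto_of_le_of_le tendsto_const_nhds h5 (fun _ => zero_le)
    fun k => ?_
  rw [eLpNorm_sub_comm]
  exact h2 k

lemma tendsto_eLpNorm_of_sub {p : ℝ≥0∞} (hp : 1 ≤ p) {f : E n → ℂ} (hf : MemLp f p volume)
    {g : ℕ → E n → ℂ} (hg : ∀ k, MemLp (g k) p volume)
    (h : Tendsto (fun k => eLpNorm (g k - f) p volume) atTop (𝓝 0)) :
    Tendsto (fun k => eLpNorm (g k) p volume) atTop (𝓝 (eLpNorm f p volume)) := by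
  have h1 : Tendsto (fun k => eLpNorm (g k - f) p volume + eLpNorm f p volume) atTop
      (𝓝 (eLpNorm f p volume)) := by
    simpa using h.add_const (eLpNorm f p volume)
  have h2 : Tendsto (fun k => eLpNorm f p volume - eLpNorm (g k - f) p volume) atTop
      (𝓝 (eLpNorm f p volume)) := by
    simpa using ENNReal.Tendsto.sub (tendsto_const_nhds (x := eLpNorm f p volume)) h
      (Or.inl hf.2.ne)
  refine tendsto_of_tendsto_of_tendsto_of_le_of_le h2 h1 (fun k => ?_) fun k => ?_
  · rw [tsub_le_iff_right, add_comm, eLpNorm_sub_comm]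
    have := eLpNorm_add_le (hf.1.sub (hg k).1) (hg k).1 hp
    simpa using this
  · have := eLpNorm_add_le ((hg k).1.sub hf.1) hf.1 hp
    simpa using this

theorem eLpNorm_cv_le_of_dense (K : 𝓢(E n, ℂ)) {p : ℝ≥0∞} (hp : 1 ≤ p) (hp' : p ≠ ⊤) {A : ℝ≥0}
    (hA : ∀ f : E n → ℂ, Continuous f → HasCompactSupport f →
      eLpNorm (cv K f) p volume ≤ A * eLpNorm f p volume) {f : E n → ℂ} (hf : MemLp f p volume) :
    eLpNorm (cv K f) p volume ≤ A * eLpNorm f p volume := by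
  obtain ⟨g, hg, hgf⟩ := exists_seq_hasCompactSupport hp' hf
  refine (Lp.eLpNorm_lim_le_liminf_eLpNorm (f := fun k => cv K (g k)) (fun k => ?_) _
    (Eventually.of_forall (tendsto_cv K hp hf (fun k => (hg k).2.2) hgf))).trans ?_
  · exact (continuous_cv K ((hg k).1.integrable_of_hasCompactSupport
      (hg k).2.1)).aestronglyMeasurable
  · refine (liminf_le_liminf (Eventually.of_forall fun k => hA (g k) (hg k).1 (hg k).2.1)).trans ?_
    refine le_of_eq (Tendsto.liminf_eq ?_)
    exact ENNReal.Tendsto.const_mul (tendsto_eLpNorm_of_sub hp hf (fun k => (hg k).2.2) hgf)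
      (Or.inr ENNReal.coe_ne_top)

/-! ### Convolution operators as multipliers -/

lemma cv_fourierInv_schwartz (ψ g : 𝓢(E n, ℂ)) (x : E n) :
    cv (𝓕⁻ ψ : 𝓢(E n, ℂ)) g x =
      (𝓕⁻ (SchwartzMap.pairing (ContinuousLinearMap.mul ℂ ℂ) ψ (𝓕 g)) : 𝓢(E n, ℂ)) x := by
  have h1 := SchwartzMap.convolution_apply (ContinuousLinearMap.mul ℂ ℂ) (𝓕⁻ ψ : 𝓢(E n, ℂ)) g x
  have h0 : 𝓕 (𝓕⁻ ψ : 𝓢(E n, ℂ)) = ψ := FourierTransform.fourier_fourierInv_eq ψ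
  have h2 : SchwartzMap.convolution (ContinuousLinearMap.mul ℂ ℂ) (𝓕⁻ ψ : 𝓢(E n, ℂ)) g =
      (𝓕⁻ (SchwartzMap.pairing (ContinuousLinearMap.mul ℂ ℂ) ψ (𝓕 g)) : 𝓢(E n, ℂ)) := by
    conv_rhs => rw [← h0]
    rfl
  rw [h2] at h1
  rw [h1, convolution_mul_swap]
  rfl

lemma l2Op_schwartz (ψ g : 𝓢(E n, ℂ)) : l2Op ψ (g.toLp 2) =
    (𝓕⁻ (SchwartzMap.pairing (ContinuousLinearMap.mul ℂ ℂ) ψ (𝓕 g)) : 𝓢(E n, ℂ)).toLp 2 := by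
  obtain ⟨B, -, hB⟩ := exists_schwartz_bound ψ
  rw [(BddMult.of_schwartz ψ hB).l2Op_eq, ← SchwartzMap.toLp_fourierInv_eq]
  congr 1
  apply Lp.ext
  refine (MemLp.coeFn_toLp _).trans ?_
  rw [SchwartzMap.toLp_fourier_eq]
  filter_upwards [(𝓕 g).coeFn_toLp 2 volume, (SchwartzMap.pairing (ContinuousLinearMap.mul ℂ ℂ) ψ
    (𝓕 g)).coeFn_toLp 2 volume] with ξ h1 h2
  rw [h1, h2]
  rfl

/-- The convolution theorem settles Schwartz functions. For general f, along an approximating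
sequence the left side converges at every point and the right side in L², hence almost everywhere
along a subsequence. -/
theorem cv_ae_eq_l2Op (ψ : 𝓢(E n, ℂ)) (f : Lp ℂ 2 (volume : Measure (E n))) :
    cv (𝓕⁻ ψ : 𝓢(E n, ℂ)) f =ᵐ[volume] l2Op ψ f := by
  obtain ⟨B, -, hB⟩ := exists_schwartz_bound ψ
  have hb := BddMult.of_schwartz ψ hB
  have hd := SchwartzMap.denseRange_toLpCLM (E := E n) (F := ℂ) (p := 2) (μ := volume)
    (by norm_num) f
  obtain ⟨u, hu, hlim⟩ := mem_closure_iff_seq_limit.1 hd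
  choose g hg using hu
  have hgu : ∀ k, u k = (g k).toLp 2 := fun k => (hg k).symm
  have h1 : Tendsto (fun k => l2Op ψ (u k)) atTop (𝓝 (l2Op ψ f)) :=
    (hb.continuous_l2Op.tendsto f).comp hlim
  obtain ⟨ns, hns, hae⟩ := (tendstoInMeasure_of_tendsto_Lp h1).exists_seq_tendsto_ae
  have h2 : Tendsto (fun k => eLpNorm ((u k : E n → ℂ) - (f : E n → ℂ)) 2 volume) atTop (𝓝 0) :=
    (Lp.tendsto_Lp_iff_tendsto_eLpNorm' _ _).1 hlim
  have h3 := tendsto_cv (𝓕⁻ ψ : 𝓢(E n, ℂ)) (p := 2) one_le_two (Lp.memLp f) (fun k => Lp.memLp (u k)) h2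
  have h4 : ∀ k, cv (𝓕⁻ ψ : 𝓢(E n, ℂ)) (u k) =ᵐ[volume] l2Op ψ (u k) := by
    intro k
    rw [hgu, l2Op_schwartz]
    have e1 : cv (𝓕⁻ ψ : 𝓢(E n, ℂ)) ((g k).toLp 2) = cv (𝓕⁻ ψ : 𝓢(E n, ℂ)) (g k) :=
      cv_congr_ae _ ((g k).coeFn_toLp 2 volume)
    rw [e1]
    filter_upwards [(𝓕⁻ (SchwartzMap.pairing (ContinuousLinearMap.mul ℂ ℂ) ψ
      (𝓕 (g k))) : 𝓢(E n, ℂ)).coeFn_toLp 2 volume] with x hx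
    rw [hx, cv_fourierInv_schwartz]
  filter_upwards [hae, ae_all_iff.2 h4] with x hx1 hx2
  refine tendsto_nhds_unique ((h3 x).comp hns.tendsto_atTop) ?_
  refine hx1.congr fun k => ?_
  exact (hx2 (ns k)).symm

theorem eLpNorm_cv_two_le (ψ : 𝓢(E n, ℂ)) {M : ℝ≥0} (hM : ∀ ξ, ‖ψ ξ‖ ≤ M) {f : E n → ℂ}
    (hf : MemLp f 2 volume) : eLpNorm (cv (𝓕⁻ ψ : 𝓢(E n, ℂ)) f) 2 volume ≤ M * eLpNorm f 2 volume := by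
  have h1 : cv (𝓕⁻ ψ : 𝓢(E n, ℂ)) f = cv (𝓕⁻ ψ : 𝓢(E n, ℂ)) hf.toLp := cv_congr_ae _ hf.coeFn_toLp.symm
  rw [h1, eLpNorm_congr_ae (cv_ae_eq_l2Op ψ hf.toLp)]
  have h2 := (BddMult.of_schwartz ψ hM).norm_l2Op_le hf.toLp
  rw [← eLpNorm_congr_ae hf.coeFn_toLp, ← Lp.enorm_def, ← Lp.enorm_def, ← ofReal_norm, ← ofReal_norm,
    ← ENNReal.ofReal_coe_nnreal, ← ENNReal.ofReal_mul M.coe_nonneg]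
  exact ENNReal.ofReal_le_ofReal h2

/-! ### Weak type (1,1) on `L¹` -/

/-- Approximants in L¹ have convolutions uniformly close to that of f, at the cost of one extra t in
the level. -/
theorem weak_type_cv (hn : 0 < n) (hκ : ∀ l, 0 < κ l) {K : 𝓢(E n, ℂ)}
    {A C : ℝ≥0} (hA : ∀ g : E n → ℂ, MemLp g 2 volume →
      eLpNorm (cv K g) 2 volume ≤ A * eLpNorm g 2 volume) (hC : Hormander κ C K)
    {f : E n → ℂ} (hf : MemLp f 1 volume) {t : ℝ≥0∞} (ht : t ≠ 0)
    (ht' : t ≠ ⊤) : t * volume {x | 3 * t < ‖cv K f x‖ₑ} ≤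
      (A ^ 2 * 2 ^ (∑ l, κ l) + volume {x : E n | knorm κ x ≤ 2 * n} + 2 * C) *
        eLpNorm f 1 volume := by
  obtain ⟨g, hg, hgf⟩ := exists_seq_hasCompactSupport ENNReal.one_ne_top hf
  obtain ⟨D, hD⟩ := exists_enorm_cv_le K le_rfl
  have hlim := ENNReal.Tendsto.const_mul (a := A ^ 2 * 2 ^ (∑ l, κ l) +
    volume {x : E n | knorm κ x ≤ 2 * n} + 2 * C)
    (tendsto_eLpNorm_of_sub le_rfl hf (fun k => (hg k).2.2) hgf) (Or.inr (by
      have := volume_knorm_le_lt_top (n := n) hκ (2 * n)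
      finiteness))
  have hsmall : ∀ᶠ k in atTop, D * eLpNorm (g k - f) 1 volume ≤ t := by
    have h2 : Tendsto (fun k => D * eLpNorm (g k - f) 1 volume) atTop (𝓝 0) := by
      simpa using ENNReal.Tendsto.const_mul hgf (Or.inr ENNReal.coe_ne_top)
    exact h2.eventually (Iic_mem_nhds (pos_iff_ne_zero.2 ht))
  refine ge_of_tendsto hlim ?_
  filter_upwards [hsmall] with k hk
  refine le_trans (mul_le_mul_right (measure_mono fun x hx => ?_) _)
    ((weak_type_of_hasCompactSupport hn hκ hA hC (hg k).1 (hg k).2.1 ht ht').trans_eq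
      (by rw [eLpNorm_one_eq_lintegral_enorm]))
  rw [mem_ofPred_eq] at hx ⊢
  by_contra! hcon
  have h1 := (hD _ (((hg k).2.2).1.sub hf.1) x).trans hk
  rw [cv_sub_of_memLp K le_rfl le_rfl (hg k).2.2 hf] at h1
  have h2 : ‖cv K f x‖ₑ ≤ ‖cv K (g k) x‖ₑ + ‖cv K (g k) x - cv K f x‖ₑ := by
    have := enorm_sub_le (E := ℂ) (a := cv K (g k) x) (b := cv K (g k) x - cv K f x)
    simpa using this
  have h3 := h2.trans (add_le_add hcon h1)
  refine absurd (hx.trans_le h3) (not_lt.2 (le_of_eq ?_))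
  ring

end AnisoMult

end

/-! ### Lᵖ bounds for 1 < p < ∞, uniform in the truncation. -/

noncomputable section

namespace AnisoMult

variable {n : ℕ} {κ : Fin n → ℕ}

/-! ### Real interpolation -/

lemma lintegral_Ioi_ite_lt {a s : ℝ} (ha : 0 ≤ a) (hs : 0 < s) :
    ∫⁻ t in Ioi (0 : ℝ), (if t < a then ENNReal.ofReal (t ^ (s - 1)) else 0) =
      ENNReal.ofReal (a ^ s / s) := by
  have h1 : (fun t : ℝ => if t < a then ENNReal.ofReal (t ^ (s - 1)) else 0) =
      (Iio a).indicator fun t => ENNReal.ofReal (t ^ (s - 1)) := by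
    funext t; simp [indicator]
  have hint : IntervalIntegrable (fun t : ℝ => t ^ (s - 1)) volume 0 a :=
    intervalIntegral.intervalIntegrable_rpow' (by linarith)
  have h2 := integral_rpow (a := 0) (b := a) (r := s - 1) (Or.inl (by linarith))
  rw [sub_add_cancel, Real.zero_rpow hs.ne', sub_zero, intervalIntegral.integral_of_le ha,
    integral_Ioc_eq_integral_Ioo] at h2
  rw [h1, setLIntegral_indicator measurableSet_Iio, ← h2, ofReal_integral_eq_lintegral_ofReal,
    inter_comm, Ioi_inter_Iio]
  · exact ((intervalIntegrable_iff_integrableOn_Ioo_of_le ha).1 hint)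
  · filter_upwards [ae_restrict_mem measurableSet_Ioo] with t ht
    exact Real.rpow_nonneg ht.1.le _

lemma lintegral_Ioi_ite_le {a s : ℝ} (ha : 0 < a) (hs : 0 < s) :
    ∫⁻ t in Ioi (0 : ℝ), (if a ≤ t then ENNReal.ofReal (t ^ (-s - 1)) else 0) =
      ENNReal.ofReal (a ^ (-s) / s) := by
  have h1 : (fun t : ℝ => if a ≤ t then ENNReal.ofReal (t ^ (-s - 1)) else 0) =
      (Ici a).indicator fun t => ENNReal.ofReal (t ^ (-s - 1)) := by
    funext t; simp [indicator]
  have h2 := integral_Ioi_rpow_of_lt (a := -s - 1) (by linarith) ha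
  rw [sub_add_cancel, neg_div_neg_eq] at h2
  rw [h1, setLIntegral_indicator measurableSet_Ici, ← h2, ofReal_integral_eq_lintegral_ofReal,
    inter_eq_left.2 (Ici_subset_Ioi.2 ha), setLIntegral_congr Ioi_ae_eq_Ici]
  · exact integrableOn_Ioi_rpow_of_lt (by linarith) ha
  · filter_upwards [ae_restrict_mem measurableSet_Ioi] with t ht
    exact Real.rpow_nonneg (ha.trans ht).le _

/-- The function is cut at height t: the weak type estimate handles the part above, Chebyshev in L²
the part below. The thresholds 3t and t add up to 4t, so the level 6t leaves room. -/
lemma meas_cv_le {K : 𝓢(E n, ℂ)} {A : ℝ≥0} {W : ℝ≥0∞}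
    (hA : ∀ g : E n → ℂ, MemLp g 2 volume → eLpNorm (cv K g) 2 volume ≤ A * eLpNorm g 2 volume)
    (hW : ∀ g : E n → ℂ, MemLp g 1 volume → ∀ t : ℝ≥0∞, t ≠ 0 → t ≠ ⊤ →
      t * volume {x | 3 * t < ‖cv K g x‖ₑ} ≤ W * eLpNorm g 1 volume)
    {f : E n → ℂ} (hc : Continuous f) (hs : HasCompactSupport f) {t : ℝ} (ht : 0 < t) :
    volume {x | t < ‖cv K f x‖ / 6} ≤
      W * ((∫⁻ x, if t < ‖f x‖ then ‖f x‖ₑ else 0) / ENNReal.ofReal t) +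
      A ^ 2 * ((∫⁻ x, if ‖f x‖ ≤ t then ‖f x‖ₑ ^ 2 else 0) / ENNReal.ofReal (t ^ 2)) := by
  classical
  have hS : MeasurableSet {x | t < ‖f x‖} := measurableSet_lt measurable_const hc.norm.measurable
  set g : E n → ℂ := {x | t < ‖f x‖}.indicator f with hg
  set b : E n → ℂ := {x | t < ‖f x‖}ᶜ.indicator f with hb
  have hf1 : MemLp f 1 volume := memLp_one_iff_integrable.2 (hc.integrable_of_hasCompactSupport hs)
  have hf2 : MemLp f 2 volume := hc.memLp_of_hasCompactSupport hs
  have hg1 : MemLp g 1 volume := hf1.indicator hS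
  have hb1 : MemLp b 1 volume := hf1.indicator hS.compl
  have hb2 : MemLp b 2 volume := hf2.indicator hS.compl
  have hfg : f = fun x => g x + b x := by
    have := indicator_self_add_compl {x | t < ‖f x‖} f
    exact this.symm
  have hT0 : ENNReal.ofReal t ≠ 0 := (ENNReal.ofReal_pos.2 ht).ne'
  have hTt : ENNReal.ofReal t ≠ ⊤ := ENNReal.ofReal_ne_top
  have hsub : {x | t < ‖cv K f x‖ / 6} ⊆ {x | 3 * ENNReal.ofReal t < ‖cv K g x‖ₑ} ∪
      {x | ENNReal.ofReal t ≤ ‖cv K b x‖ₑ} := by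
    intro x hx
    by_contra! hcon
    simp only [mem_union, mem_ofPred_eq, not_or, not_lt, not_le] at hcon hx
    have h3 : ‖cv K g x‖ ≤ 3 * t := by
      have := hcon.1
      rw [← ofReal_norm, show (3 : ℝ≥0∞) = ENNReal.ofReal 3 by simp,
        ← ENNReal.ofReal_mul (by norm_num)] at this
      exact (ENNReal.ofReal_le_ofReal_iff (by positivity)).1 this
    have h4 : ‖cv K b x‖ < t := by
      have := hcon.2
      rw [← ofReal_norm] at this
      exact (ENNReal.ofReal_lt_ofReal_iff ht).1 this
    have h5 : cv K f x = cv K g x + cv K b x := by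
      conv_lhs => rw [hfg]
      exact cv_add K (memLp_one_iff_integrable.1 hg1) (memLp_one_iff_integrable.1 hb1) x
    have h6 := norm_add_le (cv K g x) (cv K b x)
    rw [← h5] at h6
    linarith
  refine (measure_mono hsub).trans ((measure_union_le _ _).trans (add_le_add ?_ ?_))
  · have h7 := hW g hg1 _ hT0 hTt
    rw [← mul_div_assoc, ENNReal.le_div_iff_mul_le (Or.inl hT0) (Or.inl hTt), mul_comm]
    refine h7.trans_eq ?_
    rw [eLpNorm_one_eq_lintegral_enorm]
    congr 1
    refine lintegral_congr fun x => ?_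
    by_cases hx : t < ‖f x‖ <;> simp [hg, hx]
  · have hcb : AEStronglyMeasurable (cv K b) volume :=
      (continuous_cv K (memLp_one_iff_integrable.1 hb1)).aestronglyMeasurable
    have h8 := mul_meas_ge_le_pow_eLpNorm' volume (p := 2) (by norm_num) (by norm_num) hcb
      (ENNReal.ofReal t)
    simp only [ENNReal.toReal_ofNat, ENNReal.rpow_ofNat] at h8
    have h9 : eLpNorm (cv K b) 2 volume ^ 2 ≤ A ^ 2 * ∫⁻ x, if ‖f x‖ ≤ t then ‖f x‖ₑ ^ 2 else 0 := by
      refine (pow_le_pow_left₀ zero_le (hA b hb2) 2).trans_eq ?_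
      rw [mul_pow, eLpNorm_two_sq]
      congr 1
      refine lintegral_congr fun x => ?_
      by_cases hx : ‖f x‖ ≤ t
      · simp [hb, hx, not_lt.2 hx]
      · simp [hb, hx, not_le.1 hx]
    rw [← mul_div_assoc, ENNReal.ofReal_pow ht.le,
      ENNReal.le_div_iff_mul_le (Or.inl (by simpa using ht)) (Or.inl (by finiteness)), mul_comm]
    exact h8.trans h9

/-- Marcinkiewicz interpolation: after the layer cake formula and Tonelli, the inner integrals are
∫₀^|f| t^(p−2) dt and ∫_|f|^∞ t^(p−3) dt, which converge because 1 < p < 2. -/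
theorem strong_type_lt_two {K : 𝓢(E n, ℂ)} {A : ℝ≥0} {W : ℝ≥0∞}
    (hA : ∀ g : E n → ℂ, MemLp g 2 volume → eLpNorm (cv K g) 2 volume ≤ A * eLpNorm g 2 volume)
    (hW : ∀ g : E n → ℂ, MemLp g 1 volume → ∀ t : ℝ≥0∞, t ≠ 0 → t ≠ ⊤ →
      t * volume {x | 3 * t < ‖cv K g x‖ₑ} ≤ W * eLpNorm g 1 volume)
    {f : E n → ℂ} (hc : Continuous f) (hs : HasCompactSupport f) {p : ℝ} (hp1 : 1 < p)
    (hp2 : p < 2) :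
    ∫⁻ x, ENNReal.ofReal ((‖cv K f x‖ / 6) ^ p) ≤ ENNReal.ofReal p *
      (W * ENNReal.ofReal (p - 1)⁻¹ + A ^ 2 * ENNReal.ofReal (2 - p)⁻¹) *
        ∫⁻ x, ENNReal.ofReal (‖f x‖ ^ p) := by
  have hcf : Continuous (cv K f) := continuous_cv K (hc.integrable_of_hasCompactSupport hs)
  have hfm : Measurable fun x => ‖f x‖ := hc.norm.measurable
  have hem : Measurable fun x => ‖f x‖ₑ := hc.measurable.enorm
  rw [lintegral_rpow_eq_lintegral_meas_lt_mul volume (Eventually.of_forall fun x => by positivity)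
    (hcf.norm.div_const 6).measurable.aemeasurable (by linarith), mul_assoc]
  refine mul_le_mul_right ?_ _
  have hG1 : Measurable (Function.uncurry fun (t : ℝ) (x : E n) =>
      ‖f x‖ₑ * (if t < ‖f x‖ then ENNReal.ofReal (t ^ (p - 1 - 1)) else 0)) := by
    refine (hem.comp measurable_snd).mul (Measurable.ite ?_ ?_ measurable_const)
    · exact measurableSet_lt measurable_fst (hfm.comp measurable_snd)
    · exact ((measurable_fst.pow_const _)).ennreal_ofReal
  have hG2 : Measurable (Function.uncurry fun (t : ℝ) (x : E n) =>
      ‖f x‖ₑ ^ 2 * (if ‖f x‖ ≤ t then ENNReal.ofReal (t ^ (-(2 - p) - 1)) else 0)) := by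
    refine ((hem.comp measurable_snd).pow_const 2).mul (Measurable.ite ?_ ?_ measurable_const)
    · exact measurableSet_le (hfm.comp measurable_snd) measurable_fst
    · exact ((measurable_fst.pow_const _)).ennreal_ofReal
  have hpt : ∀ t ∈ Ioi (0 : ℝ), volume {x | t < ‖cv K f x‖ / 6} * ENNReal.ofReal (t ^ (p - 1)) ≤
      W * (∫⁻ x, ‖f x‖ₑ * (if t < ‖f x‖ then ENNReal.ofReal (t ^ (p - 1 - 1)) else 0)) +
      A ^ 2 * (∫⁻ x, ‖f x‖ₑ ^ 2 *
        (if ‖f x‖ ≤ t then ENNReal.ofReal (t ^ (-(2 - p) - 1)) else 0)) := by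
    intro t ht
    have ht : 0 < t := ht
    refine (mul_le_mul_left (meas_cv_le hA hW hc hs ht) _).trans_eq ?_
    rw [add_mul, mul_assoc, mul_assoc]
    congr 2
    · rw [div_eq_mul_inv, mul_assoc, ← ENNReal.ofReal_inv_of_pos ht, ← ENNReal.ofReal_mul
        (by positivity), ← lintegral_mul_const' _ _ ENNReal.ofReal_ne_top]
      refine lintegral_congr fun x => ?_
      rw [Real.rpow_sub_one ht.ne' (p - 1), div_eq_inv_mul]
      by_cases hx : t < ‖f x‖ <;> simp [hx]
    · rw [div_eq_mul_inv, mul_assoc, ← ENNReal.ofReal_inv_of_pos (by positivity),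
        ← ENNReal.ofReal_mul (by positivity), ← lintegral_mul_const' _ _ ENNReal.ofReal_ne_top]
      refine lintegral_congr fun x => ?_
      have : (t ^ 2)⁻¹ * t ^ (p - 1) = t ^ (-(2 - p) - 1) := by
        rw [← Real.rpow_natCast, ← Real.rpow_neg ht.le, ← Real.rpow_add ht]
        congr 1
        push_cast
        ring
      rw [this]
      by_cases hx : ‖f x‖ ≤ t <;> simp [hx]
  refine (setLIntegral_mono' measurableSet_Ioi hpt).trans ?_
  have hm1 : Measurable fun t : ℝ =>
      ∫⁻ x, ‖f x‖ₑ * (if t < ‖f x‖ then ENNReal.ofReal (t ^ (p - 1 - 1)) else 0) :=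
    hG1.lintegral_prod_right'
  have hm2 : Measurable fun t : ℝ => ∫⁻ x, ‖f x‖ₑ ^ 2 *
      (if ‖f x‖ ≤ t then ENNReal.ofReal (t ^ (-(2 - p) - 1)) else 0) :=
    hG2.lintegral_prod_right'
  rw [lintegral_add_left (hm1.const_mul W), lintegral_const_mul _ hm1, lintegral_const_mul _ hm2,
    lintegral_lintegral_swap hG1.aemeasurable, lintegral_lintegral_swap hG2.aemeasurable, add_mul,
    mul_assoc, mul_assoc]
  have hmp : Measurable fun x => ENNReal.ofReal (‖f x‖ ^ p) := (hfm.pow_const p).ennreal_ofReal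
  refine add_le_add (mul_le_mul_right ?_ _) (mul_le_mul_right ?_ _)
  · rw [← lintegral_const_mul _ hmp]
    refine lintegral_mono fun x => ?_
    rw [lintegral_const_mul' _ _ enorm_ne_top, lintegral_Ioi_ite_lt (norm_nonneg _) (by linarith),
      ← ofReal_norm, ← ENNReal.ofReal_mul (norm_nonneg _), ← ENNReal.ofReal_mul (by
        have : 0 < p - 1 := by linarith
        positivity)]
    refine ENNReal.ofReal_le_ofReal (le_of_eq ?_)
    rcases (norm_nonneg (f x)).eq_or_lt with h0 | h0
    · rw [← h0, Real.zero_rpow (by linarith), Real.zero_rpow (by linarith)]; simp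
    · rw [Real.rpow_sub_one h0.ne']
      field_simp
  · rw [← lintegral_const_mul _ hmp]
    refine lintegral_mono fun x => ?_
    rcases (norm_nonneg (f x)).eq_or_lt with h0 | h0
    · have : f x = 0 := norm_eq_zero.1 h0.symm
      simp [this]
    rw [lintegral_const_mul' _ _ (by finiteness), lintegral_Ioi_ite_le h0 (by linarith),
      ← ofReal_norm, ← ENNReal.ofReal_pow (norm_nonneg _), ← ENNReal.ofReal_mul (by positivity),
      ← ENNReal.ofReal_mul (by
        have : 0 < 2 - p := by linarith
        positivity)]
    refine ENNReal.ofReal_le_ofReal (le_of_eq ?_)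
    have : ‖f x‖ ^ 2 * ‖f x‖ ^ (-(2 - p)) = ‖f x‖ ^ p := by
      rw [← Real.rpow_natCast, ← Real.rpow_add h0]
      congr 1
      push_cast
      ring
    rw [← mul_div_assoc, this, div_eq_inv_mul]

lemma eLpNorm_rpow_eq_lintegral_ofReal (f : E n → ℂ) {p : ℝ} (hp : 0 < p) :
    eLpNorm f (ENNReal.ofReal p) volume = (∫⁻ x, ENNReal.ofReal (‖f x‖ ^ p)) ^ p⁻¹ := by
  rw [eLpNorm_eq_lintegral_rpow_enorm_toReal (by simpa using hp) ENNReal.ofReal_ne_top,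
    ENNReal.toReal_ofReal hp.le, one_div]
  congr 1
  refine lintegral_congr fun x => ?_
  rw [← ofReal_norm, ENNReal.ofReal_rpow_of_nonneg (norm_nonneg _) hp.le]

/-- The constant in the strong type estimate for exponents below two. -/
def interpConst (p : ℝ) (A : ℝ≥0) (W : ℝ≥0∞) : ℝ≥0∞ :=
  6 * (ENNReal.ofReal p *
    (W * ENNReal.ofReal (p - 1)⁻¹ + A ^ 2 * ENNReal.ofReal (2 - p)⁻¹)) ^ p⁻¹

lemma interpConst_ne_top {p : ℝ} (hp : 0 < p) {A : ℝ≥0} {W : ℝ≥0∞} (hW : W ≠ ⊤) :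
    interpConst p A W ≠ ⊤ := by
  unfold interpConst
  finiteness

theorem eLpNorm_cv_le_of_lt_two {K : 𝓢(E n, ℂ)} {A : ℝ≥0} {W : ℝ≥0∞} (hWt : W ≠ ⊤)
    (hA : ∀ g : E n → ℂ, MemLp g 2 volume → eLpNorm (cv K g) 2 volume ≤ A * eLpNorm g 2 volume)
    (hW : ∀ g : E n → ℂ, MemLp g 1 volume → ∀ t : ℝ≥0∞, t ≠ 0 → t ≠ ⊤ →
      t * volume {x | 3 * t < ‖cv K g x‖ₑ} ≤ W * eLpNorm g 1 volume)
    {p : ℝ} (hp1 : 1 < p) (hp2 : p < 2) {f : E n → ℂ} (hf : MemLp f (ENNReal.ofReal p) volume) :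
    eLpNorm (cv K f) (ENNReal.ofReal p) volume ≤
      (interpConst p A W).toNNReal * eLpNorm f (ENNReal.ofReal p) volume := by
  have hp0 : 0 < p := by linarith
  refine eLpNorm_cv_le_of_dense K (by simpa using hp1.le) ENNReal.ofReal_ne_top
    (fun f hc hs => ?_) hf
  rw [ENNReal.coe_toNNReal (interpConst_ne_top hp0 hWt)]
  have h1 := strong_type_lt_two hA hW hc hs hp1 hp2
  have h2 : ∀ x, ENNReal.ofReal ((‖cv K f x‖ / 6) ^ p) =
      ENNReal.ofReal ((6⁻¹ : ℝ) ^ p) * ENNReal.ofReal (‖cv K f x‖ ^ p) := by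
    intro x
    rw [← ENNReal.ofReal_mul (by positivity), ← Real.mul_rpow (by norm_num) (norm_nonneg _),
      div_eq_inv_mul]
  simp only [h2] at h1
  rw [lintegral_const_mul' _ _ ENNReal.ofReal_ne_top] at h1
  have h3 := ENNReal.rpow_le_rpow h1 (inv_pos.2 hp0).le
  rw [ENNReal.mul_rpow_of_nonneg _ _ (inv_pos.2 hp0).le,
    ENNReal.mul_rpow_of_nonneg _ _ (inv_pos.2 hp0).le, ← eLpNorm_rpow_eq_lintegral_ofReal _ hp0,
    ← eLpNorm_rpow_eq_lintegral_ofReal _ hp0, ENNReal.ofReal_rpow_of_nonneg (by positivity)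
    (inv_pos.2 hp0).le, Real.rpow_rpow_inv (by norm_num) hp0.ne'] at h3
  have h4 : (6 : ℝ≥0∞) * ENNReal.ofReal (6⁻¹ : ℝ) = 1 := by
    rw [ENNReal.ofReal_inv_of_pos (by norm_num), ENNReal.ofReal_ofNat]
    exact ENNReal.mul_inv_cancel (by norm_num) (by norm_num)
  calc eLpNorm (cv K f) (ENNReal.ofReal p) volume
      = 6 * (ENNReal.ofReal (6⁻¹ : ℝ) * eLpNorm (cv K f) (ENNReal.ofReal p) volume) := by
        rw [← mul_assoc, h4, one_mul]
    _ ≤ _ := mul_le_mul_right h3 _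
    _ = _ := by rw [interpConst, mul_assoc]

/-! ### Duality -/

lemma aestronglyMeasurable_cv (K : 𝓢(E n, ℂ)) {f : E n → ℂ} (hf : AEStronglyMeasurable f volume) :
    AEStronglyMeasurable (cv K f) volume := by
  refine AEStronglyMeasurable.integral_prod_right' (f := fun z : E n × E n => K (z.1 - z.2) * f z.2)
    ((Continuous.aestronglyMeasurable ?_).mul hf.comp_snd)
  have := K.continuous
  fun_prop

/-- The transpose of convolution with K is convolution with the reflected kernel. Writing it as K
acting between two reflections lets bounds for K itself serve in the duality argument. -/
lemma integral_cv_mul (K : 𝓢(E n, ℂ)) {q : ℝ≥0∞} (hq : 1 ≤ q) {f g : E n → ℂ} (hf : Integrable f)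
    (hg : MemLp g q volume) :
    ∫ x, cv K f x * g x = ∫ y, f y * cv K (fun z => g (-z)) (-y) := by
  have hg' : MemLp (fun z => g (-z)) q volume :=
    hg.comp_measurePreserving (Measure.measurePreserving_neg volume)
  obtain ⟨D, hD⟩ := exists_enorm_cv_le K hq
  have hmeas : AEStronglyMeasurable (Function.uncurry fun (x y : E n) => K (x - y) * f y * g x)
      (volume.prod volume) := by
    refine ((Continuous.aestronglyMeasurable ?_).mul hf.1.comp_snd).mul hg.1.comp_fst
    have := K.continuous
    fun_prop
  have hinner : ∀ y, ∫ x, K (x - y) * f y * g x = f y * cv K (fun z => g (-z)) (-y) := by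
    intro y
    unfold cv
    rw [← integral_const_mul, ← integral_neg_eq_self]
    refine integral_congr_ae (Eventually.of_forall fun x => ?_)
    simp only
    rw [show -x - y = -y - x by abel]
    ring
  have hint : Integrable (Function.uncurry fun (x y : E n) => K (x - y) * f y * g x)
      (volume.prod volume) := by
    refine ⟨hmeas, ?_⟩
    obtain ⟨D', hD'⟩ := exists_enorm_cv_le K hq
    rw [hasFiniteIntegral_iff_enorm, lintegral_prod_symm _ hmeas.enorm]
    have hb : ∀ y, ∫⁻ x, ‖Function.uncurry (fun (x y : E n) => K (x - y) * f y * g x) (x, y)‖ₑ ≤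
        ‖f y‖ₑ * (eLpNorm K (1 - q⁻¹)⁻¹ volume * eLpNorm g q volume) := by
      intro y
      have := ENNReal.HolderConjugate.inv_one_sub_inv' hq
      have : ENNReal.HolderTriple (1 - q⁻¹)⁻¹ q 1 := ENNReal.HolderTriple.symm
      have hK : Continuous fun x => K (x - y) := by
        have := K.continuous
        fun_prop
      have h5 := eLpNorm_smul_le_mul_eLpNorm (p := (1 - q⁻¹)⁻¹) (q := q) (r := 1) hg.1
        (hK.aestronglyMeasurable (μ := volume))
      rw [eLpNorm_one_eq_lintegral_enorm] at h5
      have h6 : eLpNorm (fun x => K (x - y)) (1 - q⁻¹)⁻¹ volume = eLpNorm K (1 - q⁻¹)⁻¹ volume :=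
        eLpNorm_comp_measurePreserving (g := K) K.continuous.aestronglyMeasurable
          (measurePreserving_sub_right volume y)
      rw [← h6]
      refine le_trans (le_of_eq ?_) (mul_le_mul_right h5 _)
      rw [← lintegral_const_mul' _ _ enorm_ne_top]
      refine lintegral_congr fun x => ?_
      simp only [Function.uncurry_apply_pair, Pi.smul_apply', smul_eq_mul, enorm_mul]
      ring
    refine (lintegral_mono hb).trans_lt ?_
    rw [lintegral_mul_const'' _ hf.1.enorm]
    exact ENNReal.mul_lt_top hf.2 (ENNReal.mul_lt_top (K.memLp _ volume).2 hg.2)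
  calc ∫ x, cv K f x * g x = ∫ x, ∫ y, K (x - y) * f y * g x := by
        refine integral_congr_ae (Eventually.of_forall fun x => ?_)
        simp only [cv]
        rw [integral_mul_const]
    _ = ∫ y, ∫ x, K (x - y) * f y * g x := integral_integral_swap hint
    _ = _ := by simp only [hinner]

/-- Testing h = K * f against |h|^(p−2) h̄ gives ‖h‖ₚ^p ≤ B ‖f‖ₚ ‖h‖ₚ^(p−1). Dividing requires ‖h‖ₚ
to be known finite beforehand, which is the role of `hKf`. -/
theorem eLpNorm_cv_le_of_dual {K : 𝓢(E n, ℂ)} {p q : ℝ} (hpq : p.HolderConjugate q) {B : ℝ≥0}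
    (hB : ∀ g : E n → ℂ, MemLp g (ENNReal.ofReal q) volume →
      eLpNorm (cv K g) (ENNReal.ofReal q) volume ≤ B * eLpNorm g (ENNReal.ofReal q) volume)
    {f : E n → ℂ} (hf : MemLp f (ENNReal.ofReal p) volume) (hf1 : Integrable f)
    (hKf : MemLp (cv K f) (ENNReal.ofReal p) volume) :
    eLpNorm (cv K f) (ENNReal.ofReal p) volume ≤ B * eLpNorm f (ENNReal.ofReal p) volume := by
  set h := cv K f with hh
  have hp0 := hpq.pos
  have hq0 := hpq.symm.pos
  set g : E n → ℂ := fun x => (‖h x‖ ^ (p - 2) : ℝ) * (starRingEnd ℂ) (h x) with hg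
  have hgm : AEStronglyMeasurable g volume := by
    refine (Complex.measurable_ofReal.comp_aemeasurable
      (hKf.1.norm.aemeasurable.pow_const _)).aestronglyMeasurable.mul ?_
    exact Complex.continuous_conj.comp_aestronglyMeasurable hKf.1
  have hgn : ∀ x, ‖g x‖ ^ q = ‖h x‖ ^ p := by
    intro x
    rcases (norm_nonneg (h x)).eq_or_lt with h0 | h0
    · have : h x = 0 := norm_eq_zero.1 h0.symm
      simp [hg, this, Real.zero_rpow hp0.ne', Real.zero_rpow hq0.ne']
    · have h1 : ‖g x‖ = ‖h x‖ ^ (p - 1) := by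
        rw [hg]
        simp only [norm_mul, Complex.norm_real, RCLike.norm_conj, Real.norm_eq_abs,
          abs_of_pos (Real.rpow_pos_of_pos h0 (p - 2))]
        rw [← Real.rpow_add_one h0.ne']
        congr 1
        ring
      rw [h1, ← Real.rpow_mul h0.le, hpq.sub_one_mul_conj]
  have hhg : ∀ x, h x * g x = ((‖h x‖ ^ p : ℝ) : ℂ) := by
    intro x
    rcases (norm_nonneg (h x)).eq_or_lt with h0 | h0
    · have : h x = 0 := norm_eq_zero.1 h0.symm
      simp [this, Real.zero_rpow hp0.ne']
    · rw [hg]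
      simp only
      rw [mul_left_comm, Complex.mul_conj, Complex.normSq_eq_norm_sq, ← Complex.ofReal_mul,
        ← Real.rpow_natCast, ← Real.rpow_add h0]
      congr 2
      push_cast
      ring
  set X : ℝ≥0∞ := ∫⁻ x, ENNReal.ofReal (‖h x‖ ^ p) with hX
  have hXp : eLpNorm h (ENNReal.ofReal p) volume = X ^ p⁻¹ := eLpNorm_rpow_eq_lintegral_ofReal h hp0
  have hXt : X ≠ ⊤ := by
    intro hcon
    have := hKf.2.ne
    rw [hXp, hcon, ENNReal.top_rpow_of_pos (inv_pos.2 hp0)] at this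
    exact this rfl
  have hXg : eLpNorm g (ENNReal.ofReal q) volume = X ^ q⁻¹ := by
    rw [eLpNorm_rpow_eq_lintegral_ofReal g hq0]
    simp only [hgn, hX]
  have hgL : MemLp g (ENNReal.ofReal q) volume :=
    ⟨hgm, by rw [hXg]; exact ENNReal.rpow_lt_top_of_nonneg (inv_pos.2 hq0).le hXt⟩
  have hg' : MemLp (fun z => g (-z)) (ENNReal.ofReal q) volume :=
    hgL.comp_measurePreserving (Measure.measurePreserving_neg volume)
  have hint : Integrable fun x => ‖h x‖ ^ p := by
    refine ⟨(hKf.1.norm.aemeasurable.pow_const _).aestronglyMeasurable, ?_⟩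
    rw [hasFiniteIntegral_iff_ofReal (Eventually.of_forall fun x => by positivity)]
    exact hXt.lt_top
  have hq1 : 1 ≤ ENNReal.ofReal q := by simpa using hpq.symm.lt.le
  have key : X ≤ B * eLpNorm f (ENNReal.ofReal p) volume * X ^ q⁻¹ := by
    have h1 : ‖∫ x, h x * g x‖ₑ = X := by
      simp only [hhg]
      rw [integral_complex_ofReal, ← ofReal_norm, Complex.norm_real, Real.norm_of_nonneg
        (integral_nonneg fun x => by positivity), ofReal_integral_eq_lintegral_ofReal hint
        (Eventually.of_forall fun x => by positivity)]
    rw [integral_cv_mul K hq1 hf1 hgL] at h1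
    have : ENNReal.HolderTriple (ENNReal.ofReal p) (ENNReal.ofReal q) 1 :=
      hpq.ennrealOfReal
    have hcm := aestronglyMeasurable_cv K hg'.1
    have hneg := Measure.measurePreserving_neg (volume : Measure (E n))
    have h2 := eLpNorm_smul_le_mul_eLpNorm (p := ENNReal.ofReal p) (q := ENNReal.ofReal q) (r := 1)
      (hcm.comp_measurePreserving hneg) hf.1
    rw [eLpNorm_one_eq_lintegral_enorm] at h2
    refine h1.symm.le.trans ((enorm_integral_le_lintegral_enorm _).trans (h2.trans ?_))
    rw [mul_comm (B : ℝ≥0∞), mul_assoc, eLpNorm_comp_measurePreserving hcm hneg, ← hXg]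
    refine mul_le_mul_right ((hB _ hg').trans_eq ?_) _
    rw [← eLpNorm_comp_measurePreserving hgL.1 hneg]
    rfl
  rw [hXp]
  rcases eq_or_ne X 0 with h0 | h0
  · rw [h0, ENNReal.zero_rpow_of_pos (inv_pos.2 hp0)]
    exact zero_le
  · have h3 : X ^ p⁻¹ * X ^ q⁻¹ = X := by
      rw [← ENNReal.rpow_add _ _ h0 hXt, hpq.inv_add_inv_eq_one, ENNReal.rpow_one]
    refine (ENNReal.mul_le_mul_iff_left (c := X ^ q⁻¹) (by simp [h0, hXt])
      (ENNReal.rpow_ne_top_of_nonneg (inv_pos.2 hq0).le hXt)).1 ?_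
    rw [h3]
    exact key

/-! ### The dyadic pieces of a multiplier -/

/-- The truncation `(χ(δ_{2^{-J}} ξ) - χ(δ_{2^J} ξ)) m(ξ)` of the multiplier `m`. -/
def trunc {m : E n → ℂ} (hm : IsMultiplier κ m) (J : ℕ) : 𝓢(E n, ℂ) :=
  psiSum hm (Finset.Ioc (-(J : ℤ)) J)

lemma trunc_apply {m : E n → ℂ} (hm : IsMultiplier κ m) (J : ℕ) (ξ : E n) :
    trunc hm J ξ = (chi (dil κ (-J) ξ) - chi (dil κ J ξ)) * m ξ := by
  rw [← sum_theta, Finset.sum_mul]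
  simp [trunc, psiSum]

lemma norm_trunc_le {m : E n → ℂ} (hm : IsMultiplier κ m) {M : ℝ}
    (hM : ∀ ξ, ξ ≠ 0 → ‖m ξ‖ ≤ M) (hM0 : 0 ≤ M) (J : ℕ) (ξ : E n) : ‖trunc hm J ξ‖ ≤ 2 * M := by
  rw [trunc_apply, norm_mul]
  rcases eq_or_ne ξ 0 with rfl | hξ
  · simpa using hM0
  · refine mul_le_mul ((norm_sub_le _ _).trans ?_) (hM ξ hξ) (norm_nonneg _) (by norm_num)
    linarith [norm_chi_le (dil κ (-J) ξ), norm_chi_le (dil κ J ξ)]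

/-- The kernel of the truncated operator. -/
def truncKer {m : E n → ℂ} (hm : IsMultiplier κ m) (J : ℕ) : 𝓢(E n, ℂ) := 𝓕⁻ (trunc hm J)

lemma exists_eLpNorm_two_truncKer_le (hn : 0 < n) {m : E n → ℂ} (hm : IsMultiplier κ m) :
    ∃ A : ℝ≥0, ∀ J, ∀ f : E n → ℂ, MemLp f 2 volume →
      eLpNorm (cv (truncKer hm J) f) 2 volume ≤ A * eLpNorm f 2 volume := by
  obtain ⟨M, hM0, -, hM⟩ := exists_bddMult hn hm
  exact ⟨⟨2 * M, by positivity⟩, fun J f hf =>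
    eLpNorm_cv_two_le (M := ⟨2 * M, by positivity⟩) (trunc hm J) (norm_trunc_le hm hM hM0 J) hf⟩

theorem exists_weak_type_truncKer (hn : 0 < n) (hκ : ∀ l, 0 < κ l) {m : E n → ℂ}
    (hm : IsMultiplier κ m) : ∃ W : ℝ≥0, ∀ J, ∀ f : E n → ℂ, MemLp f 1 volume →
      ∀ t : ℝ≥0∞, t ≠ 0 → t ≠ ⊤ →
        t * volume {x | 3 * t < ‖cv (truncKer hm J) f x‖ₑ} ≤ W * eLpNorm f 1 volume := by
  obtain ⟨A, hA⟩ := exists_eLpNorm_two_truncKer_le hn hm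
  obtain ⟨C, hC⟩ := exists_hormander_psiSum hn hκ hm
  have hfin : (A : ℝ≥0∞) ^ 2 * 2 ^ (∑ l, κ l) + volume {x : E n | knorm κ x ≤ 2 * n} + 2 * C ≠ ⊤ := by
    have := volume_knorm_le_lt_top (n := n) hκ (2 * n)
    finiteness
  refine ⟨_, fun J f hf t ht ht' => (weak_type_cv hn hκ (hA J) (hC _) hf ht ht').trans_eq
    (congrArg (· * eLpNorm f 1 volume) (ENNReal.coe_toNNReal hfin).symm)⟩

/-- Supplies the a priori finiteness for duality: K * f lies in L² and is bounded, so it lies in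
every Lᵖ with p ≥ 2. -/
lemma memLp_cv_of_hasCompactSupport (K : 𝓢(E n, ℂ)) {A : ℝ≥0}
    (hA : ∀ g : E n → ℂ, MemLp g 2 volume → eLpNorm (cv K g) 2 volume ≤ A * eLpNorm g 2 volume)
    {f : E n → ℂ} (hc : Continuous f) (hs : HasCompactSupport f) {p : ℝ} (hp : 2 ≤ p) :
    MemLp (cv K f) (ENNReal.ofReal p) volume := by
  have hf2 : MemLp f 2 volume := hc.memLp_of_hasCompactSupport hs
  have h2 : MemLp (cv K f) 2 volume :=
    ⟨aestronglyMeasurable_cv K hf2.1, (hA f hf2).trans_lt (ENNReal.mul_lt_top (by simp) hf2.2)⟩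
  obtain ⟨D, hD⟩ := exists_enorm_cv_le K (p := 2) one_le_two
  have hfin : (D : ℝ≥0∞) * eLpNorm f 2 volume ≠ ⊤ := (ENNReal.mul_lt_top (by simp) hf2.2).ne
  set R : ℝ := (D * eLpNorm f 2 volume).toReal with hR
  have hbd : ∀ x, ‖cv K f x‖ ≤ R := fun x => by
    rw [← toReal_enorm]
    exact ENNReal.toReal_mono hfin (hD f hf2.1 x)
  have hi := h2.integrable_norm_rpow (by norm_num) (by norm_num)
  have hp0 : 0 < p := by linarith
  rw [← integrable_norm_rpow_iff h2.1 (by simpa using hp0) ENNReal.ofReal_ne_top,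
    ENNReal.toReal_ofReal hp0.le]
  refine (hi.const_mul (R ^ (p - 2))).mono'
    (h2.1.norm.aemeasurable.pow_const _).aestronglyMeasurable (Eventually.of_forall fun x => ?_)
  rw [Real.norm_of_nonneg (by positivity), ENNReal.toReal_ofNat]
  rcases (norm_nonneg (cv K f x)).eq_or_lt with h0 | h0
  · rw [← h0, Real.zero_rpow hp0.ne', Real.zero_rpow two_ne_zero, mul_zero]
  · calc ‖cv K f x‖ ^ p = ‖cv K f x‖ ^ (p - 2) * ‖cv K f x‖ ^ (2 : ℝ) := by
          rw [← Real.rpow_add h0]; congr 1; ring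
      _ ≤ _ := by
          refine mul_le_mul_of_nonneg_right ?_ (by positivity)
          exact Real.rpow_le_rpow h0.le (hbd x) (by linarith)

theorem exists_strong_type_truncKer (hn : 0 < n) (hκ : ∀ l, 0 < κ l) {m : E n → ℂ}
    (hm : IsMultiplier κ m) {p : ℝ≥0∞} (hp1 : 1 < p) (hp : p ≠ ⊤) :
    ∃ B : ℝ≥0, ∀ J, ∀ f : E n → ℂ, MemLp f p volume →
      eLpNorm (cv (truncKer hm J) f) p volume ≤ B * eLpNorm f p volume := by
  obtain ⟨A, hA⟩ := exists_eLpNorm_two_truncKer_le hn hm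
  obtain ⟨W, hW⟩ := exists_weak_type_truncKer hn hκ hm
  have hlow : ∀ q : ℝ, 1 < q → q < 2 → ∃ B : ℝ≥0, ∀ J, ∀ f : E n → ℂ,
      MemLp f (ENNReal.ofReal q) volume → eLpNorm (cv (truncKer hm J) f) (ENNReal.ofReal q) volume ≤
        B * eLpNorm f (ENNReal.ofReal q) volume := fun q hq1 hq2 =>
    ⟨_, fun J f hf => eLpNorm_cv_le_of_lt_two ENNReal.coe_ne_top (hA J) (hW J) hq1 hq2 hf⟩
  lift p to ℝ≥0 using hp
  have hp1 : 1 < p := by exact_mod_cast hp1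
  rw [← ENNReal.ofReal_coe_nnreal]
  -- Interpolation below 2, Plancherel at 2, and duality above 2, where the conjugate exponent lies
  -- below 2.
  rcases lt_trichotomy p 2 with h | h | h
  · exact hlow p (by exact_mod_cast hp1) (by exact_mod_cast h)
  · refine ⟨A, fun J f hf => ?_⟩
    rw [h] at hf ⊢
    simp only [NNReal.coe_ofNat, ENNReal.ofReal_ofNat] at hf ⊢
    exact hA J f hf
  · have hpq : (p : ℝ).HolderConjugate (p : ℝ).conjExponent :=
      Real.HolderConjugate.conjExponent (by exact_mod_cast hp1)
    have hp2 : (2 : ℝ) < p := by exact_mod_cast h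
    obtain ⟨B, hB⟩ := hlow (p : ℝ).conjExponent hpq.symm.lt (by
      rw [Real.conjExponent, div_lt_iff₀ (by linarith)]
      linarith)
    refine ⟨B, fun J f hf => eLpNorm_cv_le_of_dense _ (by simpa using hp1.le) ENNReal.ofReal_ne_top
      (fun f hc hs => ?_) hf⟩
    refine eLpNorm_cv_le_of_dual hpq (hB J) (hc.memLp_of_hasCompactSupport hs)
      (hc.integrable_of_hasCompactSupport hs) (memLp_cv_of_hasCompactSupport _ (hA J) hc hs ?_)
    exact hp2.le

end AnisoMult

end

/-! ### Removal of the truncation and extension of the operator to Lᵖ and L¹. -/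

noncomputable section

namespace AnisoMult

variable {n : ℕ} {κ : Fin n → ℕ}

/-! ### Passage to the limit -/

lemma eventually_chi_dil_eq_zero (hκ : ∀ l, 0 < κ l) {ξ : E n} (hξ : ξ ≠ 0) :
    ∀ᶠ J : ℕ in atTop, chi (dil κ J ξ) = 0 := by
  have h1 : Tendsto (fun J : ℕ => (2 : ℝ) ^ J * knorm κ ξ) atTop atTop :=
    (tendsto_pow_atTop_atTop_of_one_lt one_lt_two).atTop_mul_const (knorm_pos hκ hξ)
  filter_upwards [h1.eventually_ge_atTop (n * (1 + 2))] with J hJ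
  refine chi_eq_zero ?_
  have h2 := knorm_le_norm hκ (dil κ J ξ)
  rw [knorm_dil hκ, zpow_natCast] at h2
  have h3 := hJ.trans h2
  rcases Nat.eq_zero_or_pos n with rfl | hn
  · exact absurd (Subsingleton.elim _ _) hξ
  · have hn' : (0 : ℝ) < n := by exact_mod_cast hn
    have := le_of_mul_le_mul_left h3 hn'
    linarith

lemma eventually_chi_dil_neg_eq_one (hκ : ∀ l, 0 < κ l) (ξ : E n) :
    ∀ᶠ J : ℕ in atTop, chi (dil κ (-J) ξ) = 1 := by
  have h1 : Tendsto (fun J : ℕ => (2 : ℝ)⁻¹ ^ J * ∑ l, |ξ l|) atTop (𝓝 (0 * ∑ l, |ξ l|)) :=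
    (tendsto_pow_atTop_nhds_zero_of_lt_one (by norm_num) (by norm_num)).mul_const _
  rw [zero_mul] at h1
  filter_upwards [h1.eventually (Iic_mem_nhds one_pos)] with J hJ
  refine chi_eq_one ((norm_le_sum_abs _).trans (le_trans ?_ hJ))
  rw [Finset.mul_sum]
  refine Finset.sum_le_sum fun l _ => ?_
  rw [dil_apply, abs_mul, abs_of_pos (by positivity)]
  refine mul_le_mul_of_nonneg_right ?_ (abs_nonneg _)
  rw [neg_mul, zpow_neg, inv_pow]
  refine inv_anti₀ (by positivity) ?_
  rw [← zpow_natCast]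
  refine zpow_le_zpow_right₀ one_le_two ?_
  have : (1 : ℤ) ≤ κ l := by exact_mod_cast hκ l
  nlinarith [Int.natCast_nonneg J]

lemma eventually_trunc_eq (hκ : ∀ l, 0 < κ l) {m : E n → ℂ} (hm : IsMultiplier κ m) {ξ : E n}
    (hξ : ξ ≠ 0) : ∀ᶠ J : ℕ in atTop, trunc hm J ξ = m ξ := by
  filter_upwards [eventually_chi_dil_eq_zero hκ hξ, eventually_chi_dil_neg_eq_one hκ ξ] with J h1 h2
  rw [trunc_apply, h1, h2, sub_zero, one_mul]

/-- Off the origin the truncated multipliers eventually equal m, and they are bounded by 2M.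
Dominated convergence with majorant (3M|f̂|)² and Plancherel give the limit in L². -/
lemma tendsto_l2Op_trunc (hn : 0 < n) (hκ : ∀ l, 0 < κ l) {m : E n → ℂ} (hm : IsMultiplier κ m)
    (f : Lp ℂ 2 (volume : Measure (E n))) :
    Tendsto (fun J => l2Op (trunc hm J) f) atTop (𝓝 (l2Op m f)) := by
  obtain ⟨M, hM0, hb, hM⟩ := exists_bddMult hn hm
  have hbJ := fun J => BddMult.of_schwartz (trunc hm J) (norm_trunc_le hm hM hM0 J)
  have h0 : Tendsto (fun J => ((hbJ J).memLp_mul (Lp.memLp (𝓕 f))).toLp) atTop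
      (𝓝 (hb.memLp_mul (Lp.memLp (𝓕 f))).toLp) := by
    rw [Lp.tendsto_Lp_iff_tendsto_eLpNorm'']
    have h1 : Tendsto (fun J => ∫⁻ ξ, ‖trunc hm J ξ * (𝓕 f : Lp ℂ 2 (volume : Measure (E n))) ξ -
        m ξ * (𝓕 f : Lp ℂ 2 (volume : Measure (E n))) ξ‖ₑ ^ 2) atTop (𝓝 0) := by
      rw [← lintegral_zero (μ := (volume : Measure (E n)))]
      refine tendsto_lintegral_of_dominated_convergence'
        (fun ξ => (ENNReal.ofReal (3 * M) * ‖(𝓕 f : Lp ℂ 2 (volume : Measure (E n))) ξ‖ₑ) ^ 2)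
        (fun J => ?_) (fun J => ?_) ?_ ?_
      · exact ((((hbJ J).memLp_mul (Lp.memLp (𝓕 f))).1.sub
          (hb.memLp_mul (Lp.memLp (𝓕 f))).1).enorm).pow_const 2
      · filter_upwards [ae_ne_zero hn] with ξ hξ
        refine pow_le_pow_left₀ zero_le ?_ 2
        rw [← sub_mul, enorm_mul, ← ofReal_norm]
        refine mul_le_mul_left (ENNReal.ofReal_le_ofReal ((norm_sub_le _ _).trans ?_)) _
        linarith [norm_trunc_le hm hM hM0 J ξ, hM ξ hξ]
      · simp only [mul_pow]
        rw [lintegral_const_mul' _ _ (by finiteness), ← eLpNorm_two_sq]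
        have := (Lp.memLp (𝓕 f)).2.ne
        finiteness
      · filter_upwards [ae_ne_zero hn] with ξ hξ
        refine tendsto_const_nhds.congr' ?_
        filter_upwards [eventually_trunc_eq hκ hm hξ] with J hJ
        rw [hJ]
        simp
    have h2 := h1.ennrpow_const (2⁻¹ : ℝ)
    rw [ENNReal.zero_rpow_of_pos (by norm_num)] at h2
    refine h2.congr fun J => ?_
    have h3 := eLpNorm_two_sq ((fun ξ => trunc hm J ξ * (𝓕 f : Lp ℂ 2 (volume : Measure (E n))) ξ) -
        fun ξ => m ξ * (𝓕 f : Lp ℂ 2 (volume : Measure (E n))) ξ)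
    simp only [Pi.sub_apply] at h3
    rw [← h3, ← ENNReal.rpow_natCast, ← ENNReal.rpow_mul]
    simp
  have hc : Continuous (fun g : Lp ℂ 2 (volume : Measure (E n)) => 𝓕⁻ g) :=
    (LinearMap.mkContinuous (σ := RingHom.id ℂ)
      ⟨⟨fun g : Lp ℂ 2 (volume : Measure (E n)) => 𝓕⁻ g, FourierTransform.fourierInv_add⟩,
        FourierTransform.fourierInv_smul⟩ 1 fun g => by
          rw [one_mul]; exact (norm_fourierInv_L2 g).le).continuous
  rw [hb.l2Op_eq]
  refine ((hc.tendsto _).comp h0).congr fun J => ?_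
  rw [(hbJ J).l2Op_eq]
  rfl

lemma eLpNorm_truncKer_eq {m : E n → ℂ} (hm : IsMultiplier κ m) (J : ℕ)
    (f : Lp ℂ 2 (volume : Measure (E n))) :
    cv (truncKer hm J) f =ᵐ[volume] l2Op (trunc hm J) f := cv_ae_eq_l2Op _ f

theorem exists_eLpNorm_l2Op_le (hn : 0 < n) (hκ : ∀ l, 0 < κ l) {m : E n → ℂ}
    (hm : IsMultiplier κ m) {p : ℝ≥0∞} (hp1 : 1 < p) (hp : p ≠ ⊤) :
    ∃ B : ℝ≥0, ∀ f : Lp ℂ 2 (volume : Measure (E n)), MemLp f p volume →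
      eLpNorm (l2Op m f) p volume ≤ B * eLpNorm f p volume := by
  obtain ⟨B, hB⟩ := exists_strong_type_truncKer hn hκ hm hp1 hp
  refine ⟨B, fun f hf => ?_⟩
  obtain ⟨ns, hns, hae⟩ :=
    (tendstoInMeasure_of_tendsto_Lp (tendsto_l2Op_trunc hn hκ hm f)).exists_seq_tendsto_ae
  refine (Lp.eLpNorm_lim_le_liminf_eLpNorm (fun k => Lp.aestronglyMeasurable _) _ hae).trans ?_
  refine liminf_le_of_le (by isBoundedDefault) fun b hb => ?_
  obtain ⟨k, hk⟩ := hb.exists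
  refine hk.trans ?_
  rw [← eLpNorm_congr_ae (eLpNorm_truncKer_eq hm (ns k) f)]
  exact hB (ns k) f hf

/-- L² convergence implies convergence in measure, so the uniform weak type bound at level 3t passes
to the limit at level 3t + t. -/
theorem exists_weak_type_l2Op (hn : 0 < n) (hκ : ∀ l, 0 < κ l) {m : E n → ℂ}
    (hm : IsMultiplier κ m) : ∃ W : ℝ≥0, ∀ f : Lp ℂ 2 (volume : Measure (E n)),
      MemLp f 1 volume → ∀ t : ℝ≥0∞, t ≠ 0 → t ≠ ⊤ →
        t * volume {x | 4 * t < ‖l2Op m f x‖ₑ} ≤ W * eLpNorm f 1 volume := by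
  obtain ⟨W, hW⟩ := exists_weak_type_truncKer hn hκ hm
  refine ⟨W, fun f hf t ht ht' => ?_⟩
  have h1 := tendstoInMeasure_of_tendsto_Lp (tendsto_l2Op_trunc hn hκ hm f) t (pos_iff_ne_zero.2 ht)
  have h2 : Tendsto (fun J => W * eLpNorm f 1 volume +
      t * volume {x | t ≤ edist (l2Op (trunc hm J) f x) (l2Op m f x)}) atTop
      (𝓝 (W * eLpNorm f 1 volume)) := by
    simpa using (ENNReal.Tendsto.const_mul h1 (Or.inr ht')).const_add (W * eLpNorm f 1 volume)
  refine ge_of_tendsto' h2 fun J => ?_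
  have h3 : volume {x | 3 * t < ‖l2Op (trunc hm J) f x‖ₑ} =
      volume {x | 3 * t < ‖cv (truncKer hm J) f x‖ₑ} := by
    refine measure_congr ?_
    filter_upwards [eLpNorm_truncKer_eq hm J f] with x hx
    exact propext (by
      change 3 * t < ‖l2Op (trunc hm J) f x‖ₑ ↔ 3 * t < ‖cv (truncKer hm J) f x‖ₑ
      rw [hx])
  refine le_trans ?_ (add_le_add (hW J f hf t ht ht') le_rfl)
  rw [← h3, ← mul_add]
  refine mul_le_mul_right ((measure_mono fun x hx => ?_).trans (measure_union_le _ _)) _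
  by_contra! hcon
  simp only [mem_union, mem_ofPred_eq, not_or, not_lt, not_le] at hcon hx
  rw [edist_comm, edist_eq_enorm_sub] at hcon
  have h4 : ‖l2Op m f x‖ₑ ≤ ‖l2Op (trunc hm J) f x‖ₑ + ‖l2Op m f x - l2Op (trunc hm J) f x‖ₑ := by
    have := enorm_add_le (l2Op (trunc hm J) f x) (l2Op m f x - l2Op (trunc hm J) f x)
    simpa using this
  refine absurd (hx.trans_le (h4.trans (add_le_add hcon.1 hcon.2.le))) (not_lt.2 (le_of_eq ?_))
  ring

/-! ### The extension to `Lᵖ` -/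

/-- The functions in `L² ∩ Lᵖ`. -/
def l2InterLp (n : ℕ) (p : ℝ≥0∞) : Submodule ℂ (Lp ℂ 2 (volume : Measure (E n))) where
  carrier := {f | MemLp f p volume}
  add_mem' {f g} hf hg := (memLp_congr_ae (Lp.coeFn_add f g)).2 (MemLp.add hf hg)
  zero_mem' := (memLp_congr_ae (Lp.coeFn_zero ℂ 2 volume)).2 MemLp.zero'
  smul_mem' c f hf := (memLp_congr_ae (Lp.coeFn_smul c f)).2 (MemLp.const_smul hf c)

lemma l2InterLp.memLp {p : ℝ≥0∞} (f : l2InterLp n p) :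
    MemLp (f : Lp ℂ 2 (volume : Measure (E n))) p volume := f.2

/-- The inclusion of `L² ∩ Lᵖ` into `Lᵖ`. -/
def l2InterLpIncl (n : ℕ) (p : ℝ≥0∞) : l2InterLp n p →ₗ[ℂ] Lp ℂ p (volume : Measure (E n)) where
  toFun f := (l2InterLp.memLp f).toLp
  map_add' f g := by
    rw [← MemLp.toLp_add, MemLp.toLp_eq_toLp_iff]
    exact Lp.coeFn_add (f : Lp ℂ 2 (volume : Measure (E n))) g
  map_smul' c f := by
    rw [RingHom.id_apply, ← MemLp.toLp_const_smul, MemLp.toLp_eq_toLp_iff]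
    exact Lp.coeFn_smul c (f : Lp ℂ 2 (volume : Measure (E n)))

lemma denseRange_l2InterLpIncl {p : ℝ≥0∞} [Fact (1 ≤ p)] (hp : p ≠ ⊤) :
    DenseRange (l2InterLpIncl n p) := by
  intro f
  obtain ⟨g, hg, hgf⟩ := exists_seq_hasCompactSupport hp (Lp.memLp f)
  have h2 : ∀ k, MemLp (g k) 2 volume := fun k =>
    (hg k).1.memLp_of_hasCompactSupport (hg k).2.1
  have hmem : ∀ k, (h2 k).toLp ∈ l2InterLp n p := fun k =>
    (memLp_congr_ae (h2 k).coeFn_toLp).2 (hg k).2.2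
  suffices hlim : Tendsto (fun k => l2InterLpIncl n p ⟨_, hmem k⟩) atTop (𝓝 f) from
    mem_closure_of_tendsto hlim (Eventually.of_forall fun k => mem_range_self _)
  rw [Lp.tendsto_Lp_iff_tendsto_eLpNorm']
  refine hgf.congr fun k => eLpNorm_congr_ae ?_
  filter_upwards [(h2 k).coeFn_toLp, MemLp.coeFn_toLp (hmem k)] with x h3 h4
  rw [Pi.sub_apply, Pi.sub_apply, ← h3, ← h4]
  rfl

/-- The operator `l2Op m` from `L² ∩ Lᵖ` to `Lᵖ`. -/
def BddMult.toLp {m : E n → ℂ} {M : ℝ} (hb : BddMult m M) {p : ℝ≥0∞}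
    (hmem : ∀ f : l2InterLp n p, MemLp (l2Op m f) p volume) :
    l2InterLp n p →ₗ[ℂ] Lp ℂ p (volume : Measure (E n)) where
  toFun f := (hmem f).toLp
  map_add' f g := by
    rw [← MemLp.toLp_add, MemLp.toLp_eq_toLp_iff]
    have := Lp.coeFn_add (l2Op m f) (l2Op m g)
    rwa [← hb.l2Op_add] at this
  map_smul' c f := by
    rw [RingHom.id_apply, ← MemLp.toLp_const_smul, MemLp.toLp_eq_toLp_iff]
    have := Lp.coeFn_smul c (l2Op m f)
    rwa [← hb.l2Op_smul] at this

lemma BddMult.coeFn_toLp {m : E n → ℂ} {M : ℝ} (hb : BddMult m M) {p : ℝ≥0∞}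
    (hmem : ∀ f : l2InterLp n p, MemLp (l2Op m f) p volume) (f : l2InterLp n p) :
    hb.toLp hmem f =ᵐ[volume] l2Op m f := MemLp.coeFn_toLp (hmem f)

lemma coeFn_l2InterLpIncl {p : ℝ≥0∞} (f : l2InterLp n p) :
    l2InterLpIncl n p f =ᵐ[volume] (f : Lp ℂ 2 (volume : Measure (E n))) :=
  MemLp.coeFn_toLp (l2InterLp.memLp f)

lemma exists_extension_of_dense {V X Y : Type*} [AddCommGroup V] [Module ℂ V]
    [NormedAddCommGroup X] [NormedSpace ℂ X] [NormedAddCommGroup Y] [NormedSpace ℂ Y]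
    [CompleteSpace Y] (S : V →ₗ[ℂ] Y) (e : V →ₗ[ℂ] X) (he : DenseRange e) {B : ℝ}
    (hS : ∀ v, ‖S v‖ ≤ B * ‖e v‖) : ∃ T : X →L[ℂ] Y, ∀ v, T (e v) = S v :=
  ⟨S.extendOfNorm e, fun v => LinearMap.extendOfNorm_eq he ⟨B, hS⟩ v⟩

theorem exists_strong_type_extension (hn : 0 < n) (hκ : ∀ l, 0 < κ l) {m : E n → ℂ}
    (hm : IsMultiplier κ m) {p : ℝ≥0∞} [Fact (1 ≤ p)] (hp1 : 1 < p) (hp : p < ⊤) :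
    ∃ T : Lp ℂ p (volume : Measure (E n)) →L[ℂ] Lp ℂ p (volume : Measure (E n)),
      ExtendsL2Op m p (fun f => (T f : E n →ₘ[volume] ℂ)) := by
  obtain ⟨B, hB⟩ := exists_eLpNorm_l2Op_le hn hκ hm hp1 hp.ne
  obtain ⟨M, hM0, hb, hM⟩ := exists_bddMult hn hm
  have hfin : ∀ f : l2InterLp n p,
      B * eLpNorm (f : Lp ℂ 2 (volume : Measure (E n))) p volume < ⊤ := by
    intro f
    exact ENNReal.mul_lt_top (by simp) (l2InterLp.memLp f).eLpNorm_lt_top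
  have hmem : ∀ f : l2InterLp n p, MemLp (l2Op m f) p volume := fun f =>
    ⟨Lp.aestronglyMeasurable _,
      (hB (f : Lp ℂ 2 (volume : Measure (E n))) (l2InterLp.memLp f)).trans_lt (hfin f)⟩
  have hS : ∀ f, ‖hb.toLp hmem f‖ ≤ B * ‖l2InterLpIncl n p f‖ := by
    intro f
    rw [Lp.norm_def, Lp.norm_def, eLpNorm_congr_ae (hb.coeFn_toLp hmem f),
      eLpNorm_congr_ae (coeFn_l2InterLpIncl f), ← ENNReal.coe_toReal, ← ENNReal.toReal_mul]
    exact ENNReal.toReal_mono (hfin f).ne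
      (hB (f : Lp ℂ 2 (volume : Measure (E n))) (l2InterLp.memLp f))
  obtain ⟨T, hTS⟩ := exists_extension_of_dense (hb.toLp hmem) (l2InterLpIncl n p)
    (denseRange_l2InterLpIncl hp.ne) hS
  refine ⟨T, fun f g hfg => ?_⟩
  have hg : g ∈ l2InterLp n p := (memLp_congr_ae hfg).1 (Lp.memLp f)
  have hf : f = l2InterLpIncl n p ⟨g, hg⟩ :=
    Lp.ext (hfg.trans (coeFn_l2InterLpIncl (⟨g, hg⟩ : l2InterLp n p)).symm)
  have h4 := hb.coeFn_toLp hmem ⟨g, hg⟩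
  rw [← hTS, ← hf] at h4
  exact h4

/-! ### The extension to `L¹` -/

/-- `g` is the limit in measure of `l2Op m h` as `h ∈ L¹ ∩ L²` tends to `f` in `L¹`. -/
def IsWeakLimit (m f g : E n → ℂ) : Prop :=
  ∀ ε : ℝ≥0∞, ε ≠ 0 → ∃ h : Lp ℂ 2 (volume : Measure (E n)), MemLp h 1 volume ∧
    eLpNorm (f - (h : E n → ℂ)) 1 volume ≤ ε ∧ volume {x | ε < ‖g x - l2Op m h x‖ₑ} ≤ ε

lemma IsWeakLimit.congr {m f f' g g' : E n → ℂ} (h : IsWeakLimit m f g) (hf : f =ᵐ[volume] f')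
    (hg : g =ᵐ[volume] g') : IsWeakLimit m f' g' := by
  intro ε hε
  obtain ⟨u, hu, h1, h2⟩ := h ε hε
  refine ⟨u, hu, ?_, ?_⟩
  · rwa [← eLpNorm_congr_ae (hf.sub (ae_eq_refl u))]
  · refine (measure_congr ?_).trans_le h2
    filter_upwards [hg] with x hx
    exact propext (by
      change ε < ‖g' x - l2Op m u x‖ₑ ↔ ε < ‖g x - l2Op m u x‖ₑ
      rw [hx])

lemma enorm_sub_lt_subset {a b c : E n → ℂ} (s t : ℝ≥0∞) :
    {x | s + t < ‖a x - c x‖ₑ} ⊆ {x | s < ‖a x - b x‖ₑ} ∪ {x | t < ‖b x - c x‖ₑ} := by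
  intro x hx
  by_contra! hcon
  simp only [mem_union, mem_ofPred_eq, not_or, not_lt] at hcon hx
  have h := enorm_add_le (a x - b x) (b x - c x)
  rw [sub_add_sub_cancel] at h
  exact absurd (hx.trans_le (h.trans (add_le_add hcon.1 hcon.2))) (lt_irrefl _)

lemma BddMult.l2Op_sub {m : E n → ℂ} {M : ℝ} (hm : BddMult m M)
    (f g : Lp ℂ 2 (volume : Measure (E n))) : l2Op m (f - g) = l2Op m f - l2Op m g := by
  rw [sub_eq_add_neg, sub_eq_add_neg, hm.l2Op_add, ← neg_one_smul ℂ g, hm.l2Op_smul, neg_one_smul]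

/-- The weak type estimate on `L¹ ∩ L²`. -/
def HasWeakType (m : E n → ℂ) (W : ℝ≥0) : Prop :=
  ∀ f : Lp ℂ 2 (volume : Measure (E n)), MemLp f 1 volume → ∀ t : ℝ≥0∞, t ≠ 0 → t ≠ ⊤ →
    t * volume {x | 4 * t < ‖l2Op m f x‖ₑ} ≤ W * eLpNorm f 1 volume

lemma HasWeakType.sub {m : E n → ℂ} {M : ℝ} (hm : BddMult m M) {W : ℝ≥0} (hW : HasWeakType m W)
    {u v : Lp ℂ 2 (volume : Measure (E n))} (hu : MemLp u 1 volume) (hv : MemLp v 1 volume)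
    {t : ℝ≥0∞} (ht : t ≠ 0) (ht' : t ≠ ⊤) :
    t * volume {x | 4 * t < ‖l2Op m u x - l2Op m v x‖ₑ} ≤ W * eLpNorm (u - v : E n → ℂ) 1 volume := by
  have h1 := Lp.coeFn_sub u v
  have h2 := Lp.coeFn_sub (l2Op m u) (l2Op m v)
  rw [← hm.l2Op_sub] at h2
  rw [← eLpNorm_congr_ae h1]
  refine le_trans (le_of_eq ?_) (hW (u - v) ((memLp_congr_ae h1).2 (hu.sub hv)) t ht ht')
  congr 1
  refine measure_congr ?_
  filter_upwards [h2] with x hx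
  exact propext (by
    change 4 * t < ‖l2Op m u x - l2Op m v x‖ₑ ↔ 4 * t < ‖l2Op m (u - v) x‖ₑ
    rw [hx, Pi.sub_apply])

/-- Two ε-approximants of f differ by at most 2ε in L¹, so by the weak type bound their images are
within 4t except on a set of measure O(ε/t). Now ε → 0, then t → 0. Linearity of the extension to L¹
will follow from this uniqueness. -/
lemma IsWeakLimit.unique {m : E n → ℂ} {M : ℝ} (hm : BddMult m M) {W : ℝ≥0} (hW : HasWeakType m W)
    {f g g' : E n → ℂ} (hf : MemLp f 1 volume) (h : IsWeakLimit m f g) (h' : IsWeakLimit m f g') :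
    g =ᵐ[volume] g' := by
  have key : ∀ t : ℝ≥0∞, t ≠ 0 → t ≠ ⊤ → volume {x | t + (4 * t + t) < ‖g x - g' x‖ₑ} = 0 := by
    intro t ht ht'
    have h1 : Tendsto (fun ε : ℝ≥0∞ => (2 * t + 2 * W) * ε) (𝓝[>] 0) (𝓝 0) := by
      have : Tendsto (fun ε : ℝ≥0∞ => (2 * t + 2 * W) * ε) (𝓝 0) (𝓝 ((2 * t + 2 * W) * 0)) :=
        ENNReal.Tendsto.const_mul tendsto_id (Or.inr (by finiteness))
      rw [mul_zero] at this
      exact this.mono_left nhdsWithin_le_nhds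
    have h2 : t * volume {x | t + (4 * t + t) < ‖g x - g' x‖ₑ} ≤ 0 := by
      refine ge_of_tendsto h1 ?_
      filter_upwards [Ioo_mem_nhdsGT (pos_iff_ne_zero.2 ht)] with ε hε
      obtain ⟨u, hu, hu1, hu2⟩ := h ε hε.1.ne'
      obtain ⟨v, hv, hv1, hv2⟩ := h' ε hε.1.ne'
      have h3 : volume {x | t < ‖g x - l2Op m u x‖ₑ} ≤ ε :=
        (measure_mono fun x hx => hε.2.trans hx).trans hu2
      have h4 : volume {x | t < ‖l2Op m v x - g' x‖ₑ} ≤ ε := by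
        refine (measure_mono fun x hx => ?_).trans hv2
        rw [mem_ofPred_eq, ← enorm_neg, neg_sub] at hx
        exact hε.2.trans hx
      have h5 : eLpNorm (u - v : E n → ℂ) 1 volume ≤ 2 * ε := by
        have := eLpNorm_add_le (hu.1.sub hf.1) (hf.1.sub hv.1) le_rfl
        rw [sub_add_sub_cancel, eLpNorm_sub_comm (u : E n → ℂ) f] at this
        rw [two_mul]
        exact this.trans (add_le_add hu1 hv1)
      calc t * volume {x | t + (4 * t + t) < ‖g x - g' x‖ₑ}
          ≤ t * (ε + (volume {x | 4 * t < ‖l2Op m u x - l2Op m v x‖ₑ} + ε)) := by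
            refine mul_le_mul_right ?_ _
            refine (measure_mono (enorm_sub_lt_subset (b := l2Op m u) _ _)).trans
              ((measure_union_le _ _).trans (add_le_add h3 ?_))
            exact (measure_mono (enorm_sub_lt_subset (b := l2Op m v) _ _)).trans
              ((measure_union_le _ _).trans (add_le_add le_rfl h4))
        _ = 2 * t * ε + t * volume {x | 4 * t < ‖l2Op m u x - l2Op m v x‖ₑ} := by ring
        _ ≤ 2 * t * ε + W * (2 * ε) :=
            add_le_add le_rfl ((hW.sub hm hu hv ht ht').trans (mul_le_mul_right h5 _))
        _ = _ := by ring
    simpa [ht] using h2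
  have h6 : ∀ k : ℕ, ∀ᵐ x, ‖g x - g' x‖ₑ ≤ 6 * ((k : ℝ≥0∞) + 1)⁻¹ := by
    intro k
    have := key ((k : ℝ≥0∞) + 1)⁻¹ (ENNReal.inv_ne_zero.2 (by finiteness)) (by simp)
    rw [ae_iff]
    convert this using 4
    rw [not_le]
    ring_nf
  filter_upwards [ae_all_iff.2 h6] with x hx
  have h7 : Tendsto (fun k : ℕ => 6 * ((k : ℝ≥0∞) + 1)⁻¹) atTop (𝓝 0) := by
    have := (tendsto_add_atTop_iff_nat (f := fun k : ℕ => ((k : ℝ≥0∞))⁻¹) 1).2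
      ENNReal.tendsto_inv_nat_nhds_zero
    simpa using ENNReal.Tendsto.const_mul (a := 6) this (Or.inr (by norm_num))
  have h8 := ge_of_tendsto' h7 hx
  exact sub_eq_zero.1 (enorm_eq_zero.1 (le_antisymm h8 zero_le))

lemma IsWeakLimit.add {m : E n → ℂ} {M : ℝ} (hm : BddMult m M) {f f' g g' : E n → ℂ}
    (hf : MemLp f 1 volume) (hf' : MemLp f' 1 volume)
    (h : IsWeakLimit m f g) (h' : IsWeakLimit m f' g') : IsWeakLimit m (f + f') (g + g') := by
  intro ε hε
  have hε2 : ε / 2 ≠ 0 := by simpa using hε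
  obtain ⟨u, hu, hu1, hu2⟩ := h (ε / 2) hε2
  obtain ⟨v, hv, hv1, hv2⟩ := h' (ε / 2) hε2
  refine ⟨u + v, (memLp_congr_ae (Lp.coeFn_add u v)).2 (hu.add hv), ?_, ?_⟩
  · rw [← ENNReal.add_halves ε]
    refine le_trans (le_of_eq ?_) ((eLpNorm_add_le (hf.1.sub hu.1) (hf'.1.sub hv.1) le_rfl).trans
      (add_le_add hu1 hv1))
    refine eLpNorm_congr_ae ?_
    filter_upwards [Lp.coeFn_add u v] with x hx
    simp only [Pi.sub_apply, Pi.add_apply, hx]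
    ring
  · calc volume {x | ε < ‖(g + g') x - l2Op m (u + v) x‖ₑ}
        ≤ volume ({x | ε / 2 < ‖g x - l2Op m u x‖ₑ} ∪ {x | ε / 2 < ‖g' x - l2Op m v x‖ₑ}) := by
          refine measure_mono_ae ?_
          rw [hm.l2Op_add]
          filter_upwards [Lp.coeFn_add (l2Op m u) (l2Op m v)] with x hx hx2
          change ε < ‖(g + g') x - (l2Op m u + l2Op m v : Lp ℂ 2 (volume : Measure (E n))) x‖ₑ at hx2
          change ε / 2 < ‖g x - l2Op m u x‖ₑ ∨ ε / 2 < ‖g' x - l2Op m v x‖ₑ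
          by_contra! hcon
          rw [hx, Pi.add_apply, Pi.add_apply, add_sub_add_comm] at hx2
          refine absurd (hx2.trans_le ((enorm_add_le _ _).trans (add_le_add hcon.1 hcon.2))) ?_
          rw [ENNReal.add_halves]
          exact lt_irrefl _
      _ ≤ ε / 2 + ε / 2 := (measure_union_le _ _).trans (add_le_add hu2 hv2)
      _ = ε := ENNReal.add_halves ε

lemma IsWeakLimit.const_smul {m : E n → ℂ} {M : ℝ} (hm : BddMult m M) {f g : E n → ℂ} (c : ℂ)
    (h : IsWeakLimit m f g) : IsWeakLimit m (c • f) (c • g) := by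
  intro ε hε
  have hc : ‖c‖ₑ ≤ ‖c‖ₑ + 1 := le_self_add
  have hc0 : ‖c‖ₑ + 1 ≠ 0 := by simp
  have hct : ‖c‖ₑ + 1 ≠ ⊤ := by finiteness
  set δ := ε / (‖c‖ₑ + 1) with hδ
  have hδ0 : δ ≠ 0 := ENNReal.div_ne_zero.2 ⟨hε, hct⟩
  have hcδ : ‖c‖ₑ * δ ≤ ε := by
    refine (mul_le_mul_left hc δ).trans ?_
    rw [hδ, ENNReal.mul_div_cancel hc0 hct]
  have hδε : δ ≤ ε := ENNReal.div_le_of_le_mul (le_mul_of_one_le_right zero_le (by simp))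
  obtain ⟨u, hu, hu1, hu2⟩ := h δ hδ0
  refine ⟨c • u, (memLp_congr_ae (Lp.coeFn_smul c u)).2 (hu.const_smul c), ?_, ?_⟩
  · refine le_trans (le_of_eq ?_) ((mul_le_mul_right hu1 ‖c‖ₑ).trans hcδ)
    rw [← eLpNorm_const_smul]
    refine eLpNorm_congr_ae ?_
    filter_upwards [Lp.coeFn_smul c u] with x hx
    simp only [Pi.sub_apply, Pi.smul_apply, hx, smul_sub]
  · refine le_trans (measure_mono_ae ?_) (hu2.trans hδε)
    rw [hm.l2Op_smul]
    filter_upwards [Lp.coeFn_smul c (l2Op m u)] with x hx hx2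
    change ε < ‖(c • g) x - (c • l2Op m u : Lp ℂ 2 (volume : Measure (E n))) x‖ₑ at hx2
    change δ < ‖g x - l2Op m u x‖ₑ
    by_contra! hcon
    rw [hx, Pi.smul_apply, Pi.smul_apply, ← smul_sub, enorm_smul] at hx2
    exact absurd (hx2.trans_le ((mul_le_mul_right hcon _).trans hcδ)) (lt_irrefl _)

lemma isWeakLimit_self (m : E n → ℂ) (f : Lp ℂ 2 (volume : Measure (E n))) (hf : MemLp f 1 volume) :
    IsWeakLimit m f (l2Op m f) := fun ε _ => ⟨f, hf, by simp, by simp⟩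

lemma IsWeakLimit.weak_type {m : E n → ℂ} {W : ℝ≥0} (hW : HasWeakType m W)
    {f g : E n → ℂ} (hf : MemLp f 1 volume) (h : IsWeakLimit m f g) {t : ℝ≥0∞} (ht : t ≠ 0)
    (ht' : t ≠ ⊤) : t * volume {x | t + 4 * t < ‖g x‖ₑ} ≤ W * eLpNorm f 1 volume := by
  have h1 : Tendsto (fun ε : ℝ≥0∞ => (t + W) * ε + W * eLpNorm f 1 volume) (𝓝[>] 0)
      (𝓝 (W * eLpNorm f 1 volume)) := by
    have : Tendsto (fun ε : ℝ≥0∞ => (t + W) * ε + W * eLpNorm f 1 volume) (𝓝 0)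
        (𝓝 ((t + W) * 0 + W * eLpNorm f 1 volume)) :=
      (ENNReal.Tendsto.const_mul tendsto_id (Or.inr (by finiteness))).add_const _
    rw [mul_zero, zero_add] at this
    exact this.mono_left nhdsWithin_le_nhds
  refine ge_of_tendsto h1 ?_
  filter_upwards [Ioo_mem_nhdsGT (pos_iff_ne_zero.2 ht)] with ε hε
  obtain ⟨u, hu, hu1, hu2⟩ := h ε hε.1.ne'
  have h3 : volume {x | t < ‖g x - l2Op m u x‖ₑ} ≤ ε :=
    (measure_mono fun x hx => hε.2.trans hx).trans hu2
  have h5 : eLpNorm u 1 volume ≤ eLpNorm f 1 volume + ε := by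
    have := eLpNorm_sub_le hf.1 (hf.1.sub hu.1) le_rfl
    rw [sub_sub_cancel] at this
    exact this.trans (add_le_add le_rfl hu1)
  have h6 := enorm_sub_lt_subset (a := g) (b := l2Op m u) (c := 0) t (4 * t)
  simp only [Pi.zero_apply, sub_zero] at h6
  calc t * volume {x | t + 4 * t < ‖g x‖ₑ}
      ≤ t * (ε + volume {x | 4 * t < ‖l2Op m u x‖ₑ}) := by
        refine mul_le_mul_right ((measure_mono h6).trans ((measure_union_le _ _).trans ?_)) _
        exact add_le_add h3 le_rfl
    _ = t * ε + t * volume {x | 4 * t < ‖l2Op m u x‖ₑ} := by ring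
    _ ≤ t * ε + W * (eLpNorm f 1 volume + ε) :=
        add_le_add le_rfl ((hW u hu t ht ht').trans (mul_le_mul_right h5 _))
    _ = _ := by ring

/-- Approximants with L¹ error 4^-k are used at height 2^-k: consecutive images then differ by more
than 4·2^-k only on a set of measure O(2^-k). These measures are summable, so off a small tail set
the images converge geometrically. -/
lemma exists_isWeakLimit {m : E n → ℂ} {M : ℝ} (hm : BddMult m M) {W : ℝ≥0} (hW : HasWeakType m W)
    {f : E n → ℂ} (hf : MemLp f 1 volume) :
    ∃ g : E n → ℂ, AEStronglyMeasurable g volume ∧ IsWeakLimit m f g := by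
  have h0 : ∀ k : ℕ, ∃ u : Lp ℂ 2 (volume : Measure (E n)), MemLp u 1 volume ∧
      eLpNorm (f - (u : E n → ℂ)) 1 volume ≤ (2⁻¹ ^ k) * (2⁻¹ ^ k) := by
    intro k
    obtain ⟨v, hv1, hv2, hv3, hv4⟩ := hf.exists_hasCompactSupport_eLpNorm_sub_le
      ENNReal.one_ne_top (ε := 2⁻¹ ^ k * 2⁻¹ ^ k) (by simp)
    have h2 : MemLp v 2 volume := hv3.memLp_of_hasCompactSupport hv1
    refine ⟨h2.toLp, (memLp_congr_ae h2.coeFn_toLp).2 hv4, ?_⟩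
    rwa [eLpNorm_congr_ae ((ae_eq_refl f).sub h2.coeFn_toLp)]
  choose u hu1 hu2 using h0
  set s : ℕ → E n → ℂ := fun k => l2Op m (u k) with hs
  set bad : ℕ → Set (E n) := fun k => {x | 4 * 2⁻¹ ^ k < ‖s k x - s (k + 1) x‖ₑ} with hbad
  have hvol : ∀ k, volume (bad k) ≤ 2 * W * 2⁻¹ ^ k := by
    intro k
    have hk0 : (2⁻¹ : ℝ≥0∞) ^ k ≠ 0 := by simp
    have hkt : (2⁻¹ : ℝ≥0∞) ^ k ≠ ⊤ := by simp
    have h1 := hW.sub hm (hu1 k) (hu1 (k + 1)) hk0 hkt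
    have h2 : eLpNorm (u k - u (k + 1) : E n → ℂ) 1 volume ≤ 2 * (2⁻¹ ^ k * 2⁻¹ ^ k) := by
      have := eLpNorm_add_le ((hu1 k).1.sub hf.1) (hf.1.sub (hu1 (k + 1)).1) le_rfl
      rw [sub_add_sub_cancel, eLpNorm_sub_comm (u k : E n → ℂ) f] at this
      rw [two_mul]
      refine this.trans (add_le_add (hu2 k) ((hu2 (k + 1)).trans ?_))
      have : (2⁻¹ : ℝ≥0∞) ^ (k + 1) ≤ 2⁻¹ ^ k := pow_le_pow_of_le_one zero_le (by simp) (by simp)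
      exact mul_le_mul' this this
    refine (ENNReal.mul_le_mul_iff_right hk0 hkt).1 (h1.trans ((mul_le_mul_right h2 _).trans_eq ?_))
    ring
  have htail : ∀ k, volume (⋃ i, bad (k + i)) ≤ 4 * W * 2⁻¹ ^ k := by
    intro k
    refine (measure_iUnion_le _).trans ((ENNReal.tsum_le_tsum fun i => hvol (k + i)).trans_eq ?_)
    simp only [pow_add, ← mul_assoc]
    rw [ENNReal.tsum_mul_left, ENNReal.tsum_geometric, ENNReal.one_sub_inv_two, inv_inv]
    ring
  have hlim : ∀ k, ∀ x ∉ ⋃ i, bad (k + i), ∃ L, Tendsto (fun j => s j x) atTop (𝓝 L) ∧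
      ‖L - s k x‖ₑ ≤ 8 * 2⁻¹ ^ k := by
    intro k x hx
    have h1 : ∀ i, edist (s (k + i) x) (s (k + (i + 1)) x) ≤ (4 * 2⁻¹ ^ k) / 2 ^ i := by
      intro i
      have : x ∉ bad (k + i) := fun h => hx (mem_iUnion.2 ⟨i, h⟩)
      rw [hbad, mem_ofPred_eq, not_lt] at this
      rw [edist_eq_enorm_sub]
      refine this.trans_eq ?_
      rw [pow_add, ← mul_assoc, div_eq_mul_inv, ENNReal.inv_pow]
    obtain ⟨L, hL⟩ := cauchySeq_tendsto_of_complete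
      (cauchySeq_of_edist_le_geometric_two (4 * 2⁻¹ ^ k) (by finiteness) h1)
    have h2 := edist_le_of_edist_le_geometric_two_of_tendsto₀ _ h1 hL
    refine ⟨L, ?_, ?_⟩
    · rw [← tendsto_add_atTop_iff_nat k]
      simpa only [add_comm k] using hL
    · rw [← edist_eq_enorm_sub, edist_comm]
      refine h2.trans_eq ?_
      ring
  set g : E n → ℂ := fun x => limUnder atTop fun j => s j x with hg
  have hg' : ∀ k, ∀ x ∉ ⋃ i, bad (k + i), Tendsto (fun j => s j x) atTop (𝓝 (g x)) ∧
      ‖g x - s k x‖ₑ ≤ 8 * 2⁻¹ ^ k := by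
    intro k x hx
    obtain ⟨L, hL, hL2⟩ := hlim k x hx
    have : g x = L := hL.limUnder_eq
    rw [this]
    exact ⟨hL, hL2⟩
  have hsmall : ∀ c : ℝ≥0∞, c ≠ ⊤ → Tendsto (fun k : ℕ => c * 2⁻¹ ^ k) atTop (𝓝 0) := by
    intro c hc
    simpa using ENNReal.Tendsto.const_mul (a := c)
      (ENNReal.tendsto_pow_atTop_nhds_zero_of_lt_one (r := 2⁻¹) (by simp)) (Or.inr hc)
  refine ⟨g, ?_, fun ε hε => ?_⟩
  · refine aestronglyMeasurable_of_tendsto_ae atTop (fun k => Lp.aestronglyMeasurable _)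
      (f := s) (g := g) ?_
    have h1 : volume (⋂ k, ⋃ i, bad (k + i)) = 0 := by
      refine le_antisymm (ge_of_tendsto' (hsmall (4 * W) (by finiteness)) fun k => ?_) zero_le
      exact (measure_mono (iInter_subset _ k)).trans (htail k)
    filter_upwards [measure_eq_zero_iff_ae_notMem.1 h1] with x hx
    rw [mem_iInter, not_forall] at hx
    obtain ⟨k, hk⟩ := hx
    exact (hg' k x hk).1
  · have hpos := pos_iff_ne_zero.2 hε
    obtain ⟨k, hk1, hk2, hk3⟩ := (((hsmall 1 (by simp)).eventually (Iic_mem_nhds hpos)).and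
      (((hsmall 8 (by simp)).eventually (Iic_mem_nhds hpos)).and
      ((hsmall (4 * W) (by finiteness)).eventually (Iic_mem_nhds hpos)))).exists
    refine ⟨u k, hu1 k, (hu2 k).trans (le_trans ?_ hk1), ?_⟩
    · exact mul_le_mul_left (pow_le_one₀ zero_le (by simp)) _
    · refine (measure_mono fun x hx => ?_).trans ((htail k).trans hk3)
      by_contra hcon
      exact absurd ((hg' k x hcon).2.trans hk2) (not_le.2 hx)

theorem exists_weak_type_extension (hn : 0 < n) (hκ : ∀ l, 0 < κ l) {m : E n → ℂ}
    (hm : IsMultiplier κ m) :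
    ∃ T : Lp ℂ 1 (volume : Measure (E n)) →ₗ[ℂ] (E n →ₘ[volume] ℂ),
      ExtendsL2Op m 1 T ∧
      ∃ C : ℝ≥0, ∀ (f : Lp ℂ 1 (volume : Measure (E n))) (t : ℝ), 0 < t →
        ENNReal.ofReal t * volume {x | t < ‖T f x‖} ≤ C * eLpNorm f 1 volume := by
  obtain ⟨W, hW⟩ := exists_weak_type_l2Op hn hκ hm
  obtain ⟨M, hM0, hb, hM⟩ := exists_bddMult hn hm
  have hW : HasWeakType m W := hW
  -- The choice of limit is arbitrary. Uniqueness makes the resulting map linear and compatible with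
  -- the operator on L².
  choose g hgm hg using fun f : Lp ℂ 1 (volume : Measure (E n)) =>
    exists_isWeakLimit hb hW (Lp.memLp f)
  have hlim : ∀ f : Lp ℂ 1 (volume : Measure (E n)),
      IsWeakLimit m f (AEEqFun.mk (g f) (hgm f)) := fun f =>
    (hg f).congr (ae_eq_refl _) (AEEqFun.coeFn_mk _ _).symm
  refine ⟨⟨⟨fun f => AEEqFun.mk (g f) (hgm f), fun f f' => ?_⟩, fun c f => ?_⟩, fun f u hfu => ?_,
    5 * W, fun f t ht => ?_⟩
  · refine AEEqFun.ext ?_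
    refine ((hlim (f + f')).unique hb hW (Lp.memLp _) ?_).trans (AEEqFun.coeFn_add _ _).symm
    exact ((hlim f).add hb (Lp.memLp f) (Lp.memLp f') (hlim f')).congr (Lp.coeFn_add f f').symm
      (ae_eq_refl _)
  · refine AEEqFun.ext ?_
    refine ((hlim (c • f)).unique hb hW (Lp.memLp _) ?_).trans (AEEqFun.coeFn_smul c _).symm
    exact ((hlim f).const_smul hb c).congr (Lp.coeFn_smul c f).symm (ae_eq_refl _)
  · refine (hlim f).unique hb hW (Lp.memLp f) ?_
    exact (isWeakLimit_self m u ((memLp_congr_ae hfu).1 (Lp.memLp f))).congr hfu.symm (ae_eq_refl _)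
  -- The weak type bound for limits is at level t + 4t, so it is applied with t/5, whence the
  -- constant 5W.
  · have h1 := (hlim f).weak_type hW (Lp.memLp f) (t := ENNReal.ofReal (t / 5)) (by simpa using ht)
      ENNReal.ofReal_ne_top
    have h5 : 5 * ENNReal.ofReal (t / 5) = ENNReal.ofReal t := by
      rw [show (5 : ℝ≥0∞) = ENNReal.ofReal 5 by simp, ← ENNReal.ofReal_mul (by norm_num)]
      congr 1
      ring
    rw [show ENNReal.ofReal (t / 5) + 4 * ENNReal.ofReal (t / 5) = 5 * ENNReal.ofReal (t / 5) by ring,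
      h5] at h1
    have h2 : {x | t < ‖(AEEqFun.mk (g f) (hgm f) : E n →ₘ[volume] ℂ) x‖} =
        {x | ENNReal.ofReal t < ‖(AEEqFun.mk (g f) (hgm f) : E n →ₘ[volume] ℂ) x‖ₑ} := by
      ext x
      rw [mem_ofPred_eq, mem_ofPred_eq, ← ofReal_norm, ENNReal.ofReal_lt_ofReal_iff_of_nonneg ht.le]
    change ENNReal.ofReal t * volume {x | t < ‖(AEEqFun.mk (g f) (hgm f) : E n →ₘ[volume] ℂ) x‖} ≤ _
    rw [h2, ← h5, mul_assoc, h5]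
    push_cast
    rw [mul_assoc]
    exact mul_le_mul_right h1 _

end AnisoMult

end

noncomputable section

namespace AnisoMult

variable {n : ℕ} {κ : Fin n → ℕ}

/-! ### Oscillation and the modulus bound -/

lemma osc_mono (f : E n → ℂ) : Monotone (osc κ f) := fun _ _ h =>
  iSup_mono fun _ => iSup_mono fun _ => iSup_mono' fun hxy => ⟨hxy.trans h, le_rfl⟩

lemma enorm_sub_le_osc (f : E n → ℂ) {x y : E n} {ρ : ℝ} (h : knorm κ (x - y) ≤ ρ) :
    ‖f x - f y‖ₑ ≤ osc κ f ρ :=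
  le_iSup_of_le x (le_iSup_of_le y (le_iSup_of_le h le_rfl))

/-- Joins y to x by N^|κ| equal steps with N = ⌊s⌋ + 1. Dividing a vector by N^|κ| divides its gauge
by at least N, so every step has gauge at most ρ. Hence ω grows at most polynomially. -/
lemma osc_mul_le (hκ : ∀ l, 0 < κ l) (f : E n → ℂ) {s ρ : ℝ} (hs : 0 ≤ s) (hρ : 0 ≤ ρ) :
    osc κ f (s * ρ) ≤ ENNReal.ofReal ((1 + s) ^ (∑ l, κ l)) * osc κ f ρ := by
  refine iSup_le fun x => iSup_le fun y => iSup_le fun hxy => ?_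
  set N : ℕ := ⌊s⌋₊ + 1 with hN
  have hN1 : (1 : ℝ) ≤ N := by rw [hN]; push_cast; linarith [Nat.cast_nonneg (α := ℝ) ⌊s⌋₊]
  have hN0 : (0 : ℝ) < N := by linarith
  have hsN : s ≤ N := by rw [hN]; push_cast; exact (Nat.lt_floor_add_one s).le
  have hNs : (N : ℝ) ≤ 1 + s := by rw [hN]; push_cast; linarith [Nat.floor_le hs]
  set d : E n := ((N : ℝ) ^ (∑ l, κ l))⁻¹ • (x - y) with hd
  have hdρ : knorm κ d ≤ ρ := by
    refine (knorm_inv_pow_smul_le hκ hN1 (x - y)).trans ?_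
    calc (N : ℝ)⁻¹ * knorm κ (x - y) ≤ (N : ℝ)⁻¹ * (N * ρ) :=
          mul_le_mul_of_nonneg_left (hxy.trans (mul_le_mul_of_nonneg_right hsN hρ)) (by positivity)
      _ = ρ := by field_simp
  have key : ∀ i : ℕ, ‖f (y + (i : ℝ) • d) - f y‖ₑ ≤ i * osc κ f ρ := by
    intro i
    induction i with
    | zero => simp
    | succ i ih =>
      have h1 : ‖f (y + ((i + 1 : ℕ) : ℝ) • d) - f (y + (i : ℝ) • d)‖ₑ ≤ osc κ f ρ := by
        refine enorm_sub_le_osc f ?_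
        have : y + ((i + 1 : ℕ) : ℝ) • d - (y + (i : ℝ) • d) = d := by
          push_cast
          rw [add_smul, one_smul]
          abel
        rwa [this]
      have h2 := enorm_add_le (f (y + ((i + 1 : ℕ) : ℝ) • d) - f (y + (i : ℝ) • d))
        (f (y + (i : ℝ) • d) - f y)
      rw [sub_add_sub_cancel] at h2
      refine h2.trans ((add_le_add h1 ih).trans_eq ?_)
      push_cast
      ring
  have h3 := key (N ^ (∑ l, κ l))
  have h4 : y + ((N ^ (∑ l, κ l) : ℕ) : ℝ) • d = x := by
    rw [hd, smul_smul]
    push_cast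
    rw [mul_inv_cancel₀ (by positivity), one_smul]
    abel
  rw [h4] at h3
  refine h3.trans (mul_le_mul_left ?_ _)
  rw [← ENNReal.ofReal_natCast]
  refine ENNReal.ofReal_le_ofReal ?_
  push_cast
  exact pow_le_pow_left₀ hN0.le hNs _

lemma enorm_sub_zero_le (hκ : ∀ l, 0 < κ l) (f : E n → ℂ) (x : E n) :
    ‖f x - f 0‖ₑ ≤ ENNReal.ofReal ((1 + knorm κ x) ^ (∑ l, κ l)) * osc κ f 1 := by
  refine le_trans (enorm_sub_le_osc (κ := κ) f (ρ := knorm κ x * 1) (by simp)) ?_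
  exact osc_mul_le hκ f (knorm_nonneg x) zero_le_one

lemma lintegral_Ioi_inv_sq {r : ℝ} (hr : 0 < r) :
    ∫⁻ ρ in Ioi r, (ENNReal.ofReal (ρ ^ 2))⁻¹ = (ENNReal.ofReal r)⁻¹ := by
  have h2 := integral_Ioi_rpow_of_lt (a := -2) (by norm_num) hr
  rw [← ENNReal.ofReal_inv_of_pos hr]
  have h3 : r⁻¹ = -r ^ ((-2 : ℝ) + 1) / (-2 + 1) := by
    rw [show (-2 : ℝ) + 1 = -1 by norm_num, Real.rpow_neg_one]
    ring
  rw [h3, ← h2, ofReal_integral_eq_lintegral_ofReal (integrableOn_Ioi_rpow_of_lt (by norm_num) hr)]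
  · refine setLIntegral_congr_fun measurableSet_Ioi fun ρ hρ => ?_
    have hρ0 : 0 < ρ := hr.trans hρ
    rw [← ENNReal.ofReal_inv_of_pos (by positivity), Real.rpow_neg hρ0.le, Real.rpow_two]
  · filter_upwards [ae_restrict_mem measurableSet_Ioi] with ρ hρ
    exact Real.rpow_nonneg (hr.trans hρ).le _

/-- ω is nondecreasing and ∫_r^∞ ρ⁻² dρ = 1/r. Through this the tail hypothesis shows that ω is
finite and tends to 0 at 0, so f is continuous. -/
lemma osc_le_tail (f : E n → ℂ) {r : ℝ} (hr : 0 < r) : osc κ f r ≤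
    ENNReal.ofReal r * ∫⁻ ρ in Ioi r, osc κ f ρ / ENNReal.ofReal (ρ ^ 2) := by
  have h1 : osc κ f r * (ENNReal.ofReal r)⁻¹ ≤
      ∫⁻ ρ in Ioi r, osc κ f ρ / ENNReal.ofReal (ρ ^ 2) := by
    have hm : Measurable fun ρ : ℝ => (ENNReal.ofReal (ρ ^ 2))⁻¹ := by fun_prop
    rw [← lintegral_Ioi_inv_sq hr, ← lintegral_const_mul _ hm]
    refine setLIntegral_mono' measurableSet_Ioi fun ρ hρ => ?_
    rw [div_eq_mul_inv]
    exact mul_le_mul_left (osc_mono f (le_of_lt hρ)) _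
  refine le_trans (le_of_eq ?_) (mul_le_mul_right h1 _)
  rw [mul_comm, mul_assoc, ENNReal.inv_mul_cancel (ENNReal.ofReal_pos.2 hr).ne'
    ENNReal.ofReal_ne_top, mul_one]

variable {f : E n → ℂ}

lemma DiniCondition.tail_lt_top (hf : DiniCondition κ f) {r : ℝ} (hr : 0 < r) :
    ∫⁻ ρ in Ioi r, osc κ f ρ / ENNReal.ofReal (ρ ^ 2) < ⊤ := by
  have h1 := hf.2.eventually (gt_mem_nhds one_pos)
  obtain ⟨s, hs, hs0, hsr⟩ := (h1.and (Ioo_mem_nhdsGT hr)).exists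
  refine lt_of_le_of_lt (lintegral_mono_set (Ioi_subset_Ioi hsr.le)) ?_
  by_contra hcon
  rw [not_lt, top_le_iff] at hcon
  rw [hcon, ENNReal.mul_top (ENNReal.ofReal_pos.2 hs0).ne'] at hs
  simp at hs

lemma DiniCondition.osc_lt_top (hf : DiniCondition κ f) (r : ℝ) : osc κ f r < ⊤ := by
  refine (osc_mono f (le_max_left r 1)).trans_lt ((osc_le_tail f (by positivity)).trans_lt ?_)
  exact ENNReal.mul_lt_top ENNReal.ofReal_lt_top (hf.tail_lt_top (by positivity))

lemma DiniCondition.tendsto_osc (hf : DiniCondition κ f) :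
    Tendsto (osc κ f) (𝓝[>] 0) (𝓝 0) := by
  refine tendsto_of_tendsto_of_tendsto_of_le_of_le' tendsto_const_nhds hf.2
    (Eventually.of_forall fun _ => zero_le) ?_
  filter_upwards [self_mem_nhdsWithin] with r hr
  exact osc_le_tail f hr

lemma tendsto_knorm_sub (hκ : ∀ l, 0 < κ l) (x : E n) :
    Tendsto (fun y => knorm κ (y - x)) (𝓝 x) (𝓝 0) := by
  have : Continuous fun y => knorm κ (y - x) := (continuous_knorm κ).comp (continuous_sub_right x)
  simpa [knorm_zero hκ] using this.tendsto x

lemma DiniCondition.continuous (hκ : ∀ l, 0 < κ l) (hf : DiniCondition κ f) : Continuous f := by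
  rw [continuous_iff_continuousAt]
  intro x
  rw [ContinuousAt, tendsto_iff_edist_tendsto_0, ENNReal.tendsto_nhds_zero]
  intro ε hε
  obtain ⟨r, hr, hr0⟩ := (((ENNReal.tendsto_nhds_zero.1 hf.tendsto_osc) ε hε).and
    self_mem_nhdsWithin).exists
  filter_upwards [(tendsto_knorm_sub hκ x).eventually (Iic_mem_nhds hr0)] with y hy
  rw [edist_eq_enorm_sub]
  exact (enorm_sub_le_osc f hy).trans hr

/-- The integrand of the modulus bound. -/
def modInt (κ : Fin n → ℕ) (f : E n → ℂ) (r ρ : ℝ) : ℝ≥0∞ :=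
  osc κ f ρ * ENNReal.ofReal (min ρ⁻¹ (r / ρ ^ 2))

lemma lintegral_Ioi_eq_add {a : ℝ} (ha : 0 < a) (F : ℝ → ℝ≥0∞) :
    ∫⁻ ρ in Ioi 0, F ρ = (∫⁻ ρ in Ioo 0 a, F ρ) + ∫⁻ ρ in Ioi a, F ρ := by
  rw [← Ioc_union_Ioi_eq_Ioi ha.le, lintegral_union measurableSet_Ioi, setLIntegral_congr Ioo_ae_eq_Ioc]
  exact disjoint_left.2 fun x hx hx' => absurd hx.2 (not_le.2 hx')

lemma modInt_le_left (f : E n → ℂ) (r : ℝ) {ρ : ℝ} (hρ : 0 < ρ) :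
    modInt κ f r ρ ≤ osc κ f ρ / ENNReal.ofReal ρ := by
  rw [modInt, div_eq_mul_inv (osc κ f ρ), ← ENNReal.ofReal_inv_of_pos hρ]
  exact mul_le_mul_right (ENNReal.ofReal_le_ofReal (min_le_left _ _)) _

lemma mul_osc_div (f : E n → ℂ) {r ρ : ℝ} (hr : 0 ≤ r) (hρ : 0 < ρ) :
    ENNReal.ofReal r * (osc κ f ρ / ENNReal.ofReal (ρ ^ 2)) =
      osc κ f ρ * ENNReal.ofReal (r / ρ ^ 2) := by
  rw [div_eq_mul_inv, ← ENNReal.ofReal_inv_of_pos (by positivity), div_eq_mul_inv,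
    ENNReal.ofReal_mul hr]
  ring

lemma modInt_le_right (f : E n → ℂ) {r ρ : ℝ} (hr : 0 ≤ r) (hρ : 0 < ρ) :
    modInt κ f r ρ ≤ ENNReal.ofReal r * (osc κ f ρ / ENNReal.ofReal (ρ ^ 2)) := by
  rw [mul_osc_div f hr hρ]
  exact mul_le_mul_right (ENNReal.ofReal_le_ofReal (min_le_right _ _)) _

/-- The branches of min(1/ρ, r/ρ²) cross at ρ = r. In this form the bound can be split at any point
a, and not only at r. -/
lemma modulusBound_eq (f : E n → ℂ) {r : ℝ} (hr : 0 < r) :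
    modulusBound κ f r = ∫⁻ ρ in Ioi 0, modInt κ f r ρ := by
  rw [lintegral_Ioi_eq_add hr, modulusBound]
  congr 1
  · refine setLIntegral_congr_fun measurableSet_Ioo fun ρ hρ => ?_
    have h0 : 0 < ρ := hρ.1
    simp only [modInt]
    rw [min_eq_left, div_eq_mul_inv, ← ENNReal.ofReal_inv_of_pos h0]
    rw [le_div_iff₀ (by positivity), pow_two, inv_mul_cancel_left₀ h0.ne']
    exact hρ.2.le
  · rw [← lintegral_const_mul' _ _ ENNReal.ofReal_ne_top]
    refine setLIntegral_congr_fun measurableSet_Ioi fun ρ hρ => ?_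
    have h0 : 0 < ρ := hr.trans hρ
    simp only [modInt]
    rw [min_eq_right, mul_osc_div f hr.le h0]
    rw [div_le_iff₀ (by positivity), pow_two, inv_mul_cancel_left₀ h0.ne']
    exact le_of_lt hρ

lemma modulusBound_zero (f : E n → ℂ) : modulusBound κ f 0 = 0 := by simp [modulusBound]

lemma modulusBound_le (f : E n → ℂ) {a r : ℝ} (ha : 0 < a) (hr : 0 ≤ r) : modulusBound κ f r ≤
    (∫⁻ ρ in Ioo 0 a, osc κ f ρ / ENNReal.ofReal ρ) +
      ENNReal.ofReal r * ∫⁻ ρ in Ioi a, osc κ f ρ / ENNReal.ofReal (ρ ^ 2) := by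
  rcases hr.eq_or_lt with rfl | hr
  · simp [modulusBound_zero]
  rw [modulusBound_eq f hr, lintegral_Ioi_eq_add ha, ← lintegral_const_mul' _ _ ENNReal.ofReal_ne_top]
  refine add_le_add (setLIntegral_mono' measurableSet_Ioo fun ρ hρ => modInt_le_left f r hρ.1)
    (setLIntegral_mono' measurableSet_Ioi fun ρ hρ => modInt_le_right f hr.le (ha.trans hρ))

/-- With i = −j, the term is compared with an integral over (2^i, 2^(i+1)), where ω(2^i) ≤ ω(ρ) and
2^-i ≤ 2/ρ. The factor 2 is used at most twice, whence 4. -/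
lemma tsum_osc_le (f : E n → ℂ) {r : ℝ} (hr : 0 ≤ r) :
    ∑' j : ℤ, osc κ f ((2 : ℝ) ^ (-j)) * ENNReal.ofReal (min 1 ((2 : ℝ) ^ j * r)) ≤
      4 * modulusBound κ f r := by
  rcases hr.eq_or_lt with rfl | hr
  · simp
  rw [← (Equiv.neg ℤ).tsum_eq]
  simp only [Equiv.neg_apply, neg_neg]
  have h1 : ∀ i : ℤ, osc κ f ((2 : ℝ) ^ i) * ENNReal.ofReal (min 1 ((2 : ℝ) ^ (-i) * r)) ≤
      4 * ∫⁻ ρ in Ioo ((2 : ℝ) ^ i) ((2 : ℝ) ^ (i + 1)), modInt κ f r ρ := by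
    intro i
    have h2i : (0 : ℝ) < 2 ^ i := by positivity
    have h2i1 : (2 : ℝ) ^ (i + 1) = 2 * 2 ^ i := by rw [zpow_add_one₀ two_ne_zero]; ring
    rw [← lintegral_const_mul' _ _ (by norm_num)]
    have h3 : ∀ ρ ∈ Ioo ((2 : ℝ) ^ i) ((2 : ℝ) ^ (i + 1)),
        osc κ f ((2 : ℝ) ^ i) * ENNReal.ofReal (min 1 ((2 : ℝ) ^ (-i) * r)) *
          ENNReal.ofReal ((2 : ℝ) ^ (-i)) ≤ 4 * modInt κ f r ρ := by
      intro ρ hρ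
      have hρ0 : 0 < ρ := h2i.trans hρ.1
      rw [modInt, mul_assoc, mul_left_comm 4, ← ENNReal.ofReal_mul (by positivity),
        show (4 : ℝ≥0∞) = ENNReal.ofReal 4 by simp, ← ENNReal.ofReal_mul (by norm_num)]
      refine mul_le_mul' (osc_mono f hρ.1.le) (ENNReal.ofReal_le_ofReal ?_)
      have h4 : (2 : ℝ) ^ (-i) ≤ 2 * ρ⁻¹ := by
        rw [zpow_neg, ← div_eq_mul_inv, le_div_iff₀ hρ0, inv_mul_le_iff₀ h2i]
        linarith [hρ.2]
      have h40 : (0 : ℝ) < 2 ^ (-i) := by positivity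
      rw [mul_min_of_nonneg _ _ (by norm_num : (0 : ℝ) ≤ 4), le_min_iff]
      have hρi : 0 < ρ⁻¹ := by positivity
      constructor
      · calc min 1 ((2 : ℝ) ^ (-i) * r) * 2 ^ (-i) ≤ 1 * (2 * ρ⁻¹) :=
              mul_le_mul (min_le_left _ _) h4 h40.le zero_le_one
          _ ≤ _ := by linarith
      · calc min 1 ((2 : ℝ) ^ (-i) * r) * 2 ^ (-i) ≤ (2 * ρ⁻¹ * r) * (2 * ρ⁻¹) :=
              mul_le_mul ((min_le_right _ _).trans (mul_le_mul_of_nonneg_right h4 hr.le)) h4 h40.le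
                (by positivity)
          _ = _ := by field_simp; ring
    refine le_trans (le_of_eq ?_) (setLIntegral_mono' measurableSet_Ioo h3)
    rw [setLIntegral_const, Real.volume_Ioo, h2i1, mul_assoc, ← ENNReal.ofReal_mul (by positivity)]
    have : (2 : ℝ) ^ (-i) * (2 * 2 ^ i - 2 ^ i) = 1 := by
      rw [zpow_neg]; field_simp; ring
    rw [this, ENNReal.ofReal_one, mul_one]
  refine (ENNReal.tsum_le_tsum h1).trans ?_
  rw [ENNReal.tsum_mul_left, modulusBound_eq f hr]
  refine mul_le_mul_right ?_ _
  have hdis : Pairwise (Function.onFun Disjoint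
      fun i : ℤ => Ioo ((2 : ℝ) ^ i) ((2 : ℝ) ^ (i + 1))) := by
    refine (pairwise_disjoint_on _).2 fun i j hij => disjoint_left.2 fun x hx hx' => ?_
    have : (2 : ℝ) ^ (i + 1) ≤ 2 ^ j := zpow_le_zpow_right₀ one_le_two (by omega)
    exact absurd (hx.2.trans_le this) (not_lt.2 hx'.1.le)
  rw [← lintegral_iUnion (s := fun i : ℤ => Ioo ((2 : ℝ) ^ i) ((2 : ℝ) ^ (i + 1)))
    (fun i => measurableSet_Ioo) hdis]
  refine lintegral_mono_set (iUnion_subset fun i ρ hρ => ?_)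
  exact lt_trans (by positivity) hρ.1

lemma DiniCondition.head_lt_top (hf : DiniCondition κ f) (a : ℝ) :
    ∫⁻ ρ in Ioo 0 a, osc κ f ρ / ENNReal.ofReal ρ < ⊤ := by
  obtain ⟨δ, hδ, hδ'⟩ := hf.1
  refine lt_of_le_of_lt (lintegral_mono_set (Ioo_subset_Ioo_right (le_max_left a 0))) ?_
  refine lt_of_le_of_lt le_self_add
    (lt_of_le_of_lt (modulusBound_le f hδ (le_max_right a 0)) (ENNReal.add_lt_top.2 ⟨hδ', ?_⟩))
  exact ENNReal.mul_lt_top ENNReal.ofReal_lt_top (hf.tail_lt_top hδ)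

lemma DiniCondition.modulusBound_lt_top (hf : DiniCondition κ f) {r : ℝ} (hr : 0 ≤ r) :
    modulusBound κ f r < ⊤ := by
  refine (modulusBound_le f one_pos hr).trans_lt (ENNReal.add_lt_top.2 ⟨hf.head_lt_top 1, ?_⟩)
  exact ENNReal.mul_lt_top ENNReal.ofReal_lt_top (hf.tail_lt_top one_pos)

lemma DiniCondition.tendsto_modulusBound (hf : DiniCondition κ f) :
    Tendsto (modulusBound κ f) (𝓝[≥] 0) (𝓝 0) := by
  rw [ENNReal.tendsto_nhds_zero]
  intro ε hε
  have hε2 : 0 < ε / 2 := ENNReal.half_pos hε.ne'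
  have h1 : ∃ a : ℝ, 0 < a ∧ ∫⁻ ρ in Ioo 0 a, osc κ f ρ / ENNReal.ofReal ρ ≤ ε / 2 := by
    have h2 : Tendsto (fun k : ℕ => ∫⁻ ρ in Ioo 0 (1 / ((k : ℝ) + 1)), osc κ f ρ / ENNReal.ofReal ρ
        ∂(volume.restrict (Ioo 0 1))) atTop (𝓝 0) := by
      refine tendsto_setLIntegral_zero (hf.head_lt_top 1).ne ?_
      have h3 : Tendsto (fun k : ℕ => ENNReal.ofReal (1 / ((k : ℝ) + 1))) atTop (𝓝 0) := by
        rw [← ENNReal.ofReal_zero]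
        exact ENNReal.tendsto_ofReal tendsto_one_div_add_atTop_nhds_zero_nat
      refine tendsto_of_tendsto_of_tendsto_of_le_of_le tendsto_const_nhds h3 (fun _ => zero_le)
        fun k => ?_
      refine (Measure.restrict_apply_le _ _).trans_eq ?_
      rw [Real.volume_Ioo, sub_zero]
    obtain ⟨k, hk⟩ := (h2.eventually (Iic_mem_nhds hε2)).exists
    refine ⟨1 / ((k : ℝ) + 1), by positivity, ?_⟩
    rw [Measure.restrict_restrict measurableSet_Ioo, inter_eq_left.2] at hk
    · exact hk
    · refine Ioo_subset_Ioo_right ?_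
      rw [div_le_one (by positivity)]
      linarith [Nat.cast_nonneg (α := ℝ) k]
  obtain ⟨a, ha, ha'⟩ := h1
  have h4 : Tendsto (fun r : ℝ => ENNReal.ofReal r *
      ∫⁻ ρ in Ioi a, osc κ f ρ / ENNReal.ofReal (ρ ^ 2)) (𝓝[≥] 0) (𝓝 0) := by
    have h5 : Tendsto (fun r : ℝ => ENNReal.ofReal r) (𝓝[≥] 0) (𝓝 0) := by
      rw [← ENNReal.ofReal_zero]
      exact (ENNReal.continuous_ofReal.tendsto 0).mono_left nhdsWithin_le_nhds
    simpa using ENNReal.Tendsto.mul_const h5 (Or.inr (hf.tail_lt_top ha).ne)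
  filter_upwards [h4.eventually (Iic_mem_nhds hε2), self_mem_nhdsWithin] with r hr hr0
  refine (modulusBound_le f ha hr0).trans ((add_le_add ha' hr).trans_eq (ENNReal.add_halves ε))

/-- Splitting at a large k makes the tail integral at most ε. So the modulus is o(r) at infinity,
which yields polynomial growth and later drives the Liouville argument. -/
lemma DiniCondition.exists_modulusBound_le (hf : DiniCondition κ f) {ε : ℝ≥0∞} (hε : 0 < ε) :
    ∃ A : ℝ≥0, ∀ r, 0 ≤ r → modulusBound κ f r ≤ A + ENNReal.ofReal r * ε := by
  have h1 : Tendsto (fun k : ℕ => ∫⁻ ρ in Ioi (1 : ℝ), (Ioi (k : ℝ)).indicator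
      (fun ρ => osc κ f ρ / ENNReal.ofReal (ρ ^ 2)) ρ) atTop (𝓝 (∫⁻ _ in Ioi (1 : ℝ), 0)) := by
    have hm : Measurable fun ρ : ℝ => osc κ f ρ / ENNReal.ofReal (ρ ^ 2) :=
      (osc_mono f).measurable.div (by fun_prop)
    refine tendsto_lintegral_of_dominated_convergence
      (fun ρ => osc κ f ρ / ENNReal.ofReal (ρ ^ 2)) (fun k => hm.indicator measurableSet_Ioi)
      (fun k => Eventually.of_forall fun ρ => indicator_le_self _ _ ρ)
      (hf.tail_lt_top one_pos).ne (Eventually.of_forall fun ρ => ?_)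
    refine tendsto_const_nhds.congr' ?_
    filter_upwards [eventually_ge_atTop ⌈ρ⌉₊] with k hk
    rw [indicator_of_notMem]
    rw [notMem_Ioi]
    exact (Nat.le_ceil ρ).trans (by exact_mod_cast hk)
  rw [lintegral_zero] at h1
  obtain ⟨k, hk, hk1⟩ := ((h1.eventually (Iic_mem_nhds hε)).and (eventually_ge_atTop 1)).exists
  have hk1 : (1 : ℝ) ≤ k := by exact_mod_cast hk1
  rw [setLIntegral_indicator measurableSet_Ioi, inter_eq_left.2 (Ioi_subset_Ioi hk1)] at hk
  refine ⟨(∫⁻ ρ in Ioo 0 (k : ℝ), osc κ f ρ / ENNReal.ofReal ρ).toNNReal, fun r hr => ?_⟩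
  rw [ENNReal.coe_toNNReal (hf.head_lt_top _).ne]
  exact (modulusBound_le f (by linarith) hr).trans (add_le_add le_rfl (mul_le_mul_right hk _))

end AnisoMult

end

noncomputable section

namespace AnisoMult

variable {n : ℕ} {κ : Fin n → ℕ}

/-! ### Functions of polynomial growth as tempered distributions -/

/-- Continuous functions of polynomial growth. -/
structure PolyGrowth (g : E n → ℂ) : Prop where
  continuous : Continuous g
  growth : ∃ (A : ℝ) (N : ℕ), ∀ x, ‖g x‖ ≤ A * (1 + ‖x‖) ^ N

lemma PolyGrowth.exists_nonneg {g : E n → ℂ} (hg : PolyGrowth g) :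
    ∃ (A : ℝ) (N : ℕ), 0 ≤ A ∧ ∀ x, ‖g x‖ ≤ A * (1 + ‖x‖) ^ N := by
  obtain ⟨A, N, h⟩ := hg.growth
  refine ⟨|A|, N, abs_nonneg A, fun x => (h x).trans ?_⟩
  exact mul_le_mul_of_nonneg_right (le_abs_self A) (by positivity)

lemma PolyGrowth.add {f g : E n → ℂ} (hf : PolyGrowth f) (hg : PolyGrowth g) :
    PolyGrowth fun x => f x + g x := by
  refine ⟨hf.continuous.add hg.continuous, ?_⟩
  obtain ⟨A, N, hA, h⟩ := hf.exists_nonneg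
  obtain ⟨B, M, hB, h'⟩ := hg.exists_nonneg
  refine ⟨A + B, N + M, fun x => (norm_add_le _ _).trans ?_⟩
  have h1 : (1 : ℝ) ≤ 1 + ‖x‖ := by linarith [norm_nonneg x]
  rw [add_mul]
  refine add_le_add ((h x).trans ?_) ((h' x).trans ?_)
  · exact mul_le_mul_of_nonneg_left (pow_le_pow_right₀ h1 (by omega)) hA
  · exact mul_le_mul_of_nonneg_left (pow_le_pow_right₀ h1 (by omega)) hB

lemma polyGrowth_const (c : ℂ) : PolyGrowth (n := n) fun _ => c :=
  ⟨continuous_const, ‖c‖, 0, fun x => by simp⟩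

lemma one_add_norm_sub_pow_le (x z : E n) (N : ℕ) :
    (1 + ‖x - z‖) ^ N ≤ (1 + ‖x‖) ^ N * (1 + ‖z‖) ^ N := by
  rw [← mul_pow]
  refine pow_le_pow_left₀ (by positivity) ?_ N
  nlinarith [norm_sub_le x z, norm_nonneg x, norm_nonneg z]

lemma PolyGrowth.comp_sub {g : E n → ℂ} (hg : PolyGrowth g) (x : E n) :
    PolyGrowth fun z => g (x - z) := by
  obtain ⟨A, N, hA, h⟩ := hg.exists_nonneg
  refine ⟨hg.continuous.comp (continuous_const.sub continuous_id), A * (1 + ‖x‖) ^ N, N,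
    fun z => (h _).trans ?_⟩
  rw [mul_assoc]
  exact mul_le_mul_of_nonneg_left (one_add_norm_sub_pow_le x z N) hA

lemma integrable_inv_one_add_norm_pow : Integrable fun x : E n => ((1 + ‖x‖) ^ (n + 1))⁻¹ := by
  have h := integrable_one_add_norm (E := E n) (μ := volume) (r := n + 1) (by simp)
  refine h.congr (Eventually.of_forall fun x => ?_)
  simp only
  rw [Real.rpow_neg (by positivity)]
  norm_cast

lemma norm_mul_le_of_growth {g : E n → ℂ} {A : ℝ} (hA : 0 ≤ A) {N : ℕ}
    (h : ∀ x, ‖g x‖ ≤ A * (1 + ‖x‖) ^ N) (φ : 𝓢(E n, ℂ)) (x : E n) :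
    ‖φ x * g x‖ ≤ A * (2 ^ (N + (n + 1)) * ((Finset.Iic (N + (n + 1), 0)).sup
      (fun m => SchwartzMap.seminorm ℂ m.1 m.2)) φ) * ((1 + ‖x‖) ^ (n + 1))⁻¹ := by
  have h1 := SchwartzMap.one_add_le_sup_seminorm_apply (𝕜 := ℂ) (m := (N + (n + 1), 0))
    (k := N + (n + 1)) (n := 0) le_rfl le_rfl φ x
  rw [norm_iteratedFDeriv_zero, pow_add] at h1
  have h2 : (0 : ℝ) < (1 + ‖x‖) ^ (n + 1) := by positivity
  rw [← div_eq_mul_inv, le_div_iff₀ h2, norm_mul]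
  calc ‖φ x‖ * ‖g x‖ * (1 + ‖x‖) ^ (n + 1)
      ≤ ‖φ x‖ * (A * (1 + ‖x‖) ^ N) * (1 + ‖x‖) ^ (n + 1) := by gcongr; exact h x
    _ = A * ((1 + ‖x‖) ^ N * (1 + ‖x‖) ^ (n + 1) * ‖φ x‖) := by ring
    _ ≤ _ := mul_le_mul_of_nonneg_left h1 hA

lemma PolyGrowth.integrable_mul {g : E n → ℂ} (hg : PolyGrowth g) (φ : 𝓢(E n, ℂ)) :
    Integrable fun x => φ x * g x := by
  obtain ⟨A, N, hA, h⟩ := hg.exists_nonneg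
  exact (integrable_inv_one_add_norm_pow.const_mul _).mono'
    (φ.continuous.mul hg.continuous).aestronglyMeasurable
    (Eventually.of_forall fun x => norm_mul_le_of_growth hA h φ x)

lemma PolyGrowth.exists_dist {g : E n → ℂ} (hg : PolyGrowth g) :
    ∃ u : 𝓢'(E n, ℂ), ContinuousRep u g := by
  obtain ⟨A, N, hA, h⟩ := hg.exists_nonneg
  let u : 𝓢(E n, ℂ) →L[ℂ] ℂ := SchwartzMap.mkCLMtoNormedSpace (σ := RingHom.id ℂ)
    (fun φ => ∫ x, φ x * g x)
    (fun φ ψ => by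
      rw [← integral_add (hg.integrable_mul φ) (hg.integrable_mul ψ)]
      simp [add_mul])
    (fun c φ => by
      rw [RingHom.id_apply, smul_eq_mul, ← integral_const_mul]
      simp [mul_assoc])
    ⟨Finset.Iic (N + (n + 1), 0),
      A * 2 ^ (N + (n + 1)) * ∫ x : E n, ((1 + ‖x‖) ^ (n + 1))⁻¹, by
        have : 0 ≤ ∫ x : E n, ((1 + ‖x‖) ^ (n + 1))⁻¹ := integral_nonneg fun x => by positivity
        positivity, fun φ => by
        refine (norm_integral_le_of_norm_le (integrable_inv_one_add_norm_pow.const_mul _)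
          (Eventually.of_forall fun x => norm_mul_le_of_growth hA h φ x)).trans (le_of_eq ?_)
        rw [integral_const_mul]
        change _ = _ * ((Finset.Iic (N + (n + 1), 0)).sup
          (fun m => SchwartzMap.seminorm ℂ m.1 m.2)) φ
        ring⟩
  exact ⟨ContinuousLinearMap.toPointwiseConvergenceCLM _ _ _ _ u, hg.continuous, hg.growth, fun φ =>
    ⟨hg.integrable_mul φ, rfl⟩⟩

lemma integrable_cv_of_growth (K : 𝓢(E n, ℂ)) {g : E n → ℂ} (hg : PolyGrowth g) (x : E n) :
    Integrable fun y => K (x - y) * g y := by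
  have h := ((hg.comp_sub x).integrable_mul K).comp_sub_left x
  simpa using h

/-- The Fourier transform turns convolution with `𝓕⁻ ψ` into multiplication by `ψ`. -/
lemma integral_fourier_mul_cv (ψ φ : 𝓢(E n, ℂ)) {f : E n → ℂ} (hf : PolyGrowth f) :
    ∫ x, (𝓕 φ : 𝓢(E n, ℂ)) x * cv (𝓕⁻ ψ : 𝓢(E n, ℂ)) f x =
      ∫ z, (𝓕 (SchwartzMap.pairing (ContinuousLinearMap.mul ℂ ℂ) ψ φ) : 𝓢(E n, ℂ)) z * f z := by
  set H : 𝓢(E n, ℂ) := 𝓕 φ with hH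
  set K : 𝓢(E n, ℂ) := 𝓕⁻ ψ with hK
  obtain ⟨A, N, hA, h⟩ := hf.exists_nonneg
  have hN : PolyGrowth fun x : E n => (((1 + ‖x‖) ^ N : ℝ) : ℂ) := by
    refine ⟨by fun_prop, 1, N, fun x => ?_⟩
    rw [Complex.norm_real, one_mul, Real.norm_of_nonneg (by positivity)]
  have hintK : Integrable fun w => ‖K w‖ * (1 + ‖w‖) ^ N := by
    refine (hN.integrable_mul K).norm.congr (Eventually.of_forall fun x => ?_)
    simp only
    rw [norm_mul, Complex.norm_real, Real.norm_of_nonneg (by positivity)]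
  have hintH : Integrable fun w => ‖H w‖ * (1 + ‖w‖) ^ N := by
    refine (hN.integrable_mul H).norm.congr (Eventually.of_forall fun x => ?_)
    simp only
    rw [norm_mul, Complex.norm_real, Real.norm_of_nonneg (by positivity)]
  have hc : Continuous (Function.uncurry fun x z => H x * (K (x - z) * f z)) := by
    have h1 := H.continuous
    have h2 := K.continuous
    have h3 := hf.continuous
    fun_prop
  have hint : Integrable (Function.uncurry fun x z => H x * (K (x - z) * f z))
      ((volume : Measure (E n)).prod volume) := by
    rw [integrable_prod_iff hc.aestronglyMeasurable]
    refine ⟨Eventually.of_forall fun x => (integrable_cv_of_growth K hf x).const_mul (H x), ?_⟩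
    refine (hintH.const_mul (A * ∫ w, ‖K w‖ * (1 + ‖w‖) ^ N)).mono'
      (hc.norm.aestronglyMeasurable.integral_prod_right')
      (Eventually.of_forall fun x => ?_)
    rw [Real.norm_of_nonneg (integral_nonneg fun z => norm_nonneg _)]
    simp only [Function.uncurry_apply_pair, norm_mul]
    have hin : ∫ z, ‖K (x - z)‖ * ‖f z‖ ≤
        (A * (1 + ‖x‖) ^ N) * ∫ w, ‖K w‖ * (1 + ‖w‖) ^ N := by
      rw [← integral_sub_left_eq_self _ volume x]
      simp only [sub_sub_cancel]
      rw [← integral_const_mul]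
      refine integral_mono ?_ (hintK.const_mul _) fun z => ?_
      · have := ((hf.comp_sub x).integrable_mul K).norm
        simpa only [norm_mul] using this
      · simp only
        calc ‖K z‖ * ‖f (x - z)‖ ≤ ‖K z‖ * (A * ((1 + ‖x‖) ^ N * (1 + ‖z‖) ^ N)) := by
              refine mul_le_mul_of_nonneg_left ((h _).trans ?_) (norm_nonneg _)
              exact mul_le_mul_of_nonneg_left (one_add_norm_sub_pow_le x z N) hA
          _ = _ := by ring
    rw [integral_const_mul]
    refine (mul_le_mul_of_nonneg_left hin (norm_nonneg _)).trans (le_of_eq ?_)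
    ring
  -- For fixed z the x-integral is, after reflection, the convolution theorem for 𝓕⁻ψ and 𝓕⁻φ.
  have hker : ∀ z, ∫ x, H x * K (x - z) =
      (𝓕 (SchwartzMap.pairing (ContinuousLinearMap.mul ℂ ℂ) ψ φ) : 𝓢(E n, ℂ)) z := by
    intro z
    have h1 := cv_fourierInv_schwartz ψ (𝓕⁻ φ : 𝓢(E n, ℂ)) (-z)
    have h0 : 𝓕 (𝓕⁻ φ : 𝓢(E n, ℂ)) = φ := FourierTransform.fourier_fourierInv_eq φ
    rw [h0] at h1
    have h2 : ∀ (g : 𝓢(E n, ℂ)) (w : E n), (𝓕⁻ g : 𝓢(E n, ℂ)) (-w) = (𝓕 g : 𝓢(E n, ℂ)) w := by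
      intro g w
      rw [SchwartzMap.fourierInv_coe, SchwartzMap.fourier_coe, Real.fourierInv_eq_fourier_neg, neg_neg]
    rw [h2] at h1
    rw [← h1, cv, ← integral_neg_eq_self]
    refine integral_congr_ae (Eventually.of_forall fun x => ?_)
    simp only
    rw [show -z - x = -x - z by abel, ← neg_neg x, h2, neg_neg, mul_comm]
  calc ∫ x, H x * cv K f x = ∫ x, ∫ z, H x * (K (x - z) * f z) := by
        refine integral_congr_ae (Eventually.of_forall fun x => ?_)
        simp only [cv]
        rw [integral_const_mul]
    _ = ∫ z, ∫ x, H x * (K (x - z) * f z) := integral_integral_swap hint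
    _ = _ := by
        refine integral_congr_ae (Eventually.of_forall fun z => ?_)
        simp only
        rw [← hker, ← integral_mul_const]
        refine integral_congr_ae (Eventually.of_forall fun x => ?_)
        simp only
        ring

end AnisoMult

end

noncomputable section

namespace AnisoMult

variable {n : ℕ} {κ : Fin n → ℕ}

/-! ### The Littlewood–Paley pieces of a function with Dini modulus -/

lemma DiniCondition.polyGrowth (hκ : ∀ l, 0 < κ l) {f : E n → ℂ} (hf : DiniCondition κ f) :
    PolyGrowth f := by
  refine ⟨hf.continuous hκ, ?_⟩
  set S := ∑ l, κ l with hS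
  set W := (osc κ f 1).toReal with hW
  have hW0 : 0 ≤ W := ENNReal.toReal_nonneg
  refine ⟨‖f 0‖ + (n + 1) ^ S * W, S, fun x => ?_⟩
  have h1 := enorm_sub_zero_le hκ f x
  rw [← ENNReal.ofReal_toReal (hf.osc_lt_top 1).ne, ← ENNReal.ofReal_mul
    (by have := knorm_nonneg (κ := κ) x; positivity), ← ofReal_norm,
    ENNReal.ofReal_le_ofReal_iff (by have := knorm_nonneg (κ := κ) x; positivity)] at h1
  have h2 : (1 + knorm κ x) ^ S ≤ (n + 1) ^ S * (1 + ‖x‖) ^ S := by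
    rw [← mul_pow]
    refine pow_le_pow_left₀ (by have := knorm_nonneg (κ := κ) x; positivity) ?_ S
    have := knorm_le_norm hκ x
    nlinarith [norm_nonneg x]
  have h3 : (1 : ℝ) ≤ (1 + ‖x‖) ^ S := one_le_pow₀ (by linarith [norm_nonneg x])
  calc ‖f x‖ ≤ ‖f 0‖ + ‖f x - f 0‖ := by
        simpa using norm_add_le (f 0) (f x - f 0)
    _ ≤ ‖f 0‖ * (1 + ‖x‖) ^ S + (n + 1) ^ S * (1 + ‖x‖) ^ S * W :=
        add_le_add (le_mul_of_one_le_right (norm_nonneg _) h3)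
          (h1.trans (mul_le_mul_of_nonneg_right h2 hW0))
    _ = _ := by ring

/-- The decay exponent used for the kernels. -/
def decExp (κ : Fin n → ℕ) : ℕ := intExp κ + ∑ l, κ l

/-- The integral of `(1 + |w|_κ)^{-N}` with `N = intExp κ`. -/
def decConst (κ : Fin n → ℕ) : ℝ≥0∞ :=
  ∫⁻ w : E n, ENNReal.ofReal (((1 + knorm κ w) ^ intExp κ)⁻¹)

lemma decConst_lt_top (hκ : ∀ l, 0 < κ l) : decConst κ < ⊤ :=
  lintegral_one_add_knorm_inv_lt_top hκ le_rfl

lemma enorm_sub_dil_le (hκ : ∀ l, 0 < κ l) (f : E n → ℂ) (j : ℤ) (x w : E n) :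
    ‖f (x - dil κ (-j) w) - f x‖ₑ ≤
      ENNReal.ofReal ((1 + knorm κ w) ^ (∑ l, κ l)) * osc κ f ((2 : ℝ) ^ (-j)) := by
  refine (enorm_sub_le_osc (κ := κ) f (ρ := knorm κ w * 2 ^ (-j)) ?_).trans
    (osc_mul_le hκ f (knorm_nonneg w) (by positivity))
  rw [sub_sub_cancel_left, knorm_neg, knorm_dil hκ, mul_comm]

/-- The increment at w is bounded by (1 + |w|_κ)^|κ| ω(2^-j). The exponent `decExp` exceeds `intExp`
by |κ| to absorb this growth. -/
lemma lintegral_kernel_le (hκ : ∀ l, 0 < κ l) (f : E n → ℂ) {K : E n → ℂ} {B : ℝ} (hB : 0 ≤ B)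
    (hK : ∀ w, ‖K w‖ ≤ B * ((1 + knorm κ w) ^ decExp κ)⁻¹) (j : ℤ) (x : E n) :
    ∫⁻ w, ‖K w * (f (x - dil κ (-j) w) - f x)‖ₑ ≤
      ENNReal.ofReal B * decConst κ * osc κ f ((2 : ℝ) ^ (-j)) := by
  have hmeas : Measurable fun w : E n => ENNReal.ofReal (((1 + knorm κ w) ^ intExp κ)⁻¹) :=
    (((measurable_const.add (continuous_knorm κ).measurable).pow_const _).inv).ennreal_ofReal
  rw [decConst, mul_assoc, mul_comm (∫⁻ _, _), ← mul_assoc, ← lintegral_const_mul _ hmeas]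
  refine lintegral_mono fun w => ?_
  have h0 : 0 < 1 + knorm κ w := by linarith [knorm_nonneg (κ := κ) w]
  have h1 : ‖K w‖ₑ ≤ ENNReal.ofReal (B * ((1 + knorm κ w) ^ decExp κ)⁻¹) := by
    rw [← ofReal_norm]
    exact ENNReal.ofReal_le_ofReal (hK w)
  rw [enorm_mul]
  refine (mul_le_mul' h1 (enorm_sub_dil_le hκ f j x w)).trans_eq ?_
  rw [← mul_assoc, ← ENNReal.ofReal_mul (by positivity), mul_right_comm (ENNReal.ofReal B),
    ← ENNReal.ofReal_mul hB]
  congr 2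
  rw [decExp, pow_add]
  field_simp

lemma integrable_of_kernel_bound (hκ : ∀ l, 0 < κ l) {K : E n → ℂ} (hc : Continuous K) {B : ℝ}
    (hK : ∀ w, ‖K w‖ ≤ B * ((1 + knorm κ w) ^ decExp κ)⁻¹) : Integrable K := by
  refine ((integrable_one_add_knorm_inv hκ).const_mul |B|).mono' hc.aestronglyMeasurable
    (Eventually.of_forall fun w => (hK w).trans ?_)
  have h0 : 1 ≤ 1 + knorm κ w := by linarith [knorm_nonneg (κ := κ) w]
  refine mul_le_mul (le_abs_self B) ?_ (by positivity) (abs_nonneg B)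
  exact inv_anti₀ (by positivity) (pow_le_pow_right₀ h0 (by simp [decExp]))

lemma integrable_kernel_sub (hκ : ∀ l, 0 < κ l) {f : E n → ℂ} (hf : DiniCondition κ f) {K : E n → ℂ}
    (hc : Continuous K) {B : ℝ} (hB : 0 ≤ B)
    (hK : ∀ w, ‖K w‖ ≤ B * ((1 + knorm κ w) ^ decExp κ)⁻¹) (j : ℤ) (x : E n) :
    Integrable fun w => K w * (f (x - dil κ (-j) w) - f x) := by
  have hfc := hf.continuous hκ
  refine ⟨Continuous.aestronglyMeasurable (by fun_prop), ?_⟩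
  refine (lintegral_kernel_le hκ f hB hK j x).trans_lt ?_
  exact ENNReal.mul_lt_top (ENNReal.mul_lt_top ENNReal.ofReal_lt_top (decConst_lt_top hκ))
    (hf.osc_lt_top _)

lemma integrable_kernel_mul (hκ : ∀ l, 0 < κ l) {f : E n → ℂ} (hf : DiniCondition κ f) {K : E n → ℂ}
    (hc : Continuous K) {B : ℝ} (hB : 0 ≤ B)
    (hK : ∀ w, ‖K w‖ ≤ B * ((1 + knorm κ w) ^ decExp κ)⁻¹) (j : ℤ) (x : E n) :
    Integrable fun w => K w * f (x - dil κ (-j) w) := by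
  refine ((integrable_kernel_sub hκ hf hc hB hK j x).add
    ((integrable_of_kernel_bound hκ hc hK).mul_const (f x))).congr
    (Eventually.of_forall fun w => ?_)
  simp only [Pi.add_apply]
  ring

lemma enorm_integral_kernel_le (hκ : ∀ l, 0 < κ l) {f : E n → ℂ} (hf : DiniCondition κ f)
    {K : E n → ℂ} (hc : Continuous K) {B : ℝ} (hB : 0 ≤ B)
    (hK : ∀ w, ‖K w‖ ≤ B * ((1 + knorm κ w) ^ decExp κ)⁻¹) (h0 : ∫ w, K w = 0) (j : ℤ) (x : E n) :
    ‖∫ w, K w * f (x - dil κ (-j) w)‖ₑ ≤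
      ENNReal.ofReal B * decConst κ * osc κ f ((2 : ℝ) ^ (-j)) := by
  have h1 : ∫ w, K w * f (x - dil κ (-j) w) = ∫ w, K w * (f (x - dil κ (-j) w) - f x) := by
    simp_rw [mul_sub]
    rw [integral_sub (integrable_kernel_mul hκ hf hc hB hK j x)
      ((integrable_of_kernel_bound hκ hc hK).mul_const (f x)), integral_mul_const, h0, zero_mul,
      sub_zero]
  rw [h1]
  exact (enorm_integral_le_lintegral_enorm _).trans (lintegral_kernel_le hκ f hB hK j x)

variable {m : E n → ℂ}

/-- The Littlewood–Paley piece of `T f` at frequency scale `2^j`. -/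
def piece (hm : IsMultiplier κ m) (f : E n → ℂ) (j : ℤ) (x : E n) : ℂ :=
  cv (𝓕⁻ (psi hm j) : 𝓢(E n, ℂ)) f x

lemma piece_eq (hm : IsMultiplier κ m) (f : E n → ℂ) (j : ℤ) (x : E n) :
    piece hm f j x = ∫ w, kern (cutoff_theta κ) hm j w * f (x - dil κ (-j) w) := by
  have h := integral_comp_dil (κ := κ) j fun w =>
    kern (cutoff_theta κ) hm j w * f (x - dil κ (-j) w)
  simp only [dil_neg_dil] at h
  rw [piece, cv, ← integral_sub_left_eq_self _ volume x]
  simp only [sub_sub_cancel, fourierInv_psi, mul_assoc]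
  rw [integral_const_mul, h, ← mul_assoc, ← zpow_add₀ two_ne_zero]
  simp

lemma exists_piece_le (hn : 0 < n) (hκ : ∀ l, 0 < κ l) (hm : IsMultiplier κ m) :
    ∃ C : ℝ≥0, ∀ f, DiniCondition κ f → ∀ j x,
      ‖piece hm f j x‖ₑ ≤ C * osc κ f ((2 : ℝ) ^ (-j)) := by
  obtain ⟨B, hB, hK⟩ := exists_kern_bound hn hκ (cutoff_theta κ) hm (decExp κ)
  have hfin : ENNReal.ofReal B * decConst κ ≠ ⊤ :=
    (ENNReal.mul_lt_top ENNReal.ofReal_lt_top (decConst_lt_top hκ)).ne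
  refine ⟨(ENNReal.ofReal B * decConst κ).toNNReal, fun f hf j x => ?_⟩
  rw [ENNReal.coe_toNNReal hfin, piece_eq]
  exact enorm_integral_kernel_le hκ hf (SchwartzMap.continuous _) hB (hK j)
    (integral_kern_eq_zero _ hm j) j x

/-- A translation of the integration variable moves the difference from f to the kernel. The new
kernel k(v + h) − k(v), with h = δ_{2^j}(x − y), again has mean zero, and its decay constant carries
the factor |h|_κ = 2^j|x − y|_κ. -/
lemma exists_piece_sub_le_of_small (hn : 0 < n) (hκ : ∀ l, 0 < κ l) (hm : IsMultiplier κ m) :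
    ∃ C : ℝ≥0, ∀ f, DiniCondition κ f → ∀ (j : ℤ) x y, (2 : ℝ) ^ j * knorm κ (x - y) ≤ 1 →
      ‖piece hm f j x - piece hm f j y‖ₑ ≤
        C * (osc κ f ((2 : ℝ) ^ (-j)) * ENNReal.ofReal ((2 : ℝ) ^ j * knorm κ (x - y))) := by
  obtain ⟨B, hB, hK⟩ := exists_kern_sub_bound hn hκ (cutoff_theta κ) hm (decExp κ)
  obtain ⟨B', hB', hK'⟩ := exists_kern_bound hn hκ (cutoff_theta κ) hm (decExp κ)
  have hfin : ENNReal.ofReal B * decConst κ ≠ ⊤ :=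
    (ENNReal.mul_lt_top ENNReal.ofReal_lt_top (decConst_lt_top hκ)).ne
  refine ⟨(ENNReal.ofReal B * decConst κ).toNNReal, fun f hf j x y hxy => ?_⟩
  rw [ENNReal.coe_toNNReal hfin]
  set k := kern (cutoff_theta κ) hm j with hk
  set h := dil κ j (x - y) with hh
  have hkh : knorm κ (-h) = 2 ^ j * knorm κ (x - y) := by rw [knorm_neg, hh, knorm_dil hκ]
  have hi := integrable_kernel_mul hκ hf k.continuous hB' (hK' j) j x
  have hi' := integrable_kernel_mul hκ hf k.continuous hB' (hK' j) j y
  have hshift : ∀ v, x - dil κ (-j) (v + h) = y - dil κ (-j) v := by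
    intro v
    rw [map_add, hh, dil_neg_dil]
    abel
  have hix := hi.comp_add_right h
  simp only [hshift] at hix
  have hx : piece hm f j x = ∫ v, k (v + h) * f (y - dil κ (-j) v) := by
    rw [piece_eq, ← integral_add_right_eq_self _ h]
    simp only [hshift]
    rfl
  have hdiff : piece hm f j x - piece hm f j y =
      ∫ v, (k (v + h) - k v) * f (y - dil κ (-j) v) := by
    rw [hx, piece_eq, ← integral_sub hix hi']
    simp only [sub_mul]
  have hint : Integrable k := k.integrable
  rw [hdiff]
  refine (enorm_integral_kernel_le hκ hf (B := B * knorm κ (-h)) ?_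
    (mul_nonneg hB (knorm_nonneg _)) ?_ ?_ j y).trans_eq ?_
  · have := k.continuous
    fun_prop
  · intro v
    have := hK j v (-h) (by rwa [hkh])
    rwa [sub_neg_eq_add, norm_sub_rev] at this
  · rw [integral_sub (hint.comp_add_right h) hint, integral_add_right_eq_self (fun v => k v), sub_self]
  · rw [ENNReal.ofReal_mul hB, hkh]
    ring

lemma exists_piece_sub_le (hn : 0 < n) (hκ : ∀ l, 0 < κ l) (hm : IsMultiplier κ m) :
    ∃ C : ℝ≥0, ∀ f, DiniCondition κ f → ∀ (j : ℤ) x y, ‖piece hm f j x - piece hm f j y‖ₑ ≤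
      C * (osc κ f ((2 : ℝ) ^ (-j)) * ENNReal.ofReal (min 1 ((2 : ℝ) ^ j * knorm κ (x - y)))) := by
  obtain ⟨C, hC⟩ := exists_piece_le hn hκ hm
  obtain ⟨C', hC'⟩ := exists_piece_sub_le_of_small hn hκ hm
  refine ⟨2 * C + C', fun f hf j x y => ?_⟩
  rcases le_total ((2 : ℝ) ^ j * knorm κ (x - y)) 1 with h | h
  · rw [min_eq_right h]
    refine (hC' f hf j x y h).trans (mul_le_mul_left ?_ _)
    push_cast
    exact le_add_self
  · rw [min_eq_left h, ENNReal.ofReal_one, mul_one]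
    refine (enorm_sub_le.trans (add_le_add (hC f hf j x) (hC f hf j y))).trans ?_
    rw [← two_mul, ← mul_assoc]
    refine mul_le_mul_left ?_ _
    push_cast
    exact le_self_add

/-- This is the core of (*): the terms ω(2^-j) min(1, 2^j|x − y|_κ) discretise the two integrals on
its right side. -/
lemma exists_tsum_piece_sub_le (hn : 0 < n) (hκ : ∀ l, 0 < κ l) (hm : IsMultiplier κ m) :
    ∃ C : ℝ≥0, ∀ f, DiniCondition κ f → ∀ x y, ∑' j : ℤ, ‖piece hm f j x - piece hm f j y‖ₑ ≤
      C * modulusBound κ f (knorm κ (x - y)) := by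
  obtain ⟨C, hC⟩ := exists_piece_sub_le hn hκ hm
  refine ⟨4 * C, fun f hf x y => ?_⟩
  refine (ENNReal.tsum_le_tsum fun j => hC f hf j x y).trans ?_
  rw [ENNReal.tsum_mul_left]
  refine (mul_le_mul_right (tsum_osc_le f (knorm_nonneg _)) _).trans_eq ?_
  push_cast
  ring

lemma summable_of_tsum_enorm {ι : Type*} {F : ι → ℂ} (h : ∑' i, ‖F i‖ₑ < ⊤) : Summable F := by
  refine Summable.of_nnnorm ?_
  exact ENNReal.tsum_coe_ne_top_iff_summable.1 h.ne

lemma enorm_sum_le_tsum {ι : Type*} (s : Finset ι) (F : ι → ℂ) :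
    ‖∑ i ∈ s, F i‖ₑ ≤ ∑' i, ‖F i‖ₑ :=
  (enorm_sum_le _ _).trans (ENNReal.sum_le_tsum s)

lemma enorm_tsum_le_tsum {ι : Type*} {F : ι → ℂ} (h : ∑' i, ‖F i‖ₑ < ⊤) :
    ‖∑' i, F i‖ₑ ≤ ∑' i, ‖F i‖ₑ :=
  le_of_tendsto (summable_of_tsum_enorm h).hasSum.enorm
    (Eventually.of_forall fun s => enorm_sum_le_tsum s F)

/-- A representative of `Tf` modulo constants. -/
def liftSum (hm : IsMultiplier κ m) (f : E n → ℂ) (x : E n) : ℂ :=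
  ∑' j : ℤ, (piece hm f j x - piece hm f j 0)

/-- Subtracting the values at 0 is needed for low frequencies, where the size bound ω(2^-j) alone
gives no decay. It does not affect differences. -/
lemma exists_hasModulus_liftSum (hn : 0 < n) (hκ : ∀ l, 0 < κ l) (hm : IsMultiplier κ m) :
    ∃ C : ℝ≥0, ∀ f, DiniCondition κ f → HasModulus κ f C (liftSum hm f) := by
  obtain ⟨C, hC⟩ := exists_tsum_piece_sub_le hn hκ hm
  refine ⟨C, fun f hf x y => ?_⟩
  have hfin : ∀ x y, ∑' j : ℤ, ‖piece hm f j x - piece hm f j y‖ₑ < ⊤ := fun x y =>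
    (hC f hf x y).trans_lt
      (ENNReal.mul_lt_top ENNReal.coe_lt_top (hf.modulusBound_lt_top (knorm_nonneg _)))
  rw [liftSum, liftSum, ← (summable_of_tsum_enorm (hfin x 0)).tsum_sub
    (summable_of_tsum_enorm (hfin y 0))]
  simp only [sub_sub_sub_cancel_right]
  exact (enorm_tsum_le_tsum (hfin x y)).trans (hC f hf x y)

lemma HasModulus.polyGrowth (hκ : ∀ l, 0 < κ l) {f g : E n → ℂ} {C : ℝ≥0} (hf : DiniCondition κ f)
    (hg : HasModulus κ f C g) : PolyGrowth g := by
  constructor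
  · rw [continuous_iff_continuousAt]
    intro x
    rw [ContinuousAt, tendsto_iff_edist_tendsto_0]
    have h1 : Tendsto (fun y => knorm κ (y - x)) (𝓝 x) (𝓝[≥] 0) :=
      tendsto_nhdsWithin_iff.2 ⟨tendsto_knorm_sub hκ x, Eventually.of_forall fun y => knorm_nonneg _⟩
    have h2 := ENNReal.Tendsto.const_mul (a := (C : ℝ≥0∞)) (hf.tendsto_modulusBound.comp h1)
      (Or.inr ENNReal.coe_ne_top)
    rw [mul_zero] at h2
    refine tendsto_of_tendsto_of_tendsto_of_le_of_le tendsto_const_nhds h2 (fun _ => zero_le)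
      fun y => ?_
    simp only [edist_eq_enorm_sub]
    exact hg y x
  · obtain ⟨A, hA⟩ := hf.exists_modulusBound_le one_pos
    refine ⟨‖g 0‖ + C * (A + n), 1, fun x => ?_⟩
    have h1 := (hg x 0).trans (mul_le_mul_right (hA _ (knorm_nonneg _)) _)
    have h0 := knorm_nonneg (κ := κ) x
    rw [sub_zero, mul_one, ← ofReal_norm, ← ENNReal.ofReal_coe_nnreal, ← ENNReal.ofReal_coe_nnreal,
      ← ENNReal.ofReal_add (by positivity) h0, ← ENNReal.ofReal_mul (by positivity),
      ENNReal.ofReal_le_ofReal_iff (by positivity)] at h1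
    have h2 := knorm_le_norm hκ x
    have h3 : ‖g x‖ ≤ ‖g 0‖ + ‖g x - g 0‖ := by simpa using norm_add_le (g 0) (g x - g 0)
    have h4 : (C : ℝ) * (A + knorm κ x) ≤ C * ((A + n) * (1 + ‖x‖)) := by
      refine mul_le_mul_of_nonneg_left ?_ C.2
      nlinarith [norm_nonneg x, A.2, mul_nonneg A.2 (norm_nonneg x)]
    rw [pow_one]
    nlinarith [norm_nonneg x, norm_nonneg (g 0), mul_nonneg (norm_nonneg (g 0)) (norm_nonneg x)]

end AnisoMult

end

/-! ### The equation û = m f̂ for the sum of the pieces. -/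

noncomputable section

namespace AnisoMult

variable {n : ℕ} {κ : Fin n → ℕ} {m : E n → ℂ}

/-! ### The distributional identity for the sum of the pieces -/

lemma cv_truncKer (hm : IsMultiplier κ m) {f : E n → ℂ} (hf : PolyGrowth f) (J : ℕ) (x : E n) :
    cv (truncKer hm J) f x = ∑ j ∈ Finset.Ioc (-(J : ℤ)) J, piece hm f j x := by
  simp only [cv, piece, truncKer, trunc, fourierInv_psiSum, Finset.sum_mul]
  exact integral_finsetSum _ fun j _ => integrable_cv_of_growth _ hf x

lemma tendsto_Ioc_atTop : Tendsto (fun J : ℕ => Finset.Ioc (-(J : ℤ)) J) atTop atTop := by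
  refine tendsto_atTop_finset_of_monotone (fun a b h => ?_) fun x => ?_
  · exact Finset.Ioc_subset_Ioc (by simpa using h) (by simpa using h)
  · exact ⟨x.natAbs + 1, by rw [Finset.mem_Ioc]; omega⟩

/-- The value at the origin of the truncated operator. -/
def truncVal (hm : IsMultiplier κ m) (f : E n → ℂ) (J : ℕ) : ℂ := cv (truncKer hm J) f 0

lemma cv_truncKer_sub (hm : IsMultiplier κ m) {f : E n → ℂ} (hf : PolyGrowth f) (J : ℕ) (x : E n) :
    cv (truncKer hm J) f x - truncVal hm f J =
      ∑ j ∈ Finset.Ioc (-(J : ℤ)) J, (piece hm f j x - piece hm f j 0) := by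
  rw [truncVal, cv_truncKer hm hf, cv_truncKer hm hf, Finset.sum_sub_distrib]

lemma fourier_apply_eq_integral (φ : 𝓢(E n, ℂ)) : ∫ x, (𝓕 φ : 𝓢(E n, ℂ)) x = φ 0 := by
  have h1 : (𝓕⁻ (𝓕 φ : 𝓢(E n, ℂ)) : 𝓢(E n, ℂ)) 0 = φ 0 := by
    rw [FourierTransform.fourierInv_fourier_eq φ]
  rw [← h1, SchwartzMap.fourierInv_coe, Real.fourierInv_eq]
  simp

/-- The distributional identity, in terms of the limit of the values at the origin. -/
lemma integral_fourier_mul_liftSum (hn : 0 < n) (hκ : ∀ l, 0 < κ l) (hm : IsMultiplier κ m)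
    {f : E n → ℂ} (hf : DiniCondition κ f) {φ ψ : 𝓢(E n, ℂ)}
    (h : ∀ᶠ J in atTop, SchwartzMap.pairing (ContinuousLinearMap.mul ℂ ℂ) (trunc hm J) φ = ψ)
    {L : ℂ} (hL : Tendsto (fun J => truncVal hm f J * φ 0) atTop (𝓝 L)) :
    ∫ x, (𝓕 φ : 𝓢(E n, ℂ)) x * liftSum hm f x = (∫ x, (𝓕 ψ : 𝓢(E n, ℂ)) x * f x) - L := by
  obtain ⟨C, hC⟩ := exists_tsum_piece_sub_le hn hκ hm
  have hfg := hf.polyGrowth hκ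
  have hfin : ∀ x, ∑' j : ℤ, ‖piece hm f j x - piece hm f j 0‖ₑ < ⊤ := fun x =>
    (hC f hf x 0).trans_lt
      (ENNReal.mul_lt_top ENNReal.coe_lt_top (hf.modulusBound_lt_top (knorm_nonneg _)))
  obtain ⟨A, hA⟩ := hf.exists_modulusBound_le one_pos
  -- A majorant of polynomial growth for all truncated sums at once, used for dominated convergence.
  set D : E n → ℂ := fun x => ((C * (A + knorm κ x) : ℝ) : ℂ) with hD
  have hDg : PolyGrowth D := by
    refine ⟨by have := continuous_knorm κ; fun_prop, C * (A + n), 1, fun x => ?_⟩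
    have h0 := knorm_nonneg (κ := κ) x
    rw [hD, Complex.norm_real, Real.norm_of_nonneg (by positivity), mul_assoc, pow_one]
    refine mul_le_mul_of_nonneg_left ?_ C.2
    have h2 := knorm_le_norm hκ x
    nlinarith [norm_nonneg x, A.2, mul_nonneg A.2 (norm_nonneg x)]
  have hbound : ∀ J x, ‖cv (truncKer hm J) f x - truncVal hm f J‖ ≤ ‖D x‖ := by
    intro J x
    have h0 := knorm_nonneg (κ := κ) x
    rw [cv_truncKer_sub hm hfg, hD, Complex.norm_real, Real.norm_of_nonneg (by positivity),
      ← ENNReal.ofReal_le_ofReal_iff (by positivity), ofReal_norm]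
    refine (enorm_sum_le_tsum _ _).trans ((hC f hf x 0).trans ?_)
    rw [sub_zero, ENNReal.ofReal_mul (by positivity), ENNReal.ofReal_add (by positivity) h0,
      ENNReal.ofReal_coe_nnreal, ENNReal.ofReal_coe_nnreal]
    have := hA _ h0
    rw [mul_one] at this
    exact mul_le_mul_right this _
  have hpt : ∀ x, Tendsto (fun J => cv (truncKer hm J) f x - truncVal hm f J) atTop
      (𝓝 (liftSum hm f x)) := by
    intro x
    have h1 := (summable_of_tsum_enorm (hfin x)).hasSum.comp tendsto_Ioc_atTop
    exact h1.congr fun J => (cv_truncKer_sub hm hfg J x).symm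
  have hmeas : ∀ J, AEStronglyMeasurable (fun x => cv (truncKer hm J) f x) volume := by
    intro J
    have hc : Continuous (Function.uncurry fun x y => truncKer hm J (x - y) * f y) := by
      have h2 := (truncKer hm J).continuous
      have h3 := hfg.continuous
      fun_prop
    exact hc.aestronglyMeasurable.integral_prod_right'
  have hint1 : ∀ J, Integrable fun x =>
      (𝓕 φ : 𝓢(E n, ℂ)) x * (cv (truncKer hm J) f x - truncVal hm f J) := by
    intro J
    refine (hDg.integrable_mul (𝓕 φ : 𝓢(E n, ℂ))).norm.mono'
      ((SchwartzMap.continuous _).aestronglyMeasurable.mul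
        ((hmeas J).sub aestronglyMeasurable_const)) (Eventually.of_forall fun x => ?_)
    rw [norm_mul, norm_mul]
    exact mul_le_mul_of_nonneg_left (hbound J x) (norm_nonneg _)
  have hlim : Tendsto (fun J => ∫ x, (𝓕 φ : 𝓢(E n, ℂ)) x *
      (cv (truncKer hm J) f x - truncVal hm f J)) atTop
      (𝓝 (∫ x, (𝓕 φ : 𝓢(E n, ℂ)) x * liftSum hm f x)) := by
    refine tendsto_integral_of_dominated_convergence _ (fun J => (hint1 J).aestronglyMeasurable)
      (hDg.integrable_mul (𝓕 φ : 𝓢(E n, ℂ))).norm (fun J => Eventually.of_forall fun x => ?_)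
      (Eventually.of_forall fun x => (hpt x).const_mul _)
    rw [norm_mul, norm_mul]
    exact mul_le_mul_of_nonneg_left (hbound J x) (norm_nonneg _)
  -- For large J the paired integral equals the f-integral minus `truncVal` times ∫φ̂ = φ(0). The
  -- limit of that last product is L.
  refine tendsto_nhds_unique hlim ((hL.const_sub _).congr' ?_)
  filter_upwards [h] with J hJ
  have h2 : Integrable fun x => (𝓕 φ : 𝓢(E n, ℂ)) x * truncVal hm f J :=
    (SchwartzMap.integrable _).mul_const _
  have h3 : Integrable fun x => (𝓕 φ : 𝓢(E n, ℂ)) x * cv (truncKer hm J) f x := by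
    refine ((hint1 J).add h2).congr (Eventually.of_forall fun x => ?_)
    simp only [Pi.add_apply]
    ring
  simp only [mul_sub]
  rw [integral_sub h3 h2, integral_mul_const, fourier_apply_eq_integral, mul_comm (φ 0), ← hJ,
    truncKer, integral_fourier_mul_cv _ _ hfg]

/-! ### Uniform convergence of the truncations on compact sets -/

lemma eventually_chi_dil_eq_zero_of_le (hκ : ∀ l, 0 < κ l) {δ : ℝ} (hδ : 0 < δ) :
    ∀ᶠ J : ℕ in atTop, ∀ ξ : E n, δ ≤ knorm κ ξ → chi (dil κ J ξ) = 0 := by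
  have h1 : Tendsto (fun J : ℕ => (2 : ℝ) ^ J * δ) atTop atTop :=
    (tendsto_pow_atTop_atTop_of_one_lt one_lt_two).atTop_mul_const hδ
  filter_upwards [h1.eventually_ge_atTop (n * (1 + 2))] with J hJ ξ hξ
  refine chi_eq_zero ?_
  have h2 := knorm_le_norm hκ (dil κ J ξ)
  rw [knorm_dil hκ, zpow_natCast] at h2
  have h3 := (hJ.trans (mul_le_mul_of_nonneg_left hξ (by positivity))).trans h2
  rcases Nat.eq_zero_or_pos n with rfl | hn
  · rw [Subsingleton.elim ξ 0, knorm_zero hκ] at hξ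
    exact absurd hξ (not_le.2 hδ)
  · have hn' : (0 : ℝ) < n := by exact_mod_cast hn
    have := le_of_mul_le_mul_left h3 hn'
    linarith

lemma eventually_chi_dil_neg_eq_one_of_le (hκ : ∀ l, 0 < κ l) (R : ℝ) :
    ∀ᶠ J : ℕ in atTop, ∀ ξ : E n, ‖ξ‖ ≤ R → chi (dil κ (-J) ξ) = 1 := by
  have h1 : Tendsto (fun J : ℕ => (2 : ℝ)⁻¹ ^ J * (n * R)) atTop (𝓝 (0 * (n * R))) :=
    (tendsto_pow_atTop_nhds_zero_of_lt_one (by norm_num) (by norm_num)).mul_const _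
  rw [zero_mul] at h1
  filter_upwards [h1.eventually (Iic_mem_nhds one_pos)] with J hJ ξ hξ
  refine chi_eq_one ((norm_le_sum_abs _).trans (le_trans ?_ hJ))
  have h2 : ∀ l, |dil κ (-J) ξ l| ≤ (2 : ℝ)⁻¹ ^ J * R := by
    intro l
    rw [dil_apply, abs_mul, abs_of_pos (by positivity)]
    refine mul_le_mul ?_ (((Real.norm_eq_abs _).symm.le.trans (PiLp.norm_apply_le ξ l)).trans hξ)
      (abs_nonneg _) (by positivity)
    rw [neg_mul, zpow_neg, inv_pow]
    refine inv_anti₀ (by positivity) ?_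
    rw [← zpow_natCast]
    refine zpow_le_zpow_right₀ one_le_two ?_
    have := hκ l
    nlinarith
  refine (Finset.sum_le_sum fun l _ => h2 l).trans (le_of_eq ?_)
  simp
  ring

lemma pairing_mul_apply (φ ψ : 𝓢(E n, ℂ)) (x : E n) :
    SchwartzMap.pairing (ContinuousLinearMap.mul ℂ ℂ) φ ψ x = φ x * ψ x := rfl

lemma schwartz_ext_of_ne_zero (hn : 0 < n) {φ ψ : 𝓢(E n, ℂ)} (h : ∀ x, x ≠ 0 → φ x = ψ x) :
    φ = ψ := by
  have : Nontrivial (E n) := by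
    have : Nonempty (Fin n) := ⟨⟨0, hn⟩⟩
    infer_instance
  have : (𝓝[≠] (0 : E n)).NeBot := Module.punctured_nhds_neBot ℝ (E n) 0
  refine DFunLike.coe_injective (Continuous.ext_on (dense_compl_singleton (0 : E n))
    φ.continuous ψ.continuous fun x hx => h x hx)

/-- If `m φ` is supported away from the origin, then it agrees with the product of `φ` with the
truncated multipliers, eventually. -/
lemma eventually_pairing_trunc_eq (hn : 0 < n) (hκ : ∀ l, 0 < κ l) (hm : IsMultiplier κ m)
    {φ ψ : 𝓢(E n, ℂ)} (hφ : HasCompactSupport φ) (hψ : ∀ ξ, ξ ≠ 0 → ψ ξ = m ξ * φ ξ) {δ : ℝ}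
    (hδ : 0 < δ) (h0 : ∀ ξ, ξ ≠ 0 → knorm κ ξ < δ → m ξ * φ ξ = 0) :
    ∀ᶠ J in atTop, SchwartzMap.pairing (ContinuousLinearMap.mul ℂ ℂ) (trunc hm J) φ = ψ := by
  obtain ⟨R, hR⟩ := hφ.isCompact.isBounded.exists_norm_le
  filter_upwards [eventually_chi_dil_eq_zero_of_le hκ hδ,
    eventually_chi_dil_neg_eq_one_of_le hκ R] with J h1 h2
  refine schwartz_ext_of_ne_zero hn fun ξ hξ => ?_
  rw [pairing_mul_apply, hψ ξ hξ, trunc_apply, mul_assoc]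
  by_cases hs : ξ ∈ tsupport φ
  · rw [h2 ξ (hR ξ hs)]
    rcases lt_or_ge (knorm κ ξ) δ with h | h
    · rw [h0 ξ hξ h, mul_zero]
    · rw [h1 ξ h]
      ring
  · rw [image_eq_zero_of_notMem_tsupport hs]
    simp

lemma FourierEqOn_iff_integral {U : Set (E n)} {f g : E n → ℂ} {F u : 𝓢'(E n, ℂ)}
    (hF : RepresentedBy F f) (hu : RepresentedBy u g) : FourierEqOn U m F u ↔
    ∀ φ ψ : 𝓢(E n, ℂ), HasCompactSupport φ → tsupport φ ⊆ U →
      (∀ ξ, ξ ≠ 0 → ψ ξ = m ξ * φ ξ) →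
      ∫ x, (𝓕 φ : 𝓢(E n, ℂ)) x * g x = ∫ x, (𝓕 ψ : 𝓢(E n, ℂ)) x * f x := by
  have h1 : ∀ φ : 𝓢(E n, ℂ), (𝓕 u) φ = ∫ x, (𝓕 φ : 𝓢(E n, ℂ)) x * g x := fun φ =>
    (hu (𝓕 φ : 𝓢(E n, ℂ))).2
  have h2 : ∀ φ : 𝓢(E n, ℂ), (𝓕 F) φ = ∫ x, (𝓕 φ : 𝓢(E n, ℂ)) x * f x := fun φ =>
    (hF (𝓕 φ : 𝓢(E n, ℂ))).2
  simp only [FourierEqOn, h1, h2]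

/-- A test function supported off the origin vanishes at 0, so the subtracted constants contribute
nothing and L = 0. -/
lemma fourierEqOn_liftSum (hn : 0 < n) (hκ : ∀ l, 0 < κ l) (hm : IsMultiplier κ m)
    {f : E n → ℂ} (hf : DiniCondition κ f) {F u : 𝓢'(E n, ℂ)} (hF : RepresentedBy F f)
    (hu : RepresentedBy u (liftSum hm f)) : FourierEqOn {0}ᶜ m F u := by
  rw [FourierEqOn_iff_integral hF hu]
  intro φ ψ hφ hsupp hψ
  have h0 : (0 : E n) ∉ tsupport φ := fun h => hsupp h rfl
  obtain ⟨δ, hδ, hδ'⟩ : ∃ δ : ℝ, 0 < δ ∧ ∀ ξ ∈ tsupport φ, δ ≤ knorm κ ξ := by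
    rcases (tsupport φ).eq_empty_or_nonempty with h | h
    · exact ⟨1, one_pos, by simp [h]⟩
    · obtain ⟨ξ, hξ, hmin⟩ := hφ.isCompact.exists_isMinOn h (continuous_knorm κ).continuousOn
      exact ⟨knorm κ ξ, knorm_pos hκ (fun h' => h0 (h' ▸ hξ)), fun η hη => hmin hη⟩
  have hev := eventually_pairing_trunc_eq hn hκ hm hφ hψ hδ fun ξ _ hξ => by
    rw [image_eq_zero_of_notMem_tsupport fun h => absurd (hδ' ξ h) (not_le.2 hξ), mul_zero]
  have hL : Tendsto (fun J => truncVal hm f J * φ 0) atTop (𝓝 0) := by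
    simp [image_eq_zero_of_notMem_tsupport h0]
  simpa using integral_fourier_mul_liftSum hn hκ hm hf hev hL

/-! ### Multipliers vanishing near the origin -/

lemma exists_psi_eq_zero (hκ : ∀ l, 0 < κ l) (hn : 0 < n) (hm : IsMultiplier κ m)
    (h0 : ∀ᶠ ξ in 𝓝[≠] (0 : E n), m ξ = 0) :
    ∃ J : ℕ, ∀ j : ℤ, j ≤ -J → psi hm j = 0 := by
  rw [eventually_nhdsWithin_iff, Metric.eventually_nhds_iff] at h0
  obtain ⟨r, hr, hr'⟩ := h0
  have h1 : Tendsto (fun J : ℕ => (2 : ℝ)⁻¹ ^ J * (n * 2)) atTop (𝓝 (0 * (n * 2))) :=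
    (tendsto_pow_atTop_nhds_zero_of_lt_one (by norm_num) (by norm_num)).mul_const _
  rw [zero_mul] at h1
  obtain ⟨J, hJ⟩ := (h1.eventually (gt_mem_nhds hr)).exists
  refine ⟨J, fun j hj => schwartz_ext_of_ne_zero hn fun ξ hξ => ?_⟩
  rw [psi_apply, zero_apply, mul_eq_zero]
  by_contra! hcon
  obtain ⟨hθ, hmξ⟩ := hcon
  have h2 : ‖dil κ (-j) ξ‖ < 2 := by
    by_contra! h2
    refine hθ ?_
    have h3 : 2 ≤ ‖dil κ 1 (dil κ (-j) ξ)‖ := by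
      refine h2.trans (norm_le_norm_of_abs_coord_le fun l => ?_)
      rw [dil_apply (κ := κ) 1 (dil κ (-j) ξ), abs_mul,
        abs_of_pos (show (0 : ℝ) < 2 ^ ((1 : ℤ) * κ l) by positivity)]
      exact le_mul_of_one_le_left (abs_nonneg _) (one_le_zpow₀ one_le_two (by simp))
    rw [theta, chi_eq_zero h2, chi_eq_zero h3, sub_zero]
  refine hmξ (hr' ?_ hξ)
  rw [dist_zero_right]
  refine lt_of_le_of_lt ((norm_le_sum_abs ξ).trans ?_) hJ
  have h4 : ∀ l, |ξ l| ≤ (2 : ℝ)⁻¹ ^ J * 2 := by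
    intro l
    have h5 : ξ l = (2 : ℝ) ^ (j * κ l) * dil κ (-j) ξ l := by
      rw [← dil_apply, dil_dil_neg]
    rw [h5, abs_mul, abs_of_pos (by positivity)]
    refine mul_le_mul ?_ (((Real.norm_eq_abs _).symm.le.trans (PiLp.norm_apply_le _ l)).trans h2.le)
      (abs_nonneg _) (by positivity)
    rw [inv_pow, ← zpow_natCast, ← zpow_neg]
    refine zpow_le_zpow_right₀ one_le_two ?_
    have := hκ l
    nlinarith
  refine (Finset.sum_le_sum fun l _ => h4 l).trans (le_of_eq ?_)
  simp
  ring

/-- Pieces of frequency j ≤ −J vanish. For the others min(1, 2^j 2^J) = 1, so `tsum_osc_le` at r =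
2^J sums their sizes. -/
lemma exists_tendsto_truncVal (hn : 0 < n) (hκ : ∀ l, 0 < κ l) (hm : IsMultiplier κ m)
    (h0 : ∀ᶠ ξ in 𝓝[≠] (0 : E n), m ξ = 0) {f : E n → ℂ} (hf : DiniCondition κ f) :
    ∃ c, Tendsto (truncVal hm f) atTop (𝓝 c) := by
  obtain ⟨J, hJ⟩ := exists_psi_eq_zero hκ hn hm h0
  obtain ⟨C, hC⟩ := exists_piece_le hn hκ hm
  have hfg := hf.polyGrowth hκ
  have h1 : ∀ j : ℤ, ‖piece hm f j 0‖ₑ ≤ C * (osc κ f ((2 : ℝ) ^ (-j)) *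
      ENNReal.ofReal (min 1 ((2 : ℝ) ^ j * (2 : ℝ) ^ (J : ℤ)))) := by
    intro j
    rcases le_or_gt j (-J) with hj | hj
    · have h2 : piece hm f j 0 = 0 := by
        have h3 : (𝓕⁻ (0 : 𝓢(E n, ℂ)) : 𝓢(E n, ℂ)) = 0 :=
          map_zero (FourierTransform.fourierInvCLM ℂ 𝓢(E n, ℂ))
        rw [piece, hJ j hj, h3, cv]
        simp
      simp [h2]
    · rw [min_eq_left, ENNReal.ofReal_one, mul_one]
      · exact hC f hf j 0
      · rw [← zpow_add₀ two_ne_zero]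
        exact one_le_zpow₀ one_le_two (by omega)
  have hfin : ∑' j : ℤ, ‖piece hm f j 0‖ₑ < ⊤ := by
    refine (ENNReal.tsum_le_tsum h1).trans_lt ?_
    rw [ENNReal.tsum_mul_left]
    refine ENNReal.mul_lt_top ENNReal.coe_lt_top ((tsum_osc_le f (by positivity)).trans_lt ?_)
    exact ENNReal.mul_lt_top (by norm_num) (hf.modulusBound_lt_top (by positivity))
  refine ⟨_, ((summable_of_tsum_enorm hfin).hasSum.comp tendsto_Ioc_atTop).congr fun J => ?_⟩
  rw [truncVal, cv_truncKer hm hfg]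
  rfl

/-- The constant c is the limit of the subtracted values at the origin. Adding it back cancels the
term L = cφ(0) for test functions that do not vanish at 0. -/
lemma exists_fourierEqOn_univ (hn : 0 < n) (hκ : ∀ l, 0 < κ l) (hm : IsMultiplier κ m)
    (h0 : ∀ᶠ ξ in 𝓝[≠] (0 : E n), m ξ = 0) {f : E n → ℂ} (hf : DiniCondition κ f)
    {F : 𝓢'(E n, ℂ)} (hF : RepresentedBy F f) (hg : PolyGrowth (liftSum hm f)) :
    ∃ c : ℂ, ∀ u : 𝓢'(E n, ℂ), RepresentedBy u (fun x => liftSum hm f x + c) →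
      FourierEqOn univ m F u := by
  obtain ⟨c, hc⟩ := exists_tendsto_truncVal hn hκ hm h0 hf
  refine ⟨c, fun u hu => ?_⟩
  rw [FourierEqOn_iff_integral hF hu]
  intro φ ψ hφ _ hψ
  obtain ⟨δ, hδ, hδ'⟩ : ∃ δ : ℝ, 0 < δ ∧ ∀ ξ : E n, ξ ≠ 0 → knorm κ ξ < δ → m ξ = 0 := by
    rw [eventually_nhdsWithin_iff, Metric.eventually_nhds_iff] at h0
    obtain ⟨r, hr, hr'⟩ := h0
    have hfun : Tendsto (fun δ : ℝ => ∑ l, δ ^ κ l) (𝓝[>] 0) (𝓝 0) := by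
      have h2 : Continuous fun δ : ℝ => ∑ l, δ ^ κ l := by fun_prop
      have h3 := h2.tendsto 0
      rw [Finset.sum_eq_zero fun l _ => zero_pow (hκ l).ne'] at h3
      exact h3.mono_left nhdsWithin_le_nhds
    obtain ⟨δ, h2, h3⟩ := ((hfun.eventually (gt_mem_nhds hr)).and self_mem_nhdsWithin).exists
    refine ⟨δ, h3, fun ξ hξ hξδ => hr' ?_ hξ⟩
    rw [dist_zero_right]
    refine lt_of_le_of_lt ((norm_le_sum_abs ξ).trans (Finset.sum_le_sum fun l _ => ?_)) h2
    exact (abs_coord_le hκ ξ l).trans (pow_le_pow_left₀ (knorm_nonneg ξ) hξδ.le _)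
  have hev := eventually_pairing_trunc_eq hn hκ hm hφ hψ hδ fun ξ hξ h => by
    rw [hδ' ξ hξ h, zero_mul]
  have h2 := integral_fourier_mul_liftSum hn hκ hm hf hev (hc.mul_const (φ 0))
  simp only [mul_add]
  rw [integral_add (hg.integrable_mul _) ((SchwartzMap.integrable _).mul_const c), h2,
    integral_mul_const, fourier_apply_eq_integral]
  ring

end AnisoMult

end

/-! ### Tempered distributions with Fourier transform supported at the origin. -/

noncomputable section

namespace AnisoMult

variable {n : ℕ} {κ : Fin n → ℕ}

/-! ### Cutoffs of Schwartz functions -/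

/-- The function `x ↦ χ(a x)`. -/
def chiS (n : ℕ) (a : ℝ) (ha : a ≠ 0) : 𝓢(E n, ℂ) :=
  HasCompactSupport.toSchwartzMap (f := fun x => chi (a • x)) (hasCompactSupport_chi.comp_smul ha)
    (contDiff_chi.comp (contDiff_const_smul a))

lemma chiS_apply {a : ℝ} (ha : a ≠ 0) (x : E n) : chiS n a ha x = chi (a • x) := rfl

/-- The bound for the derivatives of the cutoff function. -/
def chiBd (n i : ℕ) : ℝ := SchwartzMap.seminorm ℂ 0 i (chiS n 1 one_ne_zero)

lemma chiBd_nonneg (n i : ℕ) : 0 ≤ chiBd n i := apply_nonneg _ _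

lemma norm_iteratedFDeriv_chi_le (i : ℕ) (x : E n) : ‖iteratedFDeriv ℝ i chi x‖ ≤ chiBd n i := by
  have h := SchwartzMap.norm_iteratedFDeriv_le_seminorm ℂ (chiS n 1 one_ne_zero) i x
  have h2 : ((chiS n 1 one_ne_zero : 𝓢(E n, ℂ)) : E n → ℂ) = chi := by
    ext y
    rw [chiS_apply, one_smul]
  rwa [h2] at h

lemma iteratedFDeriv_comp_smul {g : E n → ℂ} (hg : ContDiff ℝ ∞ g) (a : ℝ) (i : ℕ) (x : E n) :
    ‖iteratedFDeriv ℝ i (fun y => g (a • y)) x‖ = |a| ^ i * ‖iteratedFDeriv ℝ i g (a • x)‖ := by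
  rw [iteratedFDeriv_comp_const_smul a (hg.of_le (by exact_mod_cast le_top))]
  simp only [norm_smul, norm_pow, Real.norm_eq_abs]

lemma norm_iteratedFDeriv_chi_sub_one_le (i : ℕ) (x : E n) :
    ‖iteratedFDeriv ℝ i (fun y => chi y - 1) x‖ ≤ chiBd n i + 1 := by
  have h1 : iteratedFDeriv ℝ i (fun y : E n => chi y - 1) x =
      iteratedFDeriv ℝ i chi x - iteratedFDeriv ℝ i (fun _ => (1 : ℂ)) x :=
    iteratedFDeriv_sub_apply (contDiff_chi.of_le (by exact_mod_cast le_top)).contDiffAt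
      contDiff_const.contDiffAt
  rw [h1]
  refine (norm_sub_le _ _).trans (add_le_add (norm_iteratedFDeriv_chi_le i x) ?_)
  rcases Nat.eq_zero_or_pos i with rfl | hi
  · simp [norm_iteratedFDeriv_zero]
  · rw [iteratedFDeriv_const_of_ne hi.ne']
    simp

lemma iteratedFDeriv_chi_sub_one_eq_zero (i : ℕ) {x : E n} (hx : ‖x‖ < 1) :
    iteratedFDeriv ℝ i (fun y => chi y - 1) x = 0 := by
  have h1 : (fun y : E n => chi y - 1) =ᶠ[𝓝 x] fun _ => (0 : ℂ) := by
    filter_upwards [(isOpen_lt continuous_norm continuous_const).mem_nhds hx] with y hy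
    rw [chi_eq_one (le_of_lt hy), sub_self]
  rw [h1.iteratedFDeriv ℝ i |>.self_of_nhds]
  simp

/-- The cutoff of a Schwartz function. -/
def cutS (a : ℝ) (ha : a ≠ 0) (φ : 𝓢(E n, ℂ)) : 𝓢(E n, ℂ) :=
  SchwartzMap.pairing (ContinuousLinearMap.mul ℂ ℂ) (chiS n a ha) φ

lemma cutS_apply {a : ℝ} (ha : a ≠ 0) (φ : 𝓢(E n, ℂ)) (x : E n) :
    cutS a ha φ x = chi (a • x) * φ x := rfl

lemma tsupport_cutS_subset {a : ℝ} (ha : a ≠ 0) (φ : 𝓢(E n, ℂ)) :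
    tsupport (cutS a ha φ) ⊆ tsupport φ :=
  closure_mono (Function.support_mul_subset_right _ _)

lemma hasCompactSupport_cutS {a : ℝ} (ha : a ≠ 0) (φ : 𝓢(E n, ℂ)) :
    HasCompactSupport (cutS a ha φ) :=
  HasCompactSupport.mul_right (hasCompactSupport_chi.comp_smul ha)

/-- χ(a·) − 1 is flat where a‖x‖ < 1. Elsewhere 1 ≤ a‖x‖, which trades a factor a for one more power
of the weight. -/
lemma seminorm_cutS_sub_le {a : ℝ} (ha : 0 < a) (ha1 : a ≤ 1) (φ : 𝓢(E n, ℂ)) (k l : ℕ) :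
    SchwartzMap.seminorm ℂ k l (cutS a ha.ne' φ - φ) ≤
      a * ∑ i ∈ Finset.range (l + 1), (l.choose i) * (chiBd n i + 1) *
        SchwartzMap.seminorm ℂ (k + 1) (l - i) φ := by
  have hs0 : ∀ i, 0 ≤ SchwartzMap.seminorm ℂ (k + 1) (l - i) φ := fun i => apply_nonneg _ _
  have hc0 := chiBd_nonneg n
  refine SchwartzMap.seminorm_le_bound ℂ k l _ (mul_nonneg ha.le (Finset.sum_nonneg fun i _ =>
    mul_nonneg (mul_nonneg (Nat.cast_nonneg _) (by linarith [hc0 i])) (hs0 i))) fun x => ?_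
  have hcd : ContDiff ℝ ∞ fun y : E n => chi y - 1 := contDiff_chi.sub contDiff_const
  have hcd' : ContDiff ℝ ∞ fun y : E n => chi (a • y) - 1 := hcd.comp (contDiff_const_smul a)
  have h1 : ((cutS a ha.ne' φ - φ : 𝓢(E n, ℂ)) : E n → ℂ) =
      fun y => (chi (a • y) - 1) * φ y := by
    ext y
    change cutS a ha.ne' φ y - φ y = _
    rw [cutS_apply]
    ring
  rw [h1]
  refine (mul_le_mul_of_nonneg_left (norm_iteratedFDeriv_mul_le hcd' (φ.smooth ⊤) x
    (by exact_mod_cast le_top)) (by positivity)).trans ?_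
  rw [Finset.mul_sum, Finset.mul_sum]
  refine Finset.sum_le_sum fun i _ => ?_
  rw [iteratedFDeriv_comp_smul hcd, abs_of_pos ha]
  rcases lt_or_ge (‖a • x‖) 1 with hx | hx
  · rw [iteratedFDeriv_chi_sub_one_eq_zero i hx, norm_zero, mul_zero, mul_zero, zero_mul, mul_zero]
    exact mul_nonneg ha.le (mul_nonneg (mul_nonneg (Nat.cast_nonneg _) (by linarith [hc0 i])) (hs0 i))
  · rw [norm_smul, Real.norm_of_nonneg ha.le] at hx
    have h2 : a ^ i * ‖iteratedFDeriv ℝ i (fun y => chi y - 1) (a • x)‖ ≤ chiBd n i + 1 := by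
      calc _ ≤ 1 * (chiBd n i + 1) := mul_le_mul (pow_le_one₀ ha.le ha1)
            (norm_iteratedFDeriv_chi_sub_one_le i _) (norm_nonneg _) zero_le_one
        _ = _ := one_mul _
    have h3 := SchwartzMap.le_seminorm ℂ (k + 1) (l - i) φ x
    have h4 : ‖x‖ ^ k * ‖iteratedFDeriv ℝ (l - i) φ x‖ ≤
        a * SchwartzMap.seminorm ℂ (k + 1) (l - i) φ := by
      refine le_trans ?_ (mul_le_mul_of_nonneg_left h3 ha.le)
      have h5 : 0 ≤ ‖x‖ ^ k * ‖iteratedFDeriv ℝ (l - i) φ x‖ := by positivity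
      calc ‖x‖ ^ k * ‖iteratedFDeriv ℝ (l - i) φ x‖
          ≤ (a * ‖x‖) * (‖x‖ ^ k * ‖iteratedFDeriv ℝ (l - i) φ x‖) := le_mul_of_one_le_left h5 hx
        _ = _ := by ring
    calc ‖x‖ ^ k * (↑(l.choose i) * (a ^ i * ‖iteratedFDeriv ℝ i (fun y => chi y - 1) (a • x)‖) *
          ‖iteratedFDeriv ℝ (l - i) φ x‖)
        = ↑(l.choose i) * (a ^ i * ‖iteratedFDeriv ℝ i (fun y => chi y - 1) (a • x)‖) *
          (‖x‖ ^ k * ‖iteratedFDeriv ℝ (l - i) φ x‖) := by ring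
      _ ≤ ↑(l.choose i) * (chiBd n i + 1) * (a * SchwartzMap.seminorm ℂ (k + 1) (l - i) φ) := by
          refine mul_le_mul (mul_le_mul_of_nonneg_left h2 (Nat.cast_nonneg _)) h4 (by positivity)
            (mul_nonneg (Nat.cast_nonneg _) (by linarith [hc0 i]))
      _ = _ := by ring

lemma tendsto_cutS (φ : 𝓢(E n, ℂ)) : Tendsto
    (fun k : ℕ => cutS ((k : ℝ) + 1)⁻¹ (inv_ne_zero k.cast_add_one_ne_zero) φ) atTop (𝓝 φ) := by
  rw [(schwartz_withSeminorms ℂ (E n) ℂ).tendsto_nhds]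
  rintro ⟨k, l⟩ ε hε
  have h1 : Tendsto (fun j : ℕ => ((j : ℝ) + 1)⁻¹ * ∑ i ∈ Finset.range (l + 1), (l.choose i) *
      (chiBd n i + 1) * SchwartzMap.seminorm ℂ (k + 1) (l - i) φ) atTop (𝓝 (0 * _)) :=
    (tendsto_one_div_add_atTop_nhds_zero_nat.congr fun j => one_div _).mul_const _
  rw [zero_mul] at h1
  filter_upwards [h1.eventually (gt_mem_nhds hε)] with j hj
  refine lt_of_le_of_lt (seminorm_cutS_sub_le (by positivity) ?_ φ k l) hj
  exact inv_le_one_of_one_le₀ (by linarith [Nat.cast_nonneg (α := ℝ) j])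

/-- Wide cutoffs converge to φ in the Schwartz topology without enlarging its support. -/
lemma eq_zero_of_tsupport_subset {U : Set (E n)} {S : 𝓢'(E n, ℂ)}
    (hS : ∀ φ : 𝓢(E n, ℂ), HasCompactSupport φ → tsupport φ ⊆ U → S φ = 0) (φ : 𝓢(E n, ℂ))
    (hφ : tsupport φ ⊆ U) : S φ = 0 := by
  have h1 : Tendsto (fun k : ℕ =>
      S (cutS ((k : ℝ) + 1)⁻¹ (inv_ne_zero k.cast_add_one_ne_zero) φ)) atTop (𝓝 (S φ)) :=
    ((map_continuous S).tendsto φ).comp (tendsto_cutS φ)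
  refine tendsto_nhds_unique h1 ?_
  simp only [fun k : ℕ => hS _ (hasCompactSupport_cutS
    (inv_ne_zero (k.cast_add_one_ne_zero : (k : ℝ) + 1 ≠ 0)) φ) ((tsupport_cutS_subset _ φ).trans hφ)]
  exact tendsto_const_nhds

/-! ### Distributions supported at the origin -/

/-- Taylor's estimate by descending order of derivative: starting from order N + 1, the mean value
inequality on the ball of radius ‖x‖ gains one power of ‖x‖ at each step. -/
lemma norm_iteratedFDeriv_le_of_flat (φ : 𝓢(E n, ℂ)) (N : ℕ)
    (h : ∀ i ≤ N, iteratedFDeriv ℝ i φ 0 = 0) (d : ℕ) (hd : d ≤ N + 1) (x : E n) :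
    ‖iteratedFDeriv ℝ (N + 1 - d) φ x‖ ≤ SchwartzMap.seminorm ℂ 0 (N + 1) φ * ‖x‖ ^ d := by
  have hA : 0 ≤ SchwartzMap.seminorm ℂ 0 (N + 1) φ := apply_nonneg _ _
  induction d generalizing x with
  | zero => simpa using SchwartzMap.norm_iteratedFDeriv_le_seminorm ℂ φ (N + 1) x
  | succ d ih =>
    have ih := ih (by omega)
    set j := N + 1 - (d + 1) with hj
    have hj1 : N + 1 - d = j + 1 := by omega
    rw [hj1] at ih
    have hdiff : Differentiable ℝ (iteratedFDeriv ℝ j φ) :=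
      (φ.smooth ⊤).differentiable_iteratedFDeriv (by exact_mod_cast ENat.natCast_lt_top j)
    have h1 := (convex_closedBall (0 : E n) ‖x‖).norm_image_sub_le_of_norm_fderiv_le
      (f := iteratedFDeriv ℝ j φ) (C := SchwartzMap.seminorm ℂ 0 (N + 1) φ * ‖x‖ ^ d)
      (fun y _ => hdiff y) (fun y hy => by
        rw [norm_fderiv_iteratedFDeriv]
        refine (ih y).trans (mul_le_mul_of_nonneg_left (pow_le_pow_left₀ (norm_nonneg _) ?_ _) hA)
        simpa using hy) (x := 0) (y := x) (by simp) (by simp)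
    rw [h j (by omega), sub_zero, sub_zero] at h1
    refine h1.trans (le_of_eq ?_)
    ring

/-- On the support ‖x‖ ≤ 2/a. The i derivatives on the cutoff cost a^i, while the other l − i act on
φ and give O(a^-(N+1−l+i)), hence O(a^-(i+1)) since l ≤ N. The net gain is 1/a. -/
lemma seminorm_cutS_le_of_flat (φ : 𝓢(E n, ℂ)) {N : ℕ} (h : ∀ i ≤ N, iteratedFDeriv ℝ i φ 0 = 0)
    {a : ℝ} (ha : 1 ≤ a) (k l : ℕ) (hl : l ≤ N) :
    SchwartzMap.seminorm ℂ k l (cutS a (by positivity) φ) ≤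
      a⁻¹ * ∑ i ∈ Finset.range (l + 1), (l.choose i) * chiBd n i *
        (2 ^ k * 2 ^ (N + 1) * SchwartzMap.seminorm ℂ 0 (N + 1) φ) := by
  have ha0 : 0 < a := by linarith
  have hA : 0 ≤ SchwartzMap.seminorm ℂ 0 (N + 1) φ := apply_nonneg _ _
  have hc0 := chiBd_nonneg n
  have hnn : ∀ i, 0 ≤ (l.choose i) * chiBd n i *
        (2 ^ k * 2 ^ (N + 1) * SchwartzMap.seminorm ℂ 0 (N + 1) φ) := fun i =>
    mul_nonneg (mul_nonneg (Nat.cast_nonneg _) (hc0 i)) (by positivity)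
  refine SchwartzMap.seminorm_le_bound ℂ k l _ (mul_nonneg (by positivity)
    (Finset.sum_nonneg fun i _ => hnn i)) fun x => ?_
  by_cases hx : x ∈ tsupport (cutS a ha0.ne' φ)
  swap
  · have h0 := image_eq_zero_of_notMem_tsupport
      (fun h' => hx (tsupport_iteratedFDeriv_subset (𝕜 := ℝ) l h'))
    rw [h0, norm_zero, mul_zero]
    exact mul_nonneg (by positivity) (Finset.sum_nonneg fun i _ => hnn i)
  have hxa : ‖x‖ ≤ 2 * a⁻¹ := by
    have hcl : IsClosed {y : E n | ‖y‖ ≤ 2 * a⁻¹} := isClosed_le continuous_norm continuous_const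
    refine closure_minimal (fun y hy => ?_) hcl hx
    by_contra hcon
    refine hy ?_
    have : 2 ≤ ‖a • y‖ := by
      rw [norm_smul, Real.norm_of_nonneg ha0.le]
      have h3 : 2 * a⁻¹ < ‖y‖ := not_le.1 hcon
      calc (2 : ℝ) = a * (2 * a⁻¹) := by field_simp
        _ ≤ _ := mul_le_mul_of_nonneg_left h3.le ha0.le
    rw [cutS_apply, chi_eq_zero this, zero_mul]
  have hai : a⁻¹ ≤ 1 := inv_le_one_of_one_le₀ ha
  have hx2 : ‖x‖ ≤ 2 := by linarith
  refine (mul_le_mul_of_nonneg_left (norm_iteratedFDeriv_mul_le (f := fun y : E n => chi (a • y))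
    (contDiff_chi.comp (contDiff_const_smul a)) (φ.smooth ⊤) x
    (by exact_mod_cast le_top)) (by positivity)).trans ?_
  rw [Finset.mul_sum, Finset.mul_sum]
  refine Finset.sum_le_sum fun i hi => ?_
  have hil : i ≤ l := by simpa [Nat.lt_succ_iff] using hi
  rw [iteratedFDeriv_comp_smul contDiff_chi, abs_of_pos ha0]
  have h1 := norm_iteratedFDeriv_chi_le i (a • x)
  have h2 := norm_iteratedFDeriv_le_of_flat φ N h (N + 1 - (l - i)) (by omega) x
  rw [show N + 1 - (N + 1 - (l - i)) = l - i by omega] at h2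
  have h3 : ‖x‖ ^ (N + 1 - (l - i)) ≤ 2 ^ (N + 1) * (a⁻¹ * a⁻¹ ^ i) := by
    calc ‖x‖ ^ (N + 1 - (l - i)) ≤ (2 * a⁻¹) ^ (N + 1 - (l - i)) :=
          pow_le_pow_left₀ (norm_nonneg _) hxa _
      _ = 2 ^ (N + 1 - (l - i)) * a⁻¹ ^ (N + 1 - (l - i)) := mul_pow _ _ _
      _ ≤ 2 ^ (N + 1) * a⁻¹ ^ (i + 1) := by
          refine mul_le_mul (pow_le_pow_right₀ one_le_two (by omega)) ?_ (by positivity) (by positivity)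
          exact pow_le_pow_of_le_one (by positivity) hai (by omega)
      _ = _ := by ring
  have h4 : ‖x‖ ^ k ≤ 2 ^ k := pow_le_pow_left₀ (norm_nonneg _) hx2 _
  calc ‖x‖ ^ k * (↑(l.choose i) * (a ^ i * ‖iteratedFDeriv ℝ i chi (a • x)‖) *
          ‖iteratedFDeriv ℝ (l - i) φ x‖)
      ≤ 2 ^ k * (↑(l.choose i) * (a ^ i * chiBd n i) *
          (SchwartzMap.seminorm ℂ 0 (N + 1) φ * (2 ^ (N + 1) * (a⁻¹ * a⁻¹ ^ i)))) := by
        have := hc0 i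
        gcongr
        exact h2.trans (mul_le_mul_of_nonneg_left h3 hA)
    _ = (a * a⁻¹) ^ i * (a⁻¹ * (↑(l.choose i) * chiBd n i *
        (2 ^ k * 2 ^ (N + 1) * SchwartzMap.seminorm ℂ 0 (N + 1) φ))) := by
        rw [mul_pow]
        ring
    _ = _ := by rw [mul_inv_cancel₀ ha0.ne', one_pow, one_mul]

/-- A tempered distribution supported at the origin kills functions that are flat enough there. -/
lemma exists_order_of_support_zero {S : 𝓢'(E n, ℂ)}
    (hS : ∀ φ : 𝓢(E n, ℂ), HasCompactSupport φ → tsupport φ ⊆ {0}ᶜ → S φ = 0) :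
    ∃ N : ℕ, ∀ φ : 𝓢(E n, ℂ), (∀ i ≤ N, iteratedFDeriv ℝ i φ 0 = 0) → S φ = 0 := by
  let q : Seminorm ℂ 𝓢(E n, ℂ) := (normSeminorm ℂ ℂ).comp (S : 𝓢(E n, ℂ) →ₗ[ℂ] ℂ)
  have hq : Continuous q := continuous_norm.comp (map_continuous S)
  obtain ⟨s, C, -, hC⟩ := Seminorm.bound_of_continuous (schwartz_withSeminorms ℂ (E n) ℂ) q hq
  -- N is the highest derivative order among the finitely many seminorms that control S by
  -- continuity.
  refine ⟨s.sup Prod.snd, fun φ hφ => ?_⟩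
  set N := s.sup Prod.snd with hN
  have hb : ∀ ψ : 𝓢(E n, ℂ), ‖S ψ‖ ≤ C * ∑ i ∈ s, SchwartzMap.seminorm ℂ i.1 i.2 ψ := by
    intro ψ
    refine (hC ψ).trans ?_
    refine mul_le_mul_of_nonneg_left ?_ C.2
    refine Seminorm.finset_sup_apply_le (Finset.sum_nonneg fun i _ => apply_nonneg _ _) fun i hi => ?_
    exact Finset.single_le_sum (f := fun i : ℕ × ℕ => SchwartzMap.seminorm ℂ i.1 i.2 ψ)
      (fun i _ => apply_nonneg _ _) hi
  -- Off a neighbourhood of 0 the distribution sees nothing, so φ may be cut off to any small ball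
  -- without changing the value of S.
  have hcut : ∀ k : ℕ, S φ = S (cutS ((k : ℝ) + 1) k.cast_add_one_ne_zero φ) := by
    intro k
    have hk : (0 : ℝ) < (k : ℝ) + 1 := by positivity
    have h1 : S (φ - cutS ((k : ℝ) + 1) k.cast_add_one_ne_zero φ) = 0 := by
      refine eq_zero_of_tsupport_subset hS _ ?_
      rw [subset_compl_singleton_iff, notMem_tsupport_iff_eventuallyEq]
      filter_upwards [Metric.ball_mem_nhds (0 : E n) (inv_pos.2 hk)] with y hy
      rw [mem_ball_zero_iff] at hy
      change φ y - cutS ((k : ℝ) + 1) k.cast_add_one_ne_zero φ y = 0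
      rw [cutS_apply, chi_eq_one, one_mul, sub_self]
      rw [norm_smul, Real.norm_of_nonneg hk.le]
      calc ((k : ℝ) + 1) * ‖y‖ ≤ (k + 1) * ((k : ℝ) + 1)⁻¹ :=
            mul_le_mul_of_nonneg_left hy.le hk.le
        _ = 1 := mul_inv_cancel₀ hk.ne'
    rw [map_sub] at h1
    exact sub_eq_zero.1 h1
  set D : ℝ := C * ∑ i ∈ s, ∑ j ∈ Finset.range (i.2 + 1), (i.2.choose j) * chiBd n j *
    (2 ^ i.1 * 2 ^ (N + 1) * SchwartzMap.seminorm ℂ 0 (N + 1) φ) with hD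
  have hle : ∀ k : ℕ, ‖S φ‖ ≤ ((k : ℝ) + 1)⁻¹ * D := by
    intro k
    rw [hcut k]
    refine (hb _).trans ?_
    rw [hD, mul_left_comm]
    refine mul_le_mul_of_nonneg_left ?_ C.2
    rw [Finset.mul_sum]
    refine Finset.sum_le_sum fun i hi => ?_
    exact seminorm_cutS_le_of_flat φ hφ (by linarith [Nat.cast_nonneg (α := ℝ) k]) i.1 i.2
      (Finset.le_sup (f := Prod.snd) hi)
  have hlim : Tendsto (fun k : ℕ => ((k : ℝ) + 1)⁻¹ * D) atTop (𝓝 (0 * D)) :=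
    (tendsto_one_div_add_atTop_nhds_zero_nat.congr fun j => one_div _).mul_const _
  rw [zero_mul] at hlim
  exact norm_le_zero_iff.1 (ge_of_tendsto' hlim hle)

end AnisoMult

end

noncomputable section

namespace AnisoMult

variable {n : ℕ} {κ : Fin n → ℕ}

/-! ### Distributions with Fourier transform supported at the origin are polynomials -/

open scoped LineDeriv

/-- The partial derivatives at the origin. -/
def derivAtZero {i : ℕ} (I : Fin i → Fin n) : 𝓢(E n, ℂ) →ₗ[ℂ] ℂ where
  toFun φ := (∂^{fun k => EuclideanSpace.single (I k) (1 : ℝ)} φ : 𝓢(E n, ℂ)) 0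
  map_add' φ ψ := by rw [LineDeriv.iteratedLineDerivOp_add]; rfl
  map_smul' c φ := by rw [LineDeriv.iteratedLineDerivOp_smul]; rfl

lemma iteratedFDeriv_zero_of_derivAtZero {φ : 𝓢(E n, ℂ)} {i : ℕ}
    (h : ∀ I : Fin i → Fin n, derivAtZero I φ = 0) : iteratedFDeriv ℝ i φ 0 = 0 := by
  refine ContinuousMultilinearMap.toMultilinearMap_injective ?_
  refine Module.Basis.ext_multilinear
    (fun _ => (EuclideanSpace.basisFun (Fin n) ℝ).toBasis) fun I => ?_
  have h1 := h I
  change (∂^{fun k => EuclideanSpace.single (I k) (1 : ℝ)} φ : 𝓢(E n, ℂ)) 0 = 0 at h1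
  rw [SchwartzMap.iteratedLineDerivOp_eq_iteratedFDeriv] at h1
  simpa using h1

/-- Linear algebra: a functional vanishing on the common kernel of finitely many functionals is a
combination of them. Thus S is a combination of derivatives of the delta at 0. -/
lemma mem_span_derivAtZero {S : 𝓢'(E n, ℂ)} {N : ℕ}
    (hN : ∀ φ : 𝓢(E n, ℂ), (∀ i ≤ N, iteratedFDeriv ℝ i φ 0 = 0) → S φ = 0) :
    (S : 𝓢(E n, ℂ) →ₗ[ℂ] ℂ) ∈ Submodule.span ℂ
      (Set.range fun p : Σ i : Fin (N + 1), (Fin i → Fin n) => derivAtZero p.2) := by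
  refine mem_span_of_iInf_ker_le_ker fun φ hφ => ?_
  rw [Submodule.mem_iInf] at hφ
  rw [LinearMap.mem_ker]
  refine hN φ fun i hi => iteratedFDeriv_zero_of_derivAtZero fun I => ?_
  exact hφ ⟨⟨i, by omega⟩, I⟩

lemma exists_poly_iteratedLineDeriv {i : ℕ} (I : Fin i → Fin n) :
    ∃ P : MvPolynomial (Fin n) ℂ, ∀ φ : 𝓢(E n, ℂ), ∃ h : 𝓢(E n, ℂ),
      (∂^{fun k => EuclideanSpace.single (I k) (1 : ℝ)} (𝓕⁻ φ : 𝓢(E n, ℂ)) : 𝓢(E n, ℂ)) = 𝓕⁻ h ∧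
        ∀ x, h x = φ x * polyFun P x := by
  induction i with
  | zero =>
    refine ⟨1, fun φ => ⟨φ, LineDeriv.iteratedLineDerivOp_fin_zero _ _, fun x => ?_⟩⟩
    simp [polyFun]
  | succ i ih =>
    obtain ⟨P, hP⟩ := ih (fun k => I k.succ)
    refine ⟨MvPolynomial.C (2 * Real.pi * Complex.I) * MvPolynomial.X (I 0) * P, fun φ => ?_⟩
    obtain ⟨h, hh, hx⟩ := hP φ
    refine ⟨(2 * Real.pi * Complex.I) • SchwartzMap.smulLeftCLM ℂ
      (inner ℝ · (EuclideanSpace.single (I 0) (1 : ℝ))) h, ?_, fun x => ?_⟩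
    · rw [LineDeriv.iteratedLineDerivOp_succ_left, ← SchwartzMap.lineDerivOp_fourierInv_eq, ← hh]
      rfl
    · have ht : (inner ℝ · (EuclideanSpace.single (I 0) (1 : ℝ)) : E n → ℝ).HasTemperateGrowth := by
        fun_prop
      rw [smul_apply, SchwartzMap.smulLeftCLM_apply_apply ht, hx]
      simp [polyFun, EuclideanSpace.inner_single_right]
      ring

lemma fourierInv_apply_zero (φ : 𝓢(E n, ℂ)) : (𝓕⁻ φ : 𝓢(E n, ℂ)) 0 = ∫ x, φ x := by
  rw [SchwartzMap.fourierInv_coe, Real.fourierInv_eq]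
  simp

lemma exists_poly_derivAtZero {i : ℕ} (I : Fin i → Fin n) : ∃ P : MvPolynomial (Fin n) ℂ,
    ∀ φ : 𝓢(E n, ℂ), derivAtZero I (𝓕⁻ φ : 𝓢(E n, ℂ)) = ∫ x, φ x * polyFun P x := by
  obtain ⟨P, hP⟩ := exists_poly_iteratedLineDeriv I
  refine ⟨P, fun φ => ?_⟩
  obtain ⟨h, hh, hx⟩ := hP φ
  change (∂^{fun k => EuclideanSpace.single (I k) (1 : ℝ)} (𝓕⁻ φ : 𝓢(E n, ℂ)) : 𝓢(E n, ℂ)) 0 = _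
  rw [hh, fourierInv_apply_zero]
  simp only [hx]

lemma PolyGrowth.mul {f g : E n → ℂ} (hf : PolyGrowth f) (hg : PolyGrowth g) :
    PolyGrowth fun x => f x * g x := by
  refine ⟨hf.continuous.mul hg.continuous, ?_⟩
  obtain ⟨A, N, hA, h⟩ := hf.exists_nonneg
  obtain ⟨B, M, hB, h'⟩ := hg.exists_nonneg
  refine ⟨A * B, N + M, fun x => ?_⟩
  rw [norm_mul, pow_add]
  calc ‖f x‖ * ‖g x‖ ≤ (A * (1 + ‖x‖) ^ N) * (B * (1 + ‖x‖) ^ M) :=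
        mul_le_mul (h x) (h' x) (norm_nonneg _) (by positivity)
    _ = _ := by ring

lemma polyGrowth_polyFun (P : MvPolynomial (Fin n) ℂ) : PolyGrowth (polyFun P) := by
  induction P using MvPolynomial.induction_on with
  | C a =>
    have : polyFun (MvPolynomial.C a) = fun _ : E n => a := by ext x; simp [polyFun]
    rw [this]
    exact polyGrowth_const a
  | add p q hp hq =>
    have : polyFun (p + q) = fun x : E n => polyFun p x + polyFun q x := by ext x; simp [polyFun]
    rw [this]
    exact hp.add hq
  | mul_X p l hp =>
    have hX : PolyGrowth fun x : E n => (x l : ℂ) := by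
      refine ⟨by fun_prop, 1, 1, fun x => ?_⟩
      rw [Complex.norm_real, one_mul, pow_one]
      linarith [PiLp.norm_apply_le x l]
    have : polyFun (p * MvPolynomial.X l) = fun x : E n => polyFun p x * (x l : ℂ) := by
      ext x
      simp [polyFun]
    rw [this]
    exact hp.mul hX

theorem exists_representedBy_polyFun {v : 𝓢'(E n, ℂ)}
    (hv : ∀ φ : 𝓢(E n, ℂ), HasCompactSupport φ → tsupport φ ⊆ {0}ᶜ → (𝓕 v) φ = 0) :
    ∃ Q : MvPolynomial (Fin n) ℂ, RepresentedBy v (polyFun Q) := by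
  obtain ⟨N, hN⟩ := exists_order_of_support_zero hv
  have hmem := mem_span_derivAtZero hN
  have key : ∀ L ∈ Submodule.span ℂ
      (Set.range fun p : Σ i : Fin (N + 1), (Fin i → Fin n) => derivAtZero p.2),
      ∃ Q : MvPolynomial (Fin n) ℂ, ∀ φ : 𝓢(E n, ℂ),
        L (𝓕⁻ φ : 𝓢(E n, ℂ)) = ∫ x, φ x * polyFun Q x := by
    intro L hL
    induction hL using Submodule.span_induction with
    | mem L hL =>
      obtain ⟨p, rfl⟩ := hL
      exact exists_poly_derivAtZero p.2
    | zero => exact ⟨0, fun φ => by simp [polyFun]⟩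
    | add L L' _ _ h h' =>
      obtain ⟨Q, hQ⟩ := h
      obtain ⟨Q', hQ'⟩ := h'
      refine ⟨Q + Q', fun φ => ?_⟩
      rw [LinearMap.add_apply, hQ, hQ', ← integral_add ((polyGrowth_polyFun Q).integrable_mul φ)
        ((polyGrowth_polyFun Q').integrable_mul φ)]
      simp [polyFun, mul_add]
    | smul c L _ h =>
      obtain ⟨Q, hQ⟩ := h
      refine ⟨MvPolynomial.C c * Q, fun φ => ?_⟩
      rw [LinearMap.smul_apply, hQ, smul_eq_mul, ← integral_const_mul]
      refine integral_congr_ae (Eventually.of_forall fun x => ?_)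
      simp [polyFun]
      ring
  obtain ⟨Q, hQ⟩ := key _ hmem
  refine ⟨Q, fun φ => ⟨(polyGrowth_polyFun Q).integrable_mul φ, ?_⟩⟩
  rw [← hQ φ]
  change v φ = v (𝓕 (𝓕⁻ φ : 𝓢(E n, ℂ)) : 𝓢(E n, ℂ))
  rw [FourierTransform.fourier_fourierInv_eq φ]

/-! ### Consequences for `FourierEqOn` -/

lemma exists_test_mul {m : E n → ℂ} (hm : ContDiffOn ℝ ∞ m {0}ᶜ) {φ : 𝓢(E n, ℂ)}
    (hφ : HasCompactSupport φ) (hs : tsupport φ ⊆ {0}ᶜ) :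
    ∃ ψ : 𝓢(E n, ℂ), ∀ ξ, ψ ξ = m ξ * φ ξ := by
  have hcd : ContDiff ℝ ∞ fun ξ => m ξ * φ ξ := by
    rw [contDiff_iff_contDiffAt]
    intro ξ
    by_cases hξ : ξ ∈ tsupport fun ξ => m ξ * φ ξ
    swap
    · exact contDiffAt_const.congr_of_eventuallyEq (notMem_tsupport_iff_eventuallyEq.1 hξ)
    have h1 : ξ ∈ tsupport φ := closure_mono (Function.support_mul_subset_right _ _) hξ
    exact (hm.contDiffAt (isOpen_compl_singleton.mem_nhds (hs h1))).mul (φ.smooth ⊤).contDiffAt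
  exact ⟨(hφ.mul_left (f := m)).toSchwartzMap hcd, fun ξ => rfl⟩

lemma exists_test_mul_of_vanishing {m : E n → ℂ} (hm : ContDiffOn ℝ ∞ m {0}ᶜ)
    (h0 : ∀ᶠ ξ in 𝓝[≠] (0 : E n), m ξ = 0) {φ : 𝓢(E n, ℂ)}
    (hφ : HasCompactSupport φ) : ∃ ψ : 𝓢(E n, ℂ), ∀ ξ, ξ ≠ 0 → ψ ξ = m ξ * φ ξ := by
  classical
  set m' : E n → ℂ := Function.update m 0 0 with hm'
  have hne : ∀ ξ, ξ ≠ 0 → m' ξ = m ξ := fun ξ hξ => Function.update_of_ne hξ _ _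
  have h1 : m' =ᶠ[𝓝 0] fun _ => 0 := by
    rw [eventually_nhdsWithin_iff] at h0
    filter_upwards [h0] with ξ hξ
    rcases eq_or_ne ξ 0 with rfl | h
    · exact Function.update_self _ _ _
    · rw [hne ξ h, hξ h]
  have hcd : ContDiff ℝ ∞ m' := by
    rw [contDiff_iff_contDiffAt]
    intro ξ
    rcases eq_or_ne ξ 0 with rfl | h
    · exact contDiffAt_const.congr_of_eventuallyEq h1
    · refine (hm.contDiffAt (isOpen_compl_singleton.mem_nhds h)).congr_of_eventuallyEq ?_
      filter_upwards [isOpen_compl_singleton.mem_nhds h] with η hη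
      exact hne η hη
  exact ⟨(hφ.mul_left (f := m')).toSchwartzMap (hcd.mul (φ.smooth ⊤)), fun ξ hξ => by
    change m' ξ * φ ξ = _
    rw [hne ξ hξ]⟩

lemma FourierEqOn.sub_apply {U : Set (E n)} {m : E n → ℂ} {F u u' : 𝓢'(E n, ℂ)}
    (hu : FourierEqOn U m F u) (hu' : FourierEqOn U m F u') {φ ψ : 𝓢(E n, ℂ)}
    (hφ : HasCompactSupport φ) (hs : tsupport φ ⊆ U) (hψ : ∀ ξ, ξ ≠ 0 → ψ ξ = m ξ * φ ξ) :
    (𝓕 (u - u')) φ = 0 := by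
  have h1 := hu φ ψ hφ hs hψ
  have h2 := hu' φ ψ hφ hs hψ
  change u (𝓕 φ : 𝓢(E n, ℂ)) = _ at h1
  change u' (𝓕 φ : 𝓢(E n, ℂ)) = _ at h2
  change u (𝓕 φ : 𝓢(E n, ℂ)) - u' (𝓕 φ : 𝓢(E n, ℂ)) = 0
  rw [h1, h2, sub_self]

lemma FourierEqOn.exists_poly {m : E n → ℂ} (hm : ContDiffOn ℝ ∞ m {0}ᶜ) {F u u' : 𝓢'(E n, ℂ)}
    (hu : FourierEqOn {0}ᶜ m F u) (hu' : FourierEqOn {0}ᶜ m F u') :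
    ∃ Q : MvPolynomial (Fin n) ℂ, RepresentedBy (u - u') (polyFun Q) := by
  refine exists_representedBy_polyFun fun φ hφ hs => ?_
  obtain ⟨ψ, hψ⟩ := exists_test_mul hm hφ hs
  exact hu.sub_apply hu' hφ hs fun ξ _ => hψ ξ

lemma FourierEqOn.unique {m : E n → ℂ} (hm : ContDiffOn ℝ ∞ m {0}ᶜ)
    (h0 : ∀ᶠ ξ in 𝓝[≠] (0 : E n), m ξ = 0) {F u u' : 𝓢'(E n, ℂ)}
    (hu : FourierEqOn univ m F u) (hu' : FourierEqOn univ m F u') : u = u' := by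
  have h1 : ∀ φ : 𝓢(E n, ℂ), HasCompactSupport φ → tsupport φ ⊆ univ → (𝓕 (u - u')) φ = 0 := by
    intro φ hφ hs
    obtain ⟨ψ, hψ⟩ := exists_test_mul_of_vanishing hm h0 hφ
    exact hu.sub_apply hu' hφ hs hψ
  ext φ
  have h2 := eq_zero_of_tsupport_subset h1 (𝓕⁻ φ : 𝓢(E n, ℂ)) (subset_univ _)
  change (u - u') (𝓕 (𝓕⁻ φ : 𝓢(E n, ℂ)) : 𝓢(E n, ℂ)) = 0 at h2
  rw [FourierTransform.fourier_fourierInv_eq φ] at h2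
  exact sub_eq_zero.1 h2

lemma ContinuousRep.add_of_sub {u u' : 𝓢'(E n, ℂ)} {g q : E n → ℂ} (hg : ContinuousRep u' g)
    (hq : PolyGrowth q) (h : RepresentedBy (u - u') q) : ContinuousRep u fun x => g x + q x := by
  have hgg : PolyGrowth g := ⟨hg.continuous, hg.growth⟩
  refine ⟨(hgg.add hq).continuous, (hgg.add hq).growth, fun φ =>
    ⟨(hgg.add hq).integrable_mul φ, ?_⟩⟩
  simp only [mul_add]
  rw [integral_add (hgg.integrable_mul φ) (hq.integrable_mul φ), ← (hg.rep φ).2, ← (h φ).2]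
  change u φ = u' φ + (u φ - u' φ)
  ring

end AnisoMult

end

/-! ### The case f ∈ Lᵖ: identification on the Fourier side and a Liouville theorem. -/

noncomputable section

namespace AnisoMult

variable {n : ℕ} {κ : Fin n → ℕ} {m : E n → ℂ}

/-! ### The `Lᵖ` operators and distributions -/

lemma continuous_toTemperedDistribution_apply {p : ℝ≥0∞} [Fact (1 ≤ p)] (φ : 𝓢(E n, ℂ)) :
    Continuous fun h : Lp ℂ p (volume : Measure (E n)) => (Lp.toTemperedDistribution h) φ :=
  (PointwiseConvergenceCLM.evalCLM (RingHom.id ℂ) ℂ φ).continuous.comp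
    (Lp.toTemperedDistributionCLM ℂ (volume : Measure (E n)) p).continuous

lemma toTemperedDistribution_l2Op (hn : 0 < n) {M : ℝ} (hb : BddMult m M)
    (g : Lp ℂ 2 (volume : Measure (E n))) {φ ψ : 𝓢(E n, ℂ)}
    (hψ : ∀ ξ, ξ ≠ 0 → ψ ξ = m ξ * φ ξ) :
    (Lp.toTemperedDistribution (l2Op m g)) (𝓕 φ : 𝓢(E n, ℂ)) =
      (Lp.toTemperedDistribution g) (𝓕 ψ : 𝓢(E n, ℂ)) := by
  have h1 : ∀ (h : Lp ℂ 2 (volume : Measure (E n))) (η : 𝓢(E n, ℂ)),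
      (Lp.toTemperedDistribution h) (𝓕 η : 𝓢(E n, ℂ)) =
        (Lp.toTemperedDistribution (𝓕 h : Lp ℂ 2 (volume : Measure (E n)))) η := fun h η => by
    rw [← Lp.fourier_toTemperedDistribution_eq]
    rfl
  rw [h1, h1, hb.l2Op_eq, FourierTransform.fourier_fourierInv_eq, Lp.toTemperedDistribution_apply,
    Lp.toTemperedDistribution_apply]
  refine integral_congr_ae ?_
  filter_upwards [MemLp.coeFn_toLp (hb.memLp_mul (Lp.memLp (𝓕 g))), ae_ne_zero hn] with ξ h2 h3
  rw [h2, hψ ξ h3, smul_eq_mul, smul_eq_mul]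
  ring

/-- The identity holds on L² ∩ Lᵖ by Plancherel, and both sides are continuous on Lᵖ, so density
suffices. -/
lemma fourier_extension_apply (hn : 0 < n) {M : ℝ} (hb : BddMult m M) {p : ℝ≥0∞}
    [Fact (1 ≤ p)] (hp : p ≠ ⊤)
    {T : Lp ℂ p (volume : Measure (E n)) →L[ℂ] Lp ℂ p (volume : Measure (E n))}
    (hT : ExtendsL2Op m p (fun h => (T h : E n →ₘ[volume] ℂ)))
    (h : Lp ℂ p (volume : Measure (E n))) {φ ψ : 𝓢(E n, ℂ)} (hψ : ∀ ξ, ξ ≠ 0 → ψ ξ = m ξ * φ ξ) :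
    (Lp.toTemperedDistribution (T h)) (𝓕 φ : 𝓢(E n, ℂ)) =
      (Lp.toTemperedDistribution h) (𝓕 ψ : 𝓢(E n, ℂ)) := by
  have heq : (fun h => (Lp.toTemperedDistribution (T h)) (𝓕 φ : 𝓢(E n, ℂ))) =
      fun h => (Lp.toTemperedDistribution h) (𝓕 ψ : 𝓢(E n, ℂ)) := by
    refine DenseRange.equalizer (denseRange_l2InterLpIncl hp)
      ((continuous_toTemperedDistribution_apply _).comp T.continuous)
      (continuous_toTemperedDistribution_apply _) ?_
    funext g
    have h1 := hT (l2InterLpIncl n p g) g (coeFn_l2InterLpIncl g)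
    have h2 := toTemperedDistribution_l2Op hn hb (g : Lp ℂ 2 (volume : Measure (E n))) hψ
    simp only [Function.comp_apply, Lp.toTemperedDistribution_apply] at h2 ⊢
    refine (integral_congr_ae ?_).trans (h2.trans (integral_congr_ae ?_))
    · filter_upwards [h1] with x hx
      exact congrArg _ hx
    · filter_upwards [coeFn_l2InterLpIncl g] with x hx
      rw [hx]
  exact congrFun heq h

lemma fourierEqOn_extension (hn : 0 < n) (hm : IsMultiplier κ m) {p : ℝ≥0∞}
    [Fact (1 ≤ p)] (hp : p ≠ ⊤)
    {T : Lp ℂ p (volume : Measure (E n)) →L[ℂ] Lp ℂ p (volume : Measure (E n))}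
    (hT : ExtendsL2Op m p (fun h => (T h : E n →ₘ[volume] ℂ))) {f : E n → ℂ}
    (hf : MemLp f p volume) {F : 𝓢'(E n, ℂ)} (hF : RepresentedBy F f) (U : Set (E n)) :
    FourierEqOn U m F (Lp.toTemperedDistribution (T (hf.toLp f))) := by
  obtain ⟨M, -, hb, -⟩ := exists_bddMult hn hm
  intro φ ψ _ _ hψ
  change (Lp.toTemperedDistribution (T (hf.toLp f))) (𝓕 φ : 𝓢(E n, ℂ)) = F (𝓕 ψ : 𝓢(E n, ℂ))
  rw [fourier_extension_apply hn hb hp hT _ hψ, (hF _).2, Lp.toTemperedDistribution_apply]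
  refine integral_congr_ae ?_
  filter_upwards [hf.coeFn_toLp] with x hx
  rw [hx, smul_eq_mul]

lemma memLp_of_continuousRep {p : ℝ≥0∞} [Fact (1 ≤ p)] {h : Lp ℂ p (volume : Measure (E n))}
    {g : E n → ℂ} (hg : ContinuousRep (Lp.toTemperedDistribution h) g) : MemLp g p volume := by
  refine (memLp_congr_ae ?_).1 (Lp.memLp h)
  refine ae_eq_of_integral_contDiff_smul_eq ((Lp.memLp h).locallyIntegrable Fact.out)
    hg.continuous.locallyIntegrable fun w hw hws => ?_
  have hc : HasCompactSupport fun x => (w x : ℂ) := hws.comp_left (g := Complex.ofReal) rfl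
  have hd : ContDiff ℝ ∞ fun x => (w x : ℂ) := Complex.ofRealCLM.contDiff.comp hw
  have h1 := (hg.rep (hc.toSchwartzMap hd)).2
  rw [Lp.toTemperedDistribution_apply] at h1
  exact h1

/-! ### Liouville -/

/-- The quotient (P − P(0))/X tends to 0 along an unbounded sequence, which forces it to be the zero
polynomial. -/
lemma polynomial_eq_C_of_tendsto {P : Polynomial ℂ} {t : ℕ → ℂ}
    (ht : Tendsto (fun k => ‖t k‖) atTop atTop)
    (hP : Tendsto (fun k => (t k)⁻¹ * P.eval (t k)) atTop (𝓝 0)) (s : ℂ) :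
    P.eval s = P.eval 0 := by
  have ht0 : ∀ᶠ k in atTop, t k ≠ 0 := by
    filter_upwards [ht.eventually_gt_atTop 0] with k hk
    exact norm_pos_iff.1 hk
  have hinv : Tendsto (fun k => (t k)⁻¹) atTop (𝓝 0) := by
    rw [tendsto_zero_iff_norm_tendsto_zero]
    simpa only [norm_inv, Function.comp_def] using tendsto_inv_atTop_zero.comp ht
  have h1 : Tendsto (fun k => P.divX.eval (t k)) atTop (𝓝 0) := by
    have h2 := hP.sub (hinv.mul_const (P.coeff 0))
    rw [zero_mul, sub_zero] at h2
    refine h2.congr' ?_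
    filter_upwards [ht0] with k hk
    conv_lhs => rw [← Polynomial.divX_mul_X_add P]
    simp only [Polynomial.eval_add, Polynomial.eval_mul, Polynomial.eval_X, Polynomial.eval_C,
      Polynomial.coeff_add, Polynomial.coeff_mul_X_zero, Polynomial.coeff_C_zero]
    field_simp
    ring
  have h2 : P.divX = 0 := by
    by_cases hdeg : 0 < P.divX.degree
    · have h3 := P.divX.tendsto_norm_atTop hdeg ht
      exact absurd h1.norm (not_tendsto_nhds_of_tendsto_atTop h3 _)
    · have h3 := Polynomial.eq_C_of_degree_le_zero (not_lt.1 hdeg)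
      rw [h3] at h1
      simp only [Polynomial.eval_C] at h1
      rw [h3, tendsto_nhds_unique tendsto_const_nhds h1, Polynomial.C_0]
  rw [← Polynomial.divX_mul_X_add P, h2]
  simp

/-- The restriction of a polynomial to a dilation orbit. -/
def orbitPoly (κ : Fin n → ℕ) (Q : MvPolynomial (Fin n) ℂ) (x : E n) : Polynomial ℂ :=
  MvPolynomial.aeval (fun l => Polynomial.C (x l : ℂ) * Polynomial.X ^ κ l) Q

lemma eval_orbitPoly (Q : MvPolynomial (Fin n) ℂ) (x : E n) (t : ℂ) :
    (orbitPoly κ Q x).eval t = MvPolynomial.eval (fun l => (x l : ℂ) * t ^ κ l) Q := by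
  rw [orbitPoly, ← Polynomial.coe_evalRingHom, MvPolynomial.map_aeval]
  simp only [Polynomial.coe_evalRingHom, Polynomial.eval_mul, Polynomial.eval_C,
    Polynomial.eval_pow, Polynomial.eval_X]
  have : (Polynomial.evalRingHom t).comp (algebraMap ℂ (Polynomial ℂ)) = RingHom.id ℂ := by
    ext z
    simp
  rw [this]
  rfl

lemma eval_orbitPoly_two_pow (Q : MvPolynomial (Fin n) ℂ) (x : E n) (i : ℕ) :
    (orbitPoly κ Q x).eval ((2 : ℂ) ^ i) = polyFun Q (dil κ i x) := by
  rw [eval_orbitPoly, polyFun]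
  congr 2
  funext l
  rw [dil_apply]
  push_cast
  rw [← pow_mul, mul_comm]
  norm_cast

/-- The gauge of δ_{2^i}x is 2^i|x|_κ and the modulus is o(r). The slope ε is chosen so that C|x|_κ
ε < δ/2. -/
lemma HasModulus.tendsto_dil (hκ : ∀ l, 0 < κ l) {f g : E n → ℂ} {C : ℝ≥0} (hf : DiniCondition κ f)
    (hg : HasModulus κ f C g) (x : E n) :
    Tendsto (fun i : ℕ => ((2 : ℂ) ^ i)⁻¹ * g (dil κ i x)) atTop (𝓝 0) := by
  have hpow : Tendsto (fun i : ℕ => ((2 : ℝ) ^ i)⁻¹) atTop (𝓝 0) :=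
    tendsto_inv_atTop_zero.comp (tendsto_pow_atTop_atTop_of_one_lt one_lt_two)
  rw [Metric.tendsto_atTop']
  intro δ hδ
  have hk := knorm_nonneg (κ := κ) x
  set ε : ℝ≥0 := ⟨δ / (2 * (C * knorm κ x + 1)), by positivity⟩ with hε
  have hε0 : 0 < ε := by
    change (0 : ℝ) < δ / (2 * (C * knorm κ x + 1))
    positivity
  obtain ⟨A, hA⟩ := hf.exists_modulusBound_le (ε := (ε : ℝ≥0∞)) (by exact_mod_cast hε0)
  have h1 : ∀ i : ℕ, ‖g (dil κ i x)‖ ≤ ‖g 0‖ + C * (A + 2 ^ i * knorm κ x * ε) := by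
    intro i
    have h2 := (hg (dil κ i x) 0).trans (mul_le_mul_right (hA _ (knorm_nonneg _)) _)
    rw [sub_zero, knorm_dil hκ, zpow_natCast, ← ofReal_norm, ← ENNReal.ofReal_coe_nnreal,
      ← ENNReal.ofReal_coe_nnreal, ← ENNReal.ofReal_coe_nnreal (p := ε),
      ← ENNReal.ofReal_mul (by positivity), ← ENNReal.ofReal_add (by positivity) (by positivity),
      ← ENNReal.ofReal_mul (by positivity), ENNReal.ofReal_le_ofReal_iff (by positivity)] at h2
    have h3 : ‖g (dil κ i x)‖ ≤ ‖g 0‖ + ‖g (dil κ i x) - g 0‖ := by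
      simpa using norm_add_le (g 0) (g (dil κ i x) - g 0)
    linarith
  have h4 : C * knorm κ x * ε < δ / 2 := by
    change C * knorm κ x * (δ / (2 * (C * knorm κ x + 1))) < δ / 2
    have h0 : (0 : ℝ) ≤ C * knorm κ x := by positivity
    rw [mul_div_assoc', div_lt_div_iff₀ (by positivity) two_pos]
    nlinarith
  have h5 := hpow.mul_const (‖g 0‖ + C * A)
  rw [zero_mul] at h5
  obtain ⟨N, hN⟩ := eventually_atTop.1 (h5.eventually (gt_mem_nhds (half_pos hδ)))
  refine ⟨N, fun i hi => ?_⟩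
  rw [dist_zero_right, norm_mul, norm_inv, norm_pow, Complex.norm_two]
  calc ((2 : ℝ) ^ i)⁻¹ * ‖g (dil κ i x)‖
      ≤ ((2 : ℝ) ^ i)⁻¹ * (‖g 0‖ + C * (A + 2 ^ i * knorm κ x * ε)) :=
        mul_le_mul_of_nonneg_left (h1 i) (by positivity)
    _ = ((2 : ℝ) ^ i)⁻¹ * (‖g 0‖ + C * A) + C * knorm κ x * ε := by
        field_simp
        ring
    _ < δ / 2 + δ / 2 := add_lt_add (hN i hi.le) h4
    _ = δ := add_halves δ

/-- Composition with δ_{2^i}, i ≥ 0, does not increase the Lᵖ norm. The factor 2^-i therefore gives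
convergence to 0 in Lᵖ, hence almost everywhere along a subsequence. -/
lemma exists_subseq_tendsto_dil {p : ℝ≥0∞} (hp0 : p ≠ 0) (hp : p ≠ ⊤) {g : E n → ℂ}
    (hg : Continuous g) (hgp : MemLp g p volume) : ∃ ns : ℕ → ℕ, StrictMono ns ∧
      ∀ᵐ x, Tendsto (fun k => ((2 : ℂ) ^ ns k)⁻¹ * g (dil κ (ns k) x)) atTop (𝓝 0) := by
  have hle : ∀ i : ℕ, eLpNorm (fun x => ((2 : ℂ) ^ i)⁻¹ * g (dil κ i x)) p volume ≤
      ENNReal.ofReal ((2 : ℝ) ^ i)⁻¹ * eLpNorm g p volume := by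
    intro i
    have h1 : eLpNorm (g ∘ dil κ i) p volume ≤ eLpNorm g p volume := by
      rw [← eLpNorm_map_measure hg.aestronglyMeasurable (dil κ i).continuous.aemeasurable,
        map_dil_volume, eLpNorm_smul_measure_of_ne_top hp, smul_eq_mul]
      refine mul_le_of_le_one_left' (ENNReal.rpow_le_one ?_ ENNReal.toReal_nonneg)
      rw [← ENNReal.ofReal_one]
      refine ENNReal.ofReal_le_ofReal (zpow_le_one_of_nonpos₀ one_le_two ?_)
      have : (0 : ℤ) ≤ i * (∑ l, κ l : ℕ) := by positivity
      linarith
    have h2 := eLpNorm_const_smul (((2 : ℂ) ^ i)⁻¹) (g ∘ dil κ i) p (volume : Measure (E n))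
    have h3 : ‖((2 : ℂ) ^ i)⁻¹‖ₑ = ENNReal.ofReal ((2 : ℝ) ^ i)⁻¹ := by
      rw [← ofReal_norm, norm_inv, norm_pow, Complex.norm_two]
    rw [h3] at h2
    exact h2.le.trans (mul_le_mul_right h1 _)
  have hlim : Tendsto (fun i : ℕ => ENNReal.ofReal ((2 : ℝ) ^ i)⁻¹ * eLpNorm g p volume) atTop
      (𝓝 0) := by
    have hpow : Tendsto (fun i : ℕ => ((2 : ℝ) ^ i)⁻¹) atTop (𝓝 0) :=
      tendsto_inv_atTop_zero.comp (tendsto_pow_atTop_atTop_of_one_lt one_lt_two)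
    have h1 := ENNReal.Tendsto.mul_const (b := eLpNorm g p volume) (ENNReal.tendsto_ofReal hpow)
      (Or.inr hgp.eLpNorm_lt_top.ne)
    rwa [ENNReal.ofReal_zero, zero_mul] at h1
  refine TendstoInMeasure.exists_seq_tendsto_ae (g := fun _ => (0 : ℂ))
    (f := fun i x => ((2 : ℂ) ^ i)⁻¹ * g (dil κ i x))
    (tendstoInMeasure_of_tendsto_eLpNorm hp0 (fun i => Continuous.aestronglyMeasurable ?_)
      aestronglyMeasurable_const ?_)
  · have := (dil κ i : E n ≃L[ℝ] E n).continuous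
    fun_prop
  · refine tendsto_of_tendsto_of_tendsto_of_le_of_le tendsto_const_nhds hlim (fun _ => zero_le)
      fun i => ?_
    have h0 : ((fun x => ((2 : ℂ) ^ i)⁻¹ * g (dil κ i x)) - fun _ => (0 : ℂ)) =
        fun x => ((2 : ℂ) ^ i)⁻¹ * g (dil κ i x) := by
      ext x
      simp
    rw [h0]
    exact hle i

/-- A polynomial that differs from an `Lᵖ` function by a function of sublinear growth
is constant. -/
lemma polyFun_eq_of_memLp (hκ : ∀ l, 0 < κ l) {f g₀ : E n → ℂ} {C : ℝ≥0} (hf : DiniCondition κ f)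
    (hg₀ : HasModulus κ f C g₀) {Q : MvPolynomial (Fin n) ℂ} {p : ℝ≥0∞} (hp0 : p ≠ 0) (hp : p ≠ ⊤)
    (hmem : MemLp (fun x => g₀ x + polyFun Q x) p volume) (x : E n) : polyFun Q x = polyFun Q 0 := by
  have hc₀ := (hg₀.polyGrowth hκ hf).continuous
  have hcQ := (polyGrowth_polyFun Q).continuous
  obtain ⟨ns, hns, hae⟩ := exists_subseq_tendsto_dil (κ := κ) hp0 hp (hc₀.add hcQ) hmem
  have hns' := hns.tendsto_atTop
  have ht : Tendsto (fun k => ‖(2 : ℂ) ^ ns k‖) atTop atTop := by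
    simp only [norm_pow, Complex.norm_two]
    exact (tendsto_pow_atTop_atTop_of_one_lt one_lt_two).comp hns'
  have h1 : (fun x : E n => polyFun Q x) =ᵐ[volume] fun _ => polyFun Q 0 := by
    filter_upwards [hae] with x hx
    have h2 := hx.sub ((hg₀.tendsto_dil hκ hf x).comp hns')
    rw [sub_zero] at h2
    have h3 : Tendsto (fun k => ((2 : ℂ) ^ ns k)⁻¹ * (orbitPoly κ Q x).eval ((2 : ℂ) ^ ns k)) atTop
        (𝓝 0) := by
      refine h2.congr fun k => ?_
      rw [eval_orbitPoly_two_pow, Function.comp_apply, Pi.add_apply]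
      ring
    -- The polynomial t ↦ Q(δ_t x) is constant. Comparing t = 1 with t = 0 gives Q(x) = Q(0), since
    -- every κₗ is positive.
    have h4 := polynomial_eq_C_of_tendsto ht h3 1
    rw [eval_orbitPoly, eval_orbitPoly] at h4
    simpa [polyFun, fun l => (hκ l).ne'] using h4
  exact congrFun ((Continuous.ae_eq_iff_eq volume hcQ continuous_const).1 h1) x

lemma HasModulus.add_const {f g : E n → ℂ} {C : ℝ≥0} (hg : HasModulus κ f C g) (c : ℂ) :
    HasModulus κ f C fun x => g x + c := by
  intro x y
  rw [add_sub_add_right_eq_sub]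
  exact hg x y

end AnisoMult

end

/-! ### Assembly of the theorem. -/

theorem theorem2p1 {n : ℕ} (hn : 0 < n) (κ : Fin n → ℕ) (hκ : ∀ l, 0 < κ l)
    (m : E n → ℂ) (hm : IsMultiplier κ m) :
    -- (A) weak type (1,1)
    (∃ T : Lp ℂ 1 (volume : Measure (E n)) →ₗ[ℂ] (E n →ₘ[volume] ℂ),
      ExtendsL2Op m 1 T ∧
      ∃ C : ℝ≥0, ∀ (f : Lp ℂ 1 (volume : Measure (E n))) (t : ℝ), 0 < t →
        ENNReal.ofReal t * volume {x | t < ‖T f x‖} ≤ C * eLpNorm f 1 volume) ∧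
    -- (A) strong type (p,p)
    (∀ (p : ℝ≥0∞) [Fact (1 ≤ p)], 1 < p → p < ⊤ →
      ∃ T : Lp ℂ p (volume : Measure (E n)) →L[ℂ] Lp ℂ p (volume : Measure (E n)),
        ExtendsL2Op m p (fun f => (T f : E n →ₘ[volume] ℂ))) ∧
    -- (B)
    (∃ C : ℝ≥0, ∀ f : E n → ℂ, DiniCondition κ f →
      ∃ F : 𝓢'(E n, ℂ), RepresentedBy F f ∧
        (∃ u : 𝓢'(E n, ℂ), FourierEqOn {0}ᶜ m F u) ∧
        (∀ u : 𝓢'(E n, ℂ), FourierEqOn {0}ᶜ m F u →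
          ∃ g : E n → ℂ, ContinuousRep u g ∧
            ∃ Q : MvPolynomial (Fin n) ℂ, HasModulus κ f C (fun x => g x - polyFun Q x)) ∧
        -- `m` supported away from the origin
        ((∀ᶠ ξ in 𝓝[≠] (0 : E n), m ξ = 0) →
          (∃ u : 𝓢'(E n, ℂ), FourierEqOn univ m F u) ∧
          ∀ u : 𝓢'(E n, ℂ), FourierEqOn univ m F u →
            ∃ g : E n → ℂ, ContinuousRep u g ∧ HasModulus κ f C g) ∧
        -- `f` in `Lᵖ`
        (∀ (p : ℝ≥0∞) [Fact (1 ≤ p)], 1 < p → p < ⊤ → ∀ hf : MemLp f p volume,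
          ∀ T : Lp ℂ p (volume : Measure (E n)) →L[ℂ] Lp ℂ p (volume : Measure (E n)),
            ExtendsL2Op m p (fun h => (T h : E n →ₘ[volume] ℂ)) →
            FourierEqOn {0}ᶜ m F (Lp.toTemperedDistribution (T (hf.toLp f))) ∧
            ∃ g : E n → ℂ, ContinuousRep (Lp.toTemperedDistribution (T (hf.toLp f))) g ∧
              HasModulus κ f C g)) := by
  refine ⟨exists_weak_type_extension hn hκ hm,
    fun p _ hp1 hp => exists_strong_type_extension hn hκ hm hp1 hp, ?_⟩
  -- The constant for `liftSum` serves in all cases: every representative is `liftSum` plus a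
  -- polynomial, and in the two special cases that polynomial is a constant, which leaves
  -- differences unchanged.
  obtain ⟨C, hC⟩ := exists_hasModulus_liftSum hn hκ hm
  refine ⟨C, fun f hf => ?_⟩
  have hmod := hC f hf
  have hpg := hmod.polyGrowth hκ hf
  obtain ⟨F, hF⟩ := (hf.polyGrowth hκ).exists_dist
  obtain ⟨u₀, hu₀⟩ := hpg.exists_dist
  have hF := hF.rep
  have heq₀ := fourierEqOn_liftSum hn hκ hm hf hF hu₀.rep
  refine ⟨F, hF, ⟨u₀, heq₀⟩, fun u hu => ?_, fun h0 => ?_, fun p _ hp1 hp hfp T hT => ?_⟩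
  · obtain ⟨Q, hQ⟩ := hu.exists_poly hm.smooth heq₀
    refine ⟨_, hu₀.add_of_sub (polyGrowth_polyFun Q) hQ, Q, ?_⟩
    simpa only [add_sub_cancel_right] using hmod
  · obtain ⟨c, hc⟩ := exists_fourierEqOn_univ hn hκ hm h0 hf hF hpg
    obtain ⟨u₁, hu₁⟩ := (hpg.add (polyGrowth_const c)).exists_dist
    have heq₁ := hc u₁ hu₁.rep
    refine ⟨⟨u₁, heq₁⟩, fun u hu => ⟨_, ?_, hmod.add_const c⟩⟩
    rwa [hu.unique hm.smooth h0 heq₁]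
  · have hu := fourierEqOn_extension hn hm hp.ne hT hfp hF {0}ᶜ
    refine ⟨hu, ?_⟩
    obtain ⟨Q, hQ⟩ := hu.exists_poly hm.smooth heq₀
    have hg := hu₀.add_of_sub (polyGrowth_polyFun Q) hQ
    refine ⟨_, hg, ?_⟩
    have hconst := polyFun_eq_of_memLp hκ hf hmod (zero_lt_one.trans hp1).ne' hp.ne
      (memLp_of_continuousRep hg)
    simp only [hconst]
    exact hmod.add_const _
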